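/- **Conventions.** Graphs are finite multigraphs, loops and multiple edges allowed. A *combinatorial type* is a pair $(G,w)$ with $G$ a connected graph and $w:V(G)\to\mathbb Z_{\ge 0}$ such that every vertex of weight $0$ has valence at least $3$; its genus is $|E(G)|-|V(G)|+1+\sum_v w(v)$. A *tropical curve* $(G,w,l)$ is a combinatorial type with a length function $l:E(G)\to\mathbb R_{>0}$; isomorphisms preserve $w$ and $l$. It is 2-edge-connected if $G$ stays connected after the removal of any set of at most one edge. Let $\Gamma^w$ be the metric graph obtained from $(G,l)$ by adding $w(v)$ loops of arbitrary positive lengths at each vertex $v$. The curve is *hyperelliptic* if $\Gamma^w$ has a divisor of degree $2$ and rank $1$ (for all choices of the lengths of the added loops; as part of the result, one choice suffices). A *constrained type* $(G,w,r)$ is a combinatorial type with an equivalence relation $r$ on $E(G)$. For a union $S$ of classes of $r$, its contraction along $S$ is obtained by contracting the edges in $S$ (contracting a nonloop edge adds the weights of its ends, contracting a loop adds $1$ to the weight of its vertex) and restricting $r$. Its cell is $\overline{C(G,w,r)}=\mathbb R_{\ge0}^{N_r}/\mathrm{Aut}(G,w,r)$, where $N_r$ is the set of classes of $r$; a point of it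 assigns lengths to the edges so that $r$-equivalent edges have equal length. For a collection $\mathcal C$ of constrained types, $M_{\mathcal C}$ is the quotient of $\coprod_{(G,w,r)\in\mathcal C}\overline{C(G,w,r)}$ that identifies two points if the tropical curves obtained by contracting all edges of length zero are isomorphic. Let $G^w_-$ be the loopless graph obtained from $G$ by adding $w(v)$ loops at each $v$ and then placing a new vertex in the interior of every loop. A constrained type $(G,w,r)$ is *2-edge-connected hyperelliptic* if $G$ is 2-edge-connected and either $G^w_-$ has exactly two vertices and $r$ is trivial, or there is a nondegenerate harmonic morphism $\phi$ of degree $2$ (all edges of length $1$) from $G^w_-$ to a tree $T$ such that two distinct edges of $G$ are $r$-equivalent if and only if they are nonloop edges mapped by $\phi$ to the same edge of $T$. It is *hyperelliptic* if every bridge of $G$ is $r$-equivalent only to itself and the contraction of all bridges is 2-edge-connected hyperelliptic. Let $\mathcal C_g^{(2)}$ and $\mathcal C_g$ be the collections of 2-edge-connected hyperelliptic and of hyperelliptic types of genus $g$, and put $H_g^{(2),\mathrm{tr}}=M_{\mathcal C_g^{(2)}}$ and $H_g^{\mathrm{tr}}=M_{\mathcal C_g}$. **Proposition.** Let $g\ge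 0$ be an integer. Sending a point to the tropical curve obtained by contracting all edges of length zero defines 1. a bijection from the points of $H_g^{(2),\mathrm{tr}}$ to the isomorphism classes of 2-edge-connected hyperelliptic tropical curves of genus $g$; 2. a bijection from the points of $H_g^{\mathrm{tr}}$ to the isomorphism classes of hyperelliptic tropical curves of genus $g$. Moreover, let $(G,w,l)$ be a tropical curve of genus $g$ such that $\Gamma^w$ has a divisor of degree $2$ and rank $1$ for some choice of positive lengths of the added loops. Then there is exactly one equivalence relation $r$ on $E(G)$ such that $(G,w,r)\in\mathcal C_g$ and $l$ is constant on the classes of $r$; and if $G$ is 2-edge-connected, there is exactly one such $r$ with $(G,w,r)\in\mathcal C_g^{(2)}$. -/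

import Mathlib

open scoped Classical NNReal Topology

noncomputable section

namespace TropHyp

/-! ### Finite multigraphs -/

/-- A finite multigraph, loops and multiple edges allowed.  Each edge carries a reference
orientation `src e → tgt e`, used only to parametrise it; isomorphisms and morphisms see only the
unordered pair `ends e`. -/
structure Multigraph where
  V : Type
  E : Type
  [fintypeV : Fintype V]
  [fintypeE : Fintype E]
  src : E → V
  tgt : E → V

attribute [instance] Multigraph.fintypeV Multigraph.fintypeE

namespace Multigraph

/-- The unordered pair of end vertices of an edge. -/
def ends (G : Multigraph) (e : G.E) : Sym2 G.V := s(G.src e, G.tgt e)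

def IsLoop (G : Multigraph) (e : G.E) : Prop := G.src e = G.tgt e

/-- The number of edge ends at `v`: a loop at `v` counts twice. -/
def valence (G : Multigraph) (v : G.V) : ℕ :=
  Nat.card {e : G.E // G.src e = v} + Nat.card {e : G.E // G.tgt e = v}

/-- Two vertices are equivalent if they are joined by a path all of whose edges lie in `S`. -/
def joinSetoid (G : Multigraph) (S : Set G.E) : Setoid G.V :=
  Relation.EqvGen.setoid fun a b => ∃ e ∈ S, G.ends e = s(a, b)

/-- The spanning subgraph with edge set `S` is connected. -/
def ConnectedBy (G : Multigraph) (S : Set G.E) : Prop :=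
  Nonempty G.V ∧ ∀ a b : G.V, (G.joinSetoid S) a b

def Connected (G : Multigraph) : Prop := G.ConnectedBy Set.univ

/-- Removing any set of at most one edge leaves a connected graph. -/
def TwoEdgeConnected (G : Multigraph) : Prop :=
  ∀ F : Finset G.E, F.card ≤ 1 → G.ConnectedBy {e | e ∉ F}

/-- In a connected graph: an edge whose removal disconnects the graph. -/
def IsBridge (G : Multigraph) (e : G.E) : Prop := ¬ G.ConnectedBy {e' | e' ≠ e}

/-- A tree: a connected graph without cycles, that is, connected with every edge a bridge. -/
def IsTree (G : Multigraph) : Prop := G.Connected ∧ ∀ e : G.E, G.IsBridge e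

/-- The loopless graph obtained by placing one new vertex in the interior of each loop. -/
def subdivideLoops (G : Multigraph) : Multigraph where
  V := G.V ⊕ {e : G.E // G.IsLoop e}
  E := {e : G.E // ¬ G.IsLoop e} ⊕ ({e : G.E // G.IsLoop e} × Bool)
  src
    | .inl e => .inl (G.src e.1)
    | .inr (e, false) => .inl (G.src e.1)
    | .inr (e, true) => .inr e
  tgt
    | .inl e => .inl (G.tgt e.1)
    | .inr (e, false) => .inr e
    | .inr (e, true) => .inl (G.tgt e.1)

/-- An isomorphism of multigraphs. -/
structure Iso (G H : Multigraph) where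
  onV : G.V ≃ H.V
  onE : G.E ≃ H.E
  ends_map : ∀ e, H.ends (onE e) = (G.ends e).map onV

namespace Iso

def refl (G : Multigraph) : Iso G G where
  onV := Equiv.refl _
  onE := Equiv.refl _
  ends_map e := by simp

def symm {G H : Multigraph} (φ : Iso G H) : Iso H G where
  onV := φ.onV.symm
  onE := φ.onE.symm
  ends_map e := by
    have h := φ.ends_map (φ.onE.symm e)
    rw [Equiv.apply_symm_apply] at h
    rw [h, Sym2.map_map]
    simp

def trans {G H K : Multigraph} (φ : Iso G H) (ψ : Iso H K) : Iso G K where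
  onV := φ.onV.trans ψ.onV
  onE := φ.onE.trans ψ.onE
  ends_map e := by
    simp [ψ.ends_map, φ.ends_map, Sym2.map_map]

end Iso

/-! ### Harmonic morphisms of (non-metric) loopless graphs -/

/-- A morphism of loopless graphs: a map `V(G) ∪ E(G) → V(H) ∪ E(H)` taking vertices to vertices,
and taking an edge either to a vertex (together with both its ends) or to an edge joining the
images of its ends. -/
structure Morphism (G H : Multigraph) where
  onV : G.V → H.V
  onE : G.E → H.V ⊕ H.E
  vertical : ∀ e y, onE e = Sum.inl y → ∀ x ∈ G.ends e, onV x = y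
  horizontal : ∀ e e', onE e = Sum.inr e' → H.ends e' = (G.ends e).map onV

namespace Morphism

variable {G H : Multigraph}

/-- The number of edges at `x` that lie over `e'`.  All edges have length one, so that all
stretching factors are one. -/
def multAt (φ : Morphism G H) (x : G.V) (e' : H.E) : ℕ :=
  Nat.card {e : G.E // x ∈ G.ends e ∧ φ.onE e = Sum.inr e'}

/-- `multAt φ x e'` is the same for all edges `e'` at the vertex `φ x`. -/
def Harmonic (φ : Morphism G H) : Prop :=
  ∀ x : G.V, ∀ e₁ e₂ : H.E, φ.onV x ∈ H.ends e₁ → φ.onV x ∈ H.ends e₂ →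
    φ.multAt x e₁ = φ.multAt x e₂

/-- The horizontal multiplicity of a harmonic morphism is positive at every vertex. -/
def Nondegenerate (φ : Morphism G H) : Prop :=
  ∀ x : G.V, ∃ e' : H.E, φ.onV x ∈ H.ends e' ∧ 0 < φ.multAt x e'

/-- The degree is the number of edges over any edge of the target, and zero if the target has no
edges. -/
def HasDegree (φ : Morphism G H) (d : ℕ) : Prop :=
  (∀ e' : H.E, Nat.card {e : G.E // φ.onE e = Sum.inr e'} = d) ∧ (IsEmpty H.E → d = 0)

end Morphism

end Multigraph

/-! ### Vertex weights and contraction -/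

/-- A multigraph with nonnegative integer vertex weights. -/
structure WGraph extends Multigraph where
  w : V → ℕ

namespace WGraph

/-- Every vertex of weight zero has valence at least three. -/
def Stable (G : WGraph) : Prop := ∀ v, G.w v = 0 → 3 ≤ G.valence v

/-- A combinatorial type of tropical curves. -/
def IsType (G : WGraph) : Prop := G.Connected ∧ G.Stable

def genus (G : WGraph) : ℤ :=
  (Nat.card G.E : ℤ) - (Nat.card G.V : ℤ) + 1 + ∑ v, (G.w v : ℤ)

/-- The graph `G^w`: add `w v` loops at each vertex `v`. -/
def addLoops (G : WGraph) : Multigraph where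
  V := G.V
  E := G.E ⊕ (Σ v : G.V, Fin (G.w v))
  src
    | .inl e => G.src e
    | .inr p => p.1
  tgt
    | .inl e => G.tgt e
    | .inr p => p.1

/-- The weight of the vertex that a component `c` of the subgraph with edge set `S` is contracted
to.  Each nonloop contraction adds the weights of the two ends and each loop contraction adds one;
in total this gives the sum of the weights in `c` plus the first Betti number of `c`.  (The
subtraction does not truncate, as `c` is connected.) -/
def contractWeight (G : WGraph) (S : Set G.E) (c : Quotient (G.joinSetoid S)) : ℕ :=
  (∑ v : {v : G.V // (Quotient.mk (G.joinSetoid S) v) = c}, G.w v.1) +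
    (Nat.card {e : G.E // e ∈ S ∧ Quotient.mk (G.joinSetoid S) (G.src e) = c} + 1 -
      Nat.card {v : G.V // Quotient.mk (G.joinSetoid S) v = c})

/-- The contraction of all edges in `S`. -/
def contract (G : WGraph) (S : Set G.E) : WGraph where
  V := Quotient (G.joinSetoid S)
  E := {e : G.E // e ∉ S}
  src e := Quotient.mk _ (G.src e.1)
  tgt e := Quotient.mk _ (G.tgt e.1)
  w := G.contractWeight S

end WGraph

/-! ### Constrained types -/

/-- A weighted graph with an equivalence relation on its edges. -/
structure CGraph extends WGraph where
  r : Setoid E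

namespace CGraph

/-- The contraction of all edges in `S`, a union of classes of `r`, with the restricted relation. -/
def contract (T : CGraph) (S : Set T.E) : CGraph where
  toWGraph := T.toWGraph.contract S
  r := T.r.comap Subtype.val

/-- `G^w_-`: add `w v` loops at each `v`, then place a vertex in the interior of each loop. -/
def loopless (T : CGraph) : Multigraph := T.addLoops.subdivideLoops

/-- A nonloop edge of `G`, regarded as an edge of `G^w_-`. -/
def looplessEdge (T : CGraph) (e : T.E) (he : ¬ T.IsLoop e) : T.loopless.E :=
  Sum.inl ⟨Sum.inl e, he⟩

/-- 2-edge-connected hyperelliptic types: `G` is 2-edge-connected, and either `G^w_-` has two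
vertices and `r` is trivial, or `G^w_-` has a nondegenerate harmonic morphism `φ` of degree two to
a tree such that two distinct edges are related if and only if they are nonloop edges that `φ`
maps to the same edge of the tree. -/
def TwoHyperelliptic (T : CGraph) : Prop :=
  T.TwoEdgeConnected ∧
    ((Nat.card T.loopless.V = 2 ∧ ∀ e e', T.r e e' ↔ e = e') ∨
      ∃ (K : Multigraph) (φ : T.loopless.Morphism K),
        K.IsTree ∧ φ.Harmonic ∧ φ.Nondegenerate ∧ φ.HasDegree 2 ∧
        ∀ e e', T.r e e' ↔ e = e' ∨
          ∃ (he : ¬ T.IsLoop e) (he' : ¬ T.IsLoop e') (k : K.E),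
            φ.onE (T.looplessEdge e he) = Sum.inr k ∧ φ.onE (T.looplessEdge e' he') = Sum.inr k)

/-- Hyperelliptic types: every bridge is related only to itself, and contracting all bridges gives
a 2-edge-connected hyperelliptic type. -/
def Hyperelliptic (T : CGraph) : Prop :=
  (∀ e e', T.IsBridge e → T.r e e' → e = e') ∧
    (T.contract {e | T.IsBridge e}).TwoHyperelliptic

end CGraph

/-- The collection of 2-edge-connected hyperelliptic types of genus `g`. -/
def twoTypes (g : ℕ) : Set CGraph := {T | T.IsType ∧ T.genus = g ∧ T.TwoHyperelliptic}

/-- The collection of hyperelliptic types of genus `g`. -/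
def types (g : ℕ) : Set CGraph := {T | T.IsType ∧ T.genus = g ∧ T.Hyperelliptic}

/-! ### Metric graphs, divisors and rank -/

/-- A multigraph with edge lengths. -/
structure Model extends Multigraph where
  len : E → ℝ

namespace Model

/-- The points of the metric graph of a model with positive lengths: the vertices, and the interior
points of the edges. -/
def Point (M : Model) : Type := M.V ⊕ (Σ e : M.E, Set.Ioo (0 : ℝ) (M.len e))

/-- The parametrisation of the closed edge `e` by `[0, len e]`, extended constantly to the real
line. -/
def edgePoint (M : Model) (e : M.E) (t : ℝ) : M.Point :=
  if h : t ∈ Set.Ioo (0 : ℝ) (M.len e) then Sum.inr ⟨e, t, h⟩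
  else if t ≤ 0 then Sum.inl (M.src e) else Sum.inl (M.tgt e)

/-- Rational functions: continuous and piecewise linear with integer slopes, with finitely many
pieces. -/
def IsRational (M : Model) (f : M.Point → ℝ) : Prop :=
  ∀ e : M.E, ContinuousOn (fun t => f (M.edgePoint e t)) (Set.Icc 0 (M.len e)) ∧
    ∃ B : Finset ℝ, ∀ t ∈ Set.Ioo (0 : ℝ) (M.len e), t ∉ B →
      ∃ n : ℤ, ∀ᶠ s in 𝓝 t, f (M.edgePoint e s) = f (M.edgePoint e t) + n * (s - t)

/-- The slope of `f` along `e`, outgoing from the point at `t`, in the direction of increasing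
parameter. -/
def slopeFwd (M : Model) (f : M.Point → ℝ) (e : M.E) (t : ℝ) : ℝ :=
  derivWithin (fun s => f (M.edgePoint e s)) (Set.Ici t) t

/-- The slope of `f` along `e`, outgoing from the point at `t`, in the direction of decreasing
parameter. -/
def slopeBwd (M : Model) (f : M.Point → ℝ) (e : M.E) (t : ℝ) : ℝ :=
  - derivWithin (fun s => f (M.edgePoint e s)) (Set.Iic t) t

/-- The sum of the outgoing slopes of `f` at a point. -/
def divAt (M : Model) (f : M.Point → ℝ) : M.Point → ℝ
  | .inl v => (∑ e : {e : M.E // M.src e = v}, M.slopeFwd f e.1 0) +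
      ∑ e : {e : M.E // M.tgt e = v}, M.slopeBwd f e.1 (M.len e.1)
  | .inr ⟨e, t⟩ => M.slopeFwd f e t.1 + M.slopeBwd f e t.1

/-- Divisors: formal integer combinations of points. -/
abbrev Div (M : Model) : Type := M.Point →₀ ℤ

def deg (M : Model) (D : M.Div) : ℤ := D.sum fun _ n => n

def IsPrincipal (M : Model) (D : M.Div) : Prop :=
  ∃ f : M.Point → ℝ, M.IsRational f ∧ ∀ x, (D x : ℝ) = M.divAt f x

def LinEquiv (M : Model) (D D' : M.Div) : Prop := M.IsPrincipal (D - D')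

/-- The rank of `D` is `k`. -/
def HasRank (M : Model) (D : M.Div) (k : ℤ) : Prop :=
  IsGreatest {j : ℤ | ∀ A : M.Div, 0 ≤ A → M.deg A = j →
    ∃ A' : M.Div, 0 ≤ A' ∧ M.LinEquiv (D - A) A'} k

/-- A metric graph is hyperelliptic if it has a divisor of degree two and rank one. -/
def Hyperelliptic (M : Model) : Prop := ∃ D : M.Div, M.deg D = 2 ∧ M.HasRank D 1

end Model

/-! ### Abstract tropical curves -/

/-- A weighted graph with edge lengths. -/
structure Curve extends WGraph where
  len : E → ℝ

namespace Curve

/-- Abstract tropical curves: connected, stable, with positive edge lengths. -/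
def IsTropical (X : Curve) : Prop := X.IsType ∧ ∀ e, 0 < X.len e

/-- The metric graph `Γ^w`: at each vertex `v`, add `w v` loops, with lengths given by `ℓ`. -/
def addLoopsModel (X : Curve) (ℓ : (Σ v : X.V, Fin (X.w v)) → ℝ) : Model where
  toMultigraph := X.addLoops
  len := Sum.elim X.len ℓ

/-- `X` is hyperelliptic if `Γ^w` is, for all choices of the lengths of the added loops. -/
def Hyperelliptic (X : Curve) : Prop :=
  ∀ ℓ : (Σ v : X.V, Fin (X.w v)) → ℝ, (∀ p, 0 < ℓ p) → (X.addLoopsModel ℓ).Hyperelliptic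

/-- `X` with its lengths forgotten and constrained by the relation `r`. -/
def constrain (X : Curve) (r : Setoid X.E) : CGraph where
  toWGraph := X.toWGraph
  r := r

/-- Isomorphism of tropical curves: a graph isomorphism preserving weights and lengths. -/
def Isomorphic (X Y : Curve) : Prop :=
  ∃ φ : X.toMultigraph.Iso Y.toMultigraph,
    (∀ v, Y.w (φ.onV v) = X.w v) ∧ ∀ e, Y.len (φ.onE e) = X.len e

instance isoSetoid : Setoid Curve where
  r := Isomorphic
  iseqv :=
    { refl := fun X => ⟨Multigraph.Iso.refl _, fun _ => rfl, fun _ => rfl⟩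
      symm := by
        rintro X Y ⟨φ, hw, hl⟩
        refine ⟨φ.symm, fun v => ?_, fun e => ?_⟩
        · have h := hw (φ.onV.symm v)
          rw [Equiv.apply_symm_apply] at h
          exact h.symm
        · have h := hl (φ.onE.symm e)
          rw [Equiv.apply_symm_apply] at h
          exact h.symm
      trans := by
        rintro X Y Z ⟨φ, hw, hl⟩ ⟨ψ, hw', hl'⟩
        exact ⟨φ.trans ψ, fun v => (hw' _).trans (hw v), fun e => (hl' _).trans (hl e)⟩ }

/-- Isomorphism classes. -/
abbrev Class : Type 1 := Quotient isoSetoid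

end Curve

/-! ### The cells and the space of a collection of constrained types -/

namespace CGraph

/-- A graph automorphism compatible with the weights and with the relation. -/
def IsAut (T : CGraph) (φ : T.toMultigraph.Iso T.toMultigraph) : Prop :=
  (∀ v, T.w (φ.onV v) = T.w v) ∧ ∀ e e', T.r e e' ↔ T.r (φ.onE e) (φ.onE e')

/-- The orthant with one coordinate for each class of `r`. -/
abbrev Orthant (T : CGraph) : Type := Quotient T.r → ℝ≥0

/-- The coordinate of the class of `e`: the length that the point `x` assigns to `e`. -/
def lengthOf (T : CGraph) (x : T.Orthant) (e : T.E) : ℝ≥0 := x (Quotient.mk T.r e)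

/-- Two points are in the same orbit of the automorphism group, which permutes coordinates. -/
def orbitSetoid (T : CGraph) : Setoid T.Orthant where
  r x y := ∃ φ, T.IsAut φ ∧ ∀ e, T.lengthOf y (φ.onE e) = T.lengthOf x e
  iseqv :=
    { refl := fun x => ⟨Multigraph.Iso.refl _, ⟨fun _ => rfl, fun _ _ => Iff.rfl⟩, fun _ => rfl⟩
      symm := by
        rintro x y ⟨φ, ⟨hw, hr⟩, hl⟩
        refine ⟨φ.symm, ⟨fun v => ?_, fun e e' => ?_⟩, fun e => ?_⟩
        · have h := hw (φ.onV.symm v)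
          rw [Equiv.apply_symm_apply] at h
          exact h.symm
        · have h := hr (φ.onE.symm e) (φ.onE.symm e')
          rw [Equiv.apply_symm_apply, Equiv.apply_symm_apply] at h
          exact h.symm
        · have h := hl (φ.onE.symm e)
          rw [Equiv.apply_symm_apply] at h
          exact h.symm
      trans := by
        rintro x y z ⟨φ, ⟨hw, hr⟩, hl⟩ ⟨ψ, ⟨hw', hr'⟩, hl'⟩
        exact ⟨φ.trans ψ, ⟨fun v => (hw' _).trans (hw v),
          fun e e' => (hr e e').trans (hr' _ _)⟩, fun e => (hl' _).trans (hl e)⟩ }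

/-- The cell of `T`: the quotient of the orthant by the automorphism group. -/
def Cell (T : CGraph) : Type := Quotient T.orbitSetoid

instance (T : CGraph) : TopologicalSpace T.Cell :=
  inferInstanceAs (TopologicalSpace (Quotient T.orbitSetoid))

/-- The tropical curve obtained from the lengths `x` by contracting all edges of length zero. -/
def curveOf (T : CGraph) (x : T.Orthant) : Curve where
  toWGraph := T.toWGraph.contract {e | T.lengthOf x e = 0}
  len e := T.lengthOf x e.1

end CGraph

theorem joinSetoid_map {G H : Multigraph} (φ : G.Iso H) (S : Set G.E) (S' : Set H.E)
    (h : ∀ e, e ∈ S → φ.onE e ∈ S') {a b : G.V} (hab : G.joinSetoid S a b) :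
    H.joinSetoid S' (φ.onV a) (φ.onV b) := by
  induction hab with
  | rel a b h1 =>
    obtain ⟨e, he, h2⟩ := h1
    exact Relation.EqvGen.rel _ _ ⟨φ.onE e, h e he, by rw [φ.ends_map, h2]; simp⟩
  | refl a => exact Relation.EqvGen.refl _
  | symm a b _ ih => exact Relation.EqvGen.symm _ _ ih
  | trans a b c _ _ ih1 ih2 => exact Relation.EqvGen.trans _ _ _ ih1 ih2

theorem joinSetoid_iff {G H : Multigraph} (φ : G.Iso H) (S : Set G.E) (S' : Set H.E)
    (h : ∀ e, e ∈ S ↔ φ.onE e ∈ S') (a b : G.V) :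
    G.joinSetoid S a b ↔ H.joinSetoid S' (φ.onV a) (φ.onV b) := by
  refine ⟨joinSetoid_map φ S S' fun e => (h e).1, fun hab => ?_⟩
  have := joinSetoid_map φ.symm S' S (fun e he => by
    have := h (φ.symm.onE e)
    rw [this]
    simpa [Multigraph.Iso.symm] using he) hab
  simpa [Multigraph.Iso.symm] using this

theorem src_class {G H : Multigraph} (φ : G.Iso H) (S' : Set H.E) (e : G.E)
    (he : φ.onE e ∈ S') :
    H.joinSetoid S' (φ.onV (G.src e)) (H.src (φ.onE e)) := by
  have h := φ.ends_map e
  simp only [Multigraph.ends, Sym2.map_mk, Sym2.eq_iff] at h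
  rcases h with ⟨h1, _⟩ | ⟨h1, h2⟩
  · rw [h1]
  · rw [← h2]
    exact Relation.EqvGen.rel _ _ ⟨_, he, Sym2.eq_swap⟩

theorem CGraph.curveOf_isomorphic (T : CGraph) (x y : T.Orthant) (h : T.orbitSetoid x y) :
    (T.curveOf x).Isomorphic (T.curveOf y) := by
  obtain ⟨φ, ⟨hw, _⟩, hl⟩ := h
  have hS : ∀ e, e ∈ {e | T.lengthOf x e = 0} ↔ φ.onE e ∈ {e | T.lengthOf y e = 0} := by
    intro e
    simp [hl]
  have hj := joinSetoid_iff φ _ _ hS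
  let fV := Quotient.congr (ra := T.joinSetoid {e | T.lengthOf x e = 0})
    (rb := T.joinSetoid {e | T.lengthOf y e = 0}) φ.onV hj
  let fE : {e : T.E // e ∉ {e | T.lengthOf x e = 0}} ≃
      {e : T.E // e ∉ {e | T.lengthOf y e = 0}} :=
    φ.onE.subtypeEquiv fun e => not_congr (hS e)
  refine ⟨⟨fV, fE, ?_⟩, ?_, ?_⟩
  · rintro ⟨e, he⟩
    have h := congrArg (Sym2.map (Quotient.mk (T.joinSetoid {e | T.lengthOf y e = 0})))
      (φ.ends_map e)
    exact h
  · intro (c : Quotient (T.joinSetoid {e | T.lengthOf x e = 0}))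
    have hv : ∀ v : T.V, Quotient.mk (T.joinSetoid {e | T.lengthOf x e = 0}) v = c ↔
        Quotient.mk (T.joinSetoid {e | T.lengthOf y e = 0}) (φ.onV v) = fV c := by
      intro v
      rw [← fV.apply_eq_iff_eq]
      rfl
    have e1 : {v : T.V // Quotient.mk (T.joinSetoid {e | T.lengthOf x e = 0}) v = c} ≃
        {v : T.V // Quotient.mk (T.joinSetoid {e | T.lengthOf y e = 0}) v = fV c} :=
      φ.onV.subtypeEquiv (p := fun v => _ = c) (q := fun v => _ = fV c) hv
    have e2 : {e : T.E // e ∈ {e | T.lengthOf x e = 0} ∧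
          Quotient.mk (T.joinSetoid {e | T.lengthOf x e = 0}) (T.src e) = c} ≃
        {e : T.E // e ∈ {e | T.lengthOf y e = 0} ∧
          Quotient.mk (T.joinSetoid {e | T.lengthOf y e = 0}) (T.src e) = fV c} :=
      φ.onE.subtypeEquiv fun e => by
        rw [hS e]
        refine and_congr_right fun he => ?_
        rw [hv, Quotient.sound (src_class φ _ e he)]
    change WGraph.contractWeight _ _ (fV c) = WGraph.contractWeight _ _ c
    unfold WGraph.contractWeight
    rw [← Nat.card_congr e2, ← Nat.card_congr e1]
    refine congrArg (fun n => n + _) (Fintype.sum_equiv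
      (φ.onV.subtypeEquiv (p := fun v => _ = c) (q := fun v => _ = fV c) hv) _ _ fun v => ?_).symm
    exact (hw v.1).symm
  · rintro ⟨e, he⟩
    exact congrArg NNReal.toReal (hl e)

namespace CGraph

/-- The isomorphism class of the tropical curve that a point of a cell represents. -/
def cellClass (T : CGraph) : T.Cell → Curve.Class :=
  Quotient.map' (s₁ := T.orbitSetoid) (s₂ := Curve.isoSetoid) T.curveOf T.curveOf_isomorphic

end CGraph

/-- The disjoint union of the cells of the types in a collection. -/
abbrev Cells (C : Set CGraph) : Type 1 := Σ T : C, T.1.Cell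

/-- Two points are identified if the tropical curves they represent, after contraction of the
edges of length zero, are isomorphic. -/
def glueSetoid (C : Set CGraph) : Setoid (Cells C) :=
  Setoid.ker fun p : Cells C => p.1.1.cellClass p.2

/-- The space of a collection of constrained types. -/
def Space (C : Set CGraph) : Type 1 := Quotient (glueSetoid C)

instance (C : Set CGraph) : TopologicalSpace (Space C) :=
  inferInstanceAs (TopologicalSpace (Quotient (glueSetoid C)))

/-- The tropical curve, up to isomorphism, represented by a point of the space. -/
def Space.toClass {C : Set CGraph} : Space C → Curve.Class :=
  Quotient.lift (s := glueSetoid C) (fun p : Cells C => p.1.1.cellClass p.2) fun _ _ h => h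

/-- The space of 2-edge-connected tropical hyperelliptic curves of genus `g`. -/
abbrev TwoHypSpace (g : ℕ) : Type 1 := Space (twoTypes g)

/-- The space of tropical hyperelliptic curves of genus `g`. -/
abbrev HypSpace (g : ℕ) : Type 1 := Space (types g)

/-- Isomorphism classes of hyperelliptic tropical curves of genus `g`. -/
def hypClasses (g : ℕ) : Set Curve.Class :=
  {κ | ∃ X : Curve, X.IsTropical ∧ X.genus = g ∧ X.Hyperelliptic ∧
    κ = Quotient.mk Curve.isoSetoid X}

/-- Isomorphism classes of 2-edge-connected hyperelliptic tropical curves of genus `g`. -/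
def twoHypClasses (g : ℕ) : Set Curve.Class :=
  {κ | ∃ X : Curve, X.IsTropical ∧ X.genus = g ∧ X.TwoEdgeConnected ∧ X.Hyperelliptic ∧
    κ = Quotient.mk Curve.isoSetoid X}

end TropHyp

end

/-! Injectivity is built in: the gluing relation is the kernel of the map to isomorphism classes. It
remains to see that every point of a cell represents a hyperelliptic curve, and that every
hyperelliptic curve carries exactly one relation `r` that makes it a point with positive coordinates
of a cell.

Both follow by comparing the two notions of hyperellipticity, for types and for metric graphs, with
a third one: a combinatorial involution (`HypInv`, `WHypInv`). It acts on edges and, modulo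
contraction of a set of bridges, on vertices. It fixes the vertices of positive weight, and an edge
outside the contracted set is either flipped or forms, with its partner, an edge cut with invariant
sides.

Types: a nondegenerate harmonic morphism of degree two to a tree has fibres with at most two
elements, and swapping these is such an involution (`Morphism.exists_hypInv`). Conversely, the
quotient by the involution, with the flipped edges collapsed, is a tree because of the cuts
(`quot_isTree`), and the quotient map is harmonic. If no edge of `G^w_-` has a partner, this graph
has two vertices (`card_loopless`).

Metric graphs: if the involution preserves lengths, a chip at a vertex and a chip at its conjugate
can be moved over the whole graph in parallel, which gives a divisor of degree two and rank one
(`hyperelliptic_of_hypInv`). Conversely, let `D` have degree two and rank one. After contracting the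
bridges, different points are inequivalent (`eq_of_chip_linEquiv`), so `D ~ x + x'` determines the
conjugate `x'` of `x`. For a function with divisor `p + q - x - y`, where `p` is neither `x` nor
`y`, the lowest level is crossed by exactly two pieces, of slope one, that begin at `p` and `q`
(`exists_straddle`). So conjugation is an isometry along edges. As all valences are at least three
once loops are added, it takes vertices to vertices and edges to edges of the same length
(`Model.exists_hypInv`).

Contraction: an invariant set of edges can be contracted equivariantly. A contracted component that
is not kept in place is a tree without weights, so all weight that arises sits at fixed vertices
(`join_onV_of_contractWeight`). Hence boundary points of cells are hyperelliptic too.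

Uniqueness of `r`: in a stable 2-edge-connected graph, two different edges are partners if and only
if removing both disconnects the graph (`onE_eq_iff`), a condition that does not mention the
involution. -/

noncomputable section

namespace TropHyp

section

/-! ### Connectedness by a set of edges -/

namespace Multigraph

variable {G : Multigraph}

theorem join_edge {S : Set G.E} {e : G.E} (he : e ∈ S) :
    G.joinSetoid S (G.src e) (G.tgt e) :=
  Relation.EqvGen.rel _ _ ⟨e, he, rfl⟩

/-- The universal property of the generated relation. Most connectivity arguments below consist in
choosing `s`. -/
theorem joinSetoid_le {S : Set G.E} (s : Setoid G.V)
    (h : ∀ e ∈ S, s (G.src e) (G.tgt e)) {a b : G.V} (hab : G.joinSetoid S a b) : s a b := by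
  induction hab with
  | rel a b h1 =>
    obtain ⟨e, he, h2⟩ := h1
    rcases Sym2.eq_iff.1 h2 with ⟨rfl, rfl⟩ | ⟨rfl, rfl⟩
    · exact h e he
    · exact s.symm (h e he)
  | refl a => exact s.refl a
  | symm a b _ ih => exact s.symm ih
  | trans a b c _ _ ih1 ih2 => exact s.trans ih1 ih2

theorem join_mono {S S' : Set G.E} (h : S ⊆ S') {a b : G.V} (hab : G.joinSetoid S a b) :
    G.joinSetoid S' a b :=
  joinSetoid_le _ (fun _ he => join_edge (h he)) hab

theorem join_map {H : Multigraph} {S : Set G.E} {S' : Set H.E} (f : G.V → H.V)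
    (h : ∀ e ∈ S, H.joinSetoid S' (f (G.src e)) (f (G.tgt e))) {a b : G.V}
    (hab : G.joinSetoid S a b) : H.joinSetoid S' (f a) (f b) :=
  joinSetoid_le ((H.joinSetoid S').comap f) h hab

theorem join_empty {a b : G.V} : G.joinSetoid ∅ a b ↔ a = b :=
  ⟨fun h => joinSetoid_le ⊥ (fun _ he => he.elim) h, fun h => h ▸ (G.joinSetoid ∅).refl a⟩

/-- A path cannot leave a set of vertices whose boundary has no edge in `S`; this is how edge cuts
are used. -/
theorem join_mem_iff {S : Set G.E} {U : Set G.V}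
    (h : ∀ e ∈ S, G.src e ∈ U ↔ G.tgt e ∈ U) {a b : G.V} (hab : G.joinSetoid S a b) :
    a ∈ U ↔ b ∈ U :=
  joinSetoid_le (⟨fun x y => x ∈ U ↔ y ∈ U, fun _ => Iff.rfl, Iff.symm, Iff.trans⟩ : Setoid G.V)
    h hab

/-- A path can be shortened until it traverses `e` at most once. Formally, the right side is itself
an equivalence relation that relates the ends of all edges of `insert e S`. -/
theorem join_insert {S : Set G.E} {e : G.E} {a b : G.V}
    (h : G.joinSetoid (insert e S) a b) :
    G.joinSetoid S a b ∨ (G.joinSetoid S a (G.src e) ∧ G.joinSetoid S (G.tgt e) b) ∨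
      (G.joinSetoid S a (G.tgt e) ∧ G.joinSetoid S (G.src e) b) := by
  let J := G.joinSetoid S
  refine joinSetoid_le (⟨fun a b => J a b ∨ (J a (G.src e) ∧ J (G.tgt e) b) ∨
      (J a (G.tgt e) ∧ J (G.src e) b), fun a => Or.inl (J.refl a), ?_, ?_⟩ : Setoid G.V) ?_ h
  · rintro x y (h | ⟨h, h'⟩ | ⟨h, h'⟩)
    · exact Or.inl (J.symm h)
    · exact Or.inr (Or.inr ⟨J.symm h', J.symm h⟩)
    · exact Or.inr (Or.inl ⟨J.symm h', J.symm h⟩)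
  · rintro x y z (h | ⟨h, h'⟩ | ⟨h, h'⟩) (k | ⟨k, k'⟩ | ⟨k, k'⟩)
    · exact Or.inl (J.trans h k)
    · exact Or.inr (Or.inl ⟨J.trans h k, k'⟩)
    · exact Or.inr (Or.inr ⟨J.trans h k, k'⟩)
    · exact Or.inr (Or.inl ⟨h, J.trans h' k⟩)
    · exact Or.inr (Or.inl ⟨h, k'⟩)
    · exact Or.inl (J.trans h k')
    · exact Or.inr (Or.inr ⟨h, J.trans h' k⟩)
    · exact Or.inl (J.trans h k')
    · exact Or.inr (Or.inr ⟨h, k'⟩)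
  · rintro e' (rfl | he')
    · exact Or.inr (Or.inl ⟨J.refl _, J.refl _⟩)
    · exact Or.inl (join_edge he')

theorem ConnectedBy.mono {S S' : Set G.E} (h : S ⊆ S') (hS : G.ConnectedBy S) :
    G.ConnectedBy S' :=
  ⟨hS.1, fun a b => join_mono h (hS.2 a b)⟩

theorem TwoEdgeConnected.connected (h : G.TwoEdgeConnected) : G.Connected :=
  (h ∅ (by simp)).mono (Set.subset_univ _)

theorem twoEdgeConnected_iff :
    G.TwoEdgeConnected ↔ G.Connected ∧ ∀ e, ¬ G.IsBridge e := by
  refine ⟨fun h => ⟨h.connected, fun e => not_not.2 ?_⟩, fun ⟨h, hb⟩ F hF => ?_⟩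
  · exact (h {e} (by simp)).mono fun x hx => by simpa using hx
  · rcases Nat.le_one_iff_eq_zero_or_eq_one.1 hF with h0 | h1
    · rw [Finset.card_eq_zero] at h0
      subst h0
      exact h.mono fun x _ => by simp
    · obtain ⟨e, rfl⟩ := Finset.card_eq_one.1 h1
      exact (not_not.1 (hb e)).mono fun x hx => by simpa using hx

/-- In a connected graph an edge is a bridge iff its ends are separated by its removal. -/
theorem isBridge_iff (h : G.Connected) (e : G.E) :
    G.IsBridge e ↔ ¬ G.joinSetoid {e' | e' ≠ e} (G.src e) (G.tgt e) := by
  refine not_congr ⟨fun hc => hc.2 _ _, fun hj => ⟨h.1, fun a b => ?_⟩⟩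
  refine joinSetoid_le _ (fun e' _ => ?_) (h.2 a b)
  by_cases he : e' = e
  · exact he ▸ hj
  · exact join_edge he

/-- A new edge merges at most two components, so forgetting the component of `G.tgt e` makes the
passage to the larger edge set injective. -/
theorem card_quotient_insert_le (S : Set G.E) (e : G.E) :
    Nat.card (Quotient (G.joinSetoid S)) ≤ Nat.card (Quotient (G.joinSetoid (insert e S))) + 1 := by
  let f : Quotient (G.joinSetoid S) → Option (Quotient (G.joinSetoid (insert e S))) := fun x =>
    if x = Quotient.mk _ (G.tgt e) then none
    else some (Quotient.mk _ x.out)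
  have hf : Function.Injective f := by
    intro x y hxy
    induction x using Quotient.inductionOn with | _ x => ?_
    induction y using Quotient.inductionOn with | _ y => ?_
    by_cases hx : Quotient.mk (G.joinSetoid S) x = Quotient.mk _ (G.tgt e) <;>
      by_cases hy : Quotient.mk (G.joinSetoid S) y = Quotient.mk _ (G.tgt e)
    · exact hx.trans hy.symm
    · simp [f, hx, hy] at hxy
    · simp [f, hx, hy] at hxy
    · simp only [f, hx, hy, if_false, Option.some.injEq] at hxy
      have h1 := join_insert (Quotient.exact hxy)
      have hx' : G.joinSetoid S (Quotient.mk (G.joinSetoid S) x).out x := Quotient.mk_out x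
      have hy' : G.joinSetoid S (Quotient.mk (G.joinSetoid S) y).out y := Quotient.mk_out y
      rcases h1 with h | ⟨_, h⟩ | ⟨h, _⟩
      · exact Quotient.sound ((G.joinSetoid S).trans ((G.joinSetoid S).symm hx')
          ((G.joinSetoid S).trans h hy'))
      · exact (hy (Quotient.sound ((G.joinSetoid S).symm ((G.joinSetoid S).trans h hy')))).elim
      · exact (hx (Quotient.sound ((G.joinSetoid S).trans ((G.joinSetoid S).symm hx') h))).elim
  have := Nat.card_le_card_of_injective f hf
  rwa [Finite.card_option] at this

theorem card_quotient_insert_lt (S : Set G.E) (e : G.E)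
    (he : ¬ G.joinSetoid S (G.src e) (G.tgt e)) :
    Nat.card (Quotient (G.joinSetoid (insert e S))) + 1 ≤ Nat.card (Quotient (G.joinSetoid S)) := by
  let f : Quotient (G.joinSetoid S) → Quotient (G.joinSetoid (insert e S)) :=
    Quotient.map' id fun a b h => join_mono (Set.subset_insert e S) h
  have hs : Function.Surjective f := fun y => by
    induction y using Quotient.inductionOn with | _ y => exact ⟨Quotient.mk _ y, rfl⟩
  have hn : ¬ Function.Injective f := fun hi => he <| Quotient.exact <|
    hi (a₁ := Quotient.mk _ (G.src e)) (a₂ := Quotient.mk _ (G.tgt e))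
      (Quotient.sound (join_edge (Set.mem_insert _ _)))
  rw [Nat.card_eq_fintype_card, Nat.card_eq_fintype_card]
  exact Fintype.card_lt_of_surjective_not_injective f hs hn

theorem card_quotient_empty : Nat.card (Quotient (G.joinSetoid ∅)) = Nat.card G.V := by
  refine (Nat.card_eq_of_bijective (Quotient.mk (G.joinSetoid ∅)) ⟨fun a b h => ?_, ?_⟩).symm
  · exact join_empty.1 (Quotient.exact h)
  · exact fun y => Quotient.inductionOn y fun a => ⟨a, rfl⟩

/-- With `card_quotient_add_le`, the two halves of the Euler characteristic count, each by adding
the edges one at a time; the second needs that no edge closes a cycle. -/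
theorem card_le_card_quotient_add (F : Finset G.E) :
    Nat.card G.V ≤ Nat.card (Quotient (G.joinSetoid (F : Set G.E))) + F.card := by
  induction F using Finset.induction_on with
  | empty => rw [Finset.coe_empty, card_quotient_empty, Finset.card_empty, add_zero]
  | insert e F he ih =>
    have := card_quotient_insert_le (F : Set G.E) e
    rw [Finset.card_insert_of_notMem he, Finset.coe_insert]
    omega

theorem card_quotient_add_le (F : Finset G.E)
    (hF : ∀ e ∈ F, ¬ G.joinSetoid {e' | e' ≠ e} (G.src e) (G.tgt e)) :
    Nat.card (Quotient (G.joinSetoid (F : Set G.E))) + F.card ≤ Nat.card G.V := by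
  induction F using Finset.induction_on with
  | empty => rw [Finset.coe_empty, card_quotient_empty, Finset.card_empty, add_zero]
  | insert e F he ih =>
    have h1 := ih fun x hx => hF x (Finset.mem_insert_of_mem hx)
    have := card_quotient_insert_lt (F : Set G.E) e fun h =>
      hF e (Finset.mem_insert_self _ _) (join_mono (fun x hx (hxe : x = e) => he (hxe ▸ hx)) h)
    rw [Finset.card_insert_of_notMem he, Finset.coe_insert]
    omega

theorem Connected.card_le (h : G.Connected) : Nat.card G.V ≤ Nat.card G.E + 1 := by
  have h1 := card_le_card_quotient_add (Finset.univ : Finset G.E)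
  have h2 : Nat.card (Quotient (G.joinSetoid ((Finset.univ : Finset G.E) : Set G.E))) ≤ 1 := by
    rw [Finite.card_le_one_iff_subsingleton]
    refine ⟨fun x y => Quotient.inductionOn₂ x y fun a b => Quotient.sound ?_⟩
    rw [Finset.coe_univ]
    exact h.2 a b
  rw [Finset.card_univ, ← Nat.card_eq_fintype_card] at h1
  omega

theorem card_lt_of_forest [Nonempty G.V]
    (h : ∀ e, ¬ G.joinSetoid {e' | e' ≠ e} (G.src e) (G.tgt e)) :
    Nat.card G.E + 1 ≤ Nat.card G.V := by
  have h1 := card_quotient_add_le (Finset.univ : Finset G.E) fun e _ => h e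
  have h2 : 0 < Nat.card (Quotient (G.joinSetoid ((Finset.univ : Finset G.E) : Set G.E))) :=
    Nat.card_pos_iff.2 ⟨⟨Quotient.mk _ (Classical.arbitrary _)⟩, inferInstance⟩
  rw [Finset.card_univ, ← Nat.card_eq_fintype_card] at h1
  omega

/-- The subgraph with edge set `S`, restricted to one of its components. -/
def component (G : Multigraph) (S : Set G.E) (c : Quotient (G.joinSetoid S)) : Multigraph where
  V := {v : G.V // Quotient.mk (G.joinSetoid S) v = c}
  E := {e : G.E // e ∈ S ∧ Quotient.mk (G.joinSetoid S) (G.src e) = c}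
  src e := ⟨G.src e.1, e.2.2⟩
  tgt e := ⟨G.tgt e.1, (Quotient.sound ((G.joinSetoid S).symm (join_edge e.2.1))).trans e.2.2⟩

theorem component_connected (S : Set G.E) (c : Quotient (G.joinSetoid S)) :
    (G.component S c).Connected := by
  refine ⟨?_, ?_⟩
  · induction c using Quotient.inductionOn with | _ a => exact ⟨⟨a, rfl⟩⟩
  · rintro ⟨a, ha⟩ ⟨b, hb⟩
    -- Membership in the component has to travel along the path, so the relation records the join in
    -- `G` together with the join in the component.
    let s : Setoid G.V :=
      { r := fun x y => G.joinSetoid S x y ∧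
          ∀ (hx : Quotient.mk (G.joinSetoid S) x = c) (hy : Quotient.mk (G.joinSetoid S) y = c),
            (G.component S c).joinSetoid Set.univ ⟨x, hx⟩ ⟨y, hy⟩
        iseqv := by
          refine ⟨fun x => ⟨(G.joinSetoid S).refl x, fun _ _ => ((G.component S c).joinSetoid _).refl _⟩, ?_, ?_⟩
          · rintro x y ⟨h, h'⟩
            exact ⟨(G.joinSetoid S).symm h, fun hx hy =>
              ((G.component S c).joinSetoid _).symm (h' hy hx)⟩
          · rintro x y z ⟨h, h'⟩ ⟨k, k'⟩
            refine ⟨(G.joinSetoid S).trans h k, fun hx hz => ?_⟩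
            have hy : Quotient.mk (G.joinSetoid S) y = c := (Quotient.sound k).trans hz
            exact ((G.component S c).joinSetoid _).trans (h' hx hy) (k' hy hz) }
    refine (joinSetoid_le s (fun e he => ⟨join_edge he, fun hx hy => ?_⟩)
      (Quotient.exact (ha.trans hb.symm))).2 ha hb
    exact join_edge (G := G.component S c) (S := Set.univ) (e := ⟨e, he, hx⟩) trivial

/-- This makes the truncated subtraction in `contractWeight` exact. -/
theorem card_component_le (S : Set G.E) (c : Quotient (G.joinSetoid S)) :
    Nat.card {v : G.V // Quotient.mk (G.joinSetoid S) v = c} ≤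
      Nat.card {e : G.E // e ∈ S ∧ Quotient.mk (G.joinSetoid S) (G.src e) = c} + 1 :=
  (component_connected S c).card_le

/-- If every edge of the component is the only one to cross some cut, the component is a tree, and
contracting it creates no weight. -/
theorem card_component_lt (S : Set G.E) (c : Quotient (G.joinSetoid S))
    (h : ∀ e ∈ S, Quotient.mk (G.joinSetoid S) (G.src e) = c →
      ∃ U : Set G.V, ¬ (G.src e ∈ U ↔ G.tgt e ∈ U) ∧
        ∀ e' ∈ S, Quotient.mk (G.joinSetoid S) (G.src e') = c → e' ≠ e →
          (G.src e' ∈ U ↔ G.tgt e' ∈ U)) :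
    Nat.card {e : G.E // e ∈ S ∧ Quotient.mk (G.joinSetoid S) (G.src e) = c} + 1 ≤
      Nat.card {v : G.V // Quotient.mk (G.joinSetoid S) v = c} := by
  have : Nonempty (G.component S c).V := (component_connected S c).1
  refine card_lt_of_forest (G := G.component S c) ?_
  rintro ⟨e, he, hc⟩ hj
  obtain ⟨U, hU, h2⟩ := h e he hc
  refine hU (join_mem_iff (U := {v : (G.component S c).V | v.1 ∈ U}) ?_ hj)
  rintro ⟨e', he', hc'⟩ hne
  exact h2 e' he' hc' fun h => hne (Subtype.ext h)

end Multigraph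

/-! ### Contraction -/

namespace WGraph

open Multigraph

variable {G : WGraph} {Z : Set G.E}

/-- The class of a vertex in a contraction. -/
abbrev proj (G : WGraph) (Z : Set G.E) (v : G.V) : (G.contract Z).V :=
  Quotient.mk (G.joinSetoid Z) v

theorem proj_surjective (c : (G.contract Z).V) : ∃ v, G.proj Z v = c :=
  Quotient.inductionOn c fun a => ⟨a, rfl⟩

theorem proj_eq_iff {a b : G.V} : G.proj Z a = G.proj Z b ↔ G.joinSetoid Z a b :=
  Quotient.eq

/-- The edges of `G` that are contracted or lie in a set of edges of the contraction. -/
def liftEdges (Z : Set G.E) (S : Set (G.contract Z).E) : Set G.E :=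
  Z ∪ {e | ∃ h : e ∉ Z, (⟨e, h⟩ : {e // e ∉ Z}) ∈ S}

/-- A path in the contraction lifts to a path in `G` that is allowed to use contracted edges. This
turns every connectivity question about the contraction into one about `G`. -/
theorem join_contract {S : Set (G.contract Z).E} {a b : G.V} :
    (G.contract Z).joinSetoid S (G.proj Z a) (G.proj Z b) ↔
      G.joinSetoid (liftEdges Z S) a b := by
  have hZ : Z ⊆ liftEdges Z S := Set.subset_union_left
  have hout : ∀ x : G.V, G.joinSetoid (liftEdges Z S) (G.proj Z x).out x := fun x =>
    join_mono hZ (Quotient.mk_out x)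
  let J := G.joinSetoid (liftEdges Z S)
  constructor
  · intro h
    have := joinSetoid_le (G := (G.contract Z).toMultigraph) (S := S)
      (J.comap Quotient.out) (fun e he => ?_) h
    · exact J.trans (J.symm (hout a)) (J.trans this (hout b))
    · exact J.trans (hout _) (J.trans (join_edge (Or.inr ⟨e.2, he⟩)) (J.symm (hout _)))
  · intro h
    refine join_map (H := (G.contract Z).toMultigraph) (G.proj Z) (fun e he => ?_) h
    rcases he with he | ⟨h1, h2⟩
    · rw [proj_eq_iff.2 (join_edge he)]
    · exact join_edge (G := (G.contract Z).toMultigraph) h2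

theorem connectedBy_contract {S : Set (G.contract Z).E} :
    (G.contract Z).ConnectedBy S ↔ G.ConnectedBy (liftEdges Z S) := by
  constructor
  · rintro ⟨⟨c⟩, h⟩
    exact ⟨⟨c.out⟩, fun a b => join_contract.1 (h _ _)⟩
  · rintro ⟨⟨v⟩, h⟩
    refine ⟨⟨G.proj Z v⟩, fun c d => ?_⟩
    obtain ⟨a, rfl⟩ := proj_surjective c
    obtain ⟨b, rfl⟩ := proj_surjective d
    exact join_contract.2 (h a b)

theorem connected_contract (h : G.Connected) : (G.contract Z).Connected := by
  refine connectedBy_contract.2 (h.mono fun e _ => ?_)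
  by_cases he : e ∈ Z
  · exact Or.inl he
  · exact Or.inr ⟨he, trivial⟩

theorem liftEdges_ne (e : (G.contract Z).E) :
    liftEdges Z {e' | e' ≠ e} = {e' | e' ≠ e.1} := by
  ext x
  constructor
  · rintro (hx | ⟨h, h'⟩) rfl
    · exact e.2 hx
    · exact h' rfl
  · intro hx
    by_cases h : x ∈ Z
    · exact Or.inl h
    · exact Or.inr ⟨h, fun h' => hx (congrArg Subtype.val h')⟩

theorem isBridge_contract (e : (G.contract Z).E) :
    (G.contract Z).IsBridge e ↔ G.IsBridge e.1 := by
  unfold IsBridge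
  rw [connectedBy_contract, liftEdges_ne]

theorem twoEdgeConnected_contract (h : G.TwoEdgeConnected) :
    (G.contract Z).TwoEdgeConnected := by
  rw [twoEdgeConnected_iff] at h ⊢
  exact ⟨connected_contract h.1, fun e => by rw [isBridge_contract]; exact h.2 _⟩

theorem twoEdgeConnected_contract_bridges (h : G.Connected) :
    (G.contract {e | G.IsBridge e}).TwoEdgeConnected := by
  rw [twoEdgeConnected_iff]
  exact ⟨connected_contract h, fun e => by rw [isBridge_contract]; exact e.2⟩

theorem sum_fiber_card {α β : Type} [Fintype α] [Fintype β] (f : α → β) :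
    ∑ b, Nat.card {a // f a = b} = Nat.card α := by
  rw [← Nat.card_sigma]
  exact Nat.card_congr (Equiv.sigmaFiberEquiv f)

/-- Summed over the components, the Betti numbers give the number of contracted edges, minus the
number of vertices, plus the number of components: exactly what `|E| - |V|` loses. -/
theorem genus_contract : (G.contract Z).genus = G.genus := by
  have hw : ∀ c : Quotient (G.joinSetoid Z), (G.contractWeight Z c : ℤ) =
      (∑ v : {v : G.V // Quotient.mk (G.joinSetoid Z) v = c}, (G.w v.1 : ℤ)) +
      ((Nat.card {e : {e : G.E // e ∈ Z} // Quotient.mk (G.joinSetoid Z) (G.src e.1) = c} : ℤ) + 1 -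
        Nat.card {v : G.V // Quotient.mk (G.joinSetoid Z) v = c}) := by
    intro c
    unfold contractWeight
    rw [Nat.cast_add, Nat.cast_sub (card_component_le Z c), Nat.cast_sum, Nat.cast_add,
      Nat.cast_one, Nat.card_congr (Equiv.subtypeSubtypeEquivSubtypeInter (fun e => e ∈ Z)
        fun e => Quotient.mk (G.joinSetoid Z) (G.src e) = c)]
  have h1 : ∑ c, (G.contractWeight Z c : ℤ) = ∑ v, (G.w v : ℤ) +
      ((Nat.card {e : G.E // e ∈ Z} : ℤ) + Nat.card (Quotient (G.joinSetoid Z)) -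
        Nat.card G.V) := by
    rw [Finset.sum_congr rfl fun c _ => hw c, Finset.sum_add_distrib, Finset.sum_sub_distrib,
      Finset.sum_add_distrib, ← Nat.cast_sum, ← Nat.cast_sum,
      sum_fiber_card (fun e : {e : G.E // e ∈ Z} => Quotient.mk (G.joinSetoid Z) (G.src e.1)),
      sum_fiber_card (fun v : G.V => Quotient.mk (G.joinSetoid Z) v),
      Finset.sum_const, Finset.card_univ, Nat.card_eq_fintype_card (α := Quotient _)]
    congr 1
    · rw [← Fintype.sum_sigma (f := fun x : Σ c, {v : G.V // Quotient.mk (G.joinSetoid Z) v = c} =>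
        (G.w x.2.1 : ℤ))]
      exact Fintype.sum_equiv (Equiv.sigmaFiberEquiv (Quotient.mk (G.joinSetoid Z))) _ _
        fun x => rfl
    · simp
  have h2 : Nat.card {e : G.E // e ∈ Z} + Nat.card {e : G.E // e ∉ Z} = Nat.card G.E := by
    rw [← Nat.card_sum]
    exact Nat.card_congr (Equiv.sumCompl _)
  change (Nat.card {e : G.E // e ∉ Z} : ℤ) - Nat.card (Quotient (G.joinSetoid Z)) + 1 +
    ∑ c, (G.contractWeight Z c : ℤ) = _
  rw [h1]
  unfold genus
  omega

theorem card_split {α : Type} [Finite α] (p q : α → Prop) :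
    Nat.card {a // p a} = Nat.card {a // q a ∧ p a} + Nat.card {a // ¬ q a ∧ p a} := by
  rw [← Nat.card_sum]
  refine Nat.card_congr ((Equiv.sumCompl fun a : {a // p a} => q a.1).symm.trans
    (Equiv.sumCongr ?_ ?_))
  · exact (Equiv.subtypeSubtypeEquivSubtypeInter p q).trans
      (Equiv.subtypeEquivRight fun a => and_comm)
  · exact (Equiv.subtypeSubtypeEquivSubtypeInter p fun a => ¬ q a).trans
      (Equiv.subtypeEquivRight fun a => and_comm)

theorem sum_card_fiber {α β : Type} [Fintype α] [Fintype β] (f : α → β) (p : β → Prop) :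
    ∑ b : {b // p b}, Nat.card {a // f a = b.1} = Nat.card {a // p (f a)} := by
  rw [← Nat.card_sigma]
  refine Nat.card_congr ⟨fun x => ⟨x.2.1, by rw [x.2.2]; exact x.1.2⟩,
    fun a => ⟨⟨f a.1, a.2⟩, ⟨a.1, rfl⟩⟩, ?_, fun _ => rfl⟩
  rintro ⟨⟨b, hb⟩, ⟨a, ha⟩⟩
  dsimp only at ha
  subst ha
  rfl

theorem w_eq_zero_of_contract (c : (G.contract Z).V) (hc : (G.contract Z).w c = 0)
    (v : G.V) (hv : G.proj Z v = c) : G.w v = 0 := by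
  have h := (Nat.add_eq_zero_iff.1 (show G.contractWeight Z c = 0 from hc)).1
  exact (Finset.sum_eq_zero_iff.1 h) (⟨v, hv⟩ : {v : G.V // Quotient.mk (G.joinSetoid Z) v = c})
    (by convert Finset.mem_univ _)

/-- A component of weight zero is a tree with `n` vertices of weight zero. These have at least `3n`
edge ends, of which the contracted edges use `2(n - 1)`, so at least `n + 2` ends remain. -/
theorem stable_contract (h : G.Stable) : (G.contract Z).Stable := by
  intro c hc
  have hw := w_eq_zero_of_contract c hc
  have h2 := (Nat.add_eq_zero_iff.1 (show G.contractWeight Z c = 0 from hc)).2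
  have hne : 0 < Nat.card {v : G.V // Quotient.mk (G.joinSetoid Z) v = c} := by
    obtain ⟨v, hv⟩ := proj_surjective c
    exact Nat.card_pos_iff.2 ⟨⟨⟨v, hv⟩⟩, inferInstance⟩
  have h3 : ∑ v : {v : G.V // Quotient.mk (G.joinSetoid Z) v = c}, 3 ≤
      ∑ v : {v : G.V // Quotient.mk (G.joinSetoid Z) v = c}, G.valence v.1 :=
    Finset.sum_le_sum fun v _ => h v.1 (hw v.1 v.2)
  unfold valence at h3
  rw [Finset.sum_add_distrib,
    sum_card_fiber G.src fun v => Quotient.mk (G.joinSetoid Z) v = c,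
    sum_card_fiber G.tgt fun v => Quotient.mk (G.joinSetoid Z) v = c,
    Finset.sum_const, Finset.card_univ, ← Nat.card_eq_fintype_card,
    card_split (fun e => Quotient.mk (G.joinSetoid Z) (G.src e) = c) (· ∈ Z),
    card_split (fun e => Quotient.mk (G.joinSetoid Z) (G.tgt e) = c) (· ∈ Z)] at h3
  have h4 : Nat.card {e : G.E // e ∈ Z ∧ Quotient.mk (G.joinSetoid Z) (G.tgt e) = c} =
      Nat.card {e : G.E // e ∈ Z ∧ Quotient.mk (G.joinSetoid Z) (G.src e) = c} :=
    Nat.card_congr (Equiv.subtypeEquivRight fun e => and_congr_right fun he => by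
      rw [Quotient.sound (join_edge he)])
  have h5 : (G.contract Z).valence c =
      Nat.card {e : G.E // e ∉ Z ∧ Quotient.mk (G.joinSetoid Z) (G.src e) = c} +
      Nat.card {e : G.E // e ∉ Z ∧ Quotient.mk (G.joinSetoid Z) (G.tgt e) = c} := by
    unfold valence
    congr 1
    · exact Nat.card_congr (Equiv.subtypeSubtypeEquivSubtypeInter (fun e => e ∉ Z)
        fun e => Quotient.mk (G.joinSetoid Z) (G.src e) = c)
    · exact Nat.card_congr (Equiv.subtypeSubtypeEquivSubtypeInter (fun e => e ∉ Z)
        fun e => Quotient.mk (G.joinSetoid Z) (G.tgt e) = c)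
  simp only [smul_eq_mul] at h3
  omega

theorem isType_contract (h : G.IsType) : (G.contract Z).IsType :=
  ⟨connected_contract h.1, stable_contract h.2⟩

end WGraph

end

section

open Multigraph

/-! ### Hyperelliptic involutions of graphs -/

/-- A hyperelliptic involution of the graph obtained from `G` by contracting a set `B` of bridges:
an involution acting on vertices up to contraction and on edges, such that an edge that is not in
`B` is either flipped, or forms together with its image an edge cut with invariant sides. -/
structure HypInv (G : Multigraph) (B : Set G.E) where
  onV : G.V → G.V
  onE : G.E → G.E
  isBridge : ∀ e ∈ B, G.IsBridge e
  onV_congr : ∀ {a b}, G.joinSetoid B a b → G.joinSetoid B (onV a) (onV b)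
  onV_onV : ∀ v, G.joinSetoid B (onV (onV v)) v
  onE_onE : ∀ e, onE (onE e) = e
  onE_of_mem : ∀ e ∈ B, onE e = e
  ends : ∀ e ∉ B,
    (G.joinSetoid B (G.src (onE e)) (onV (G.src e)) ∧
      G.joinSetoid B (G.tgt (onE e)) (onV (G.tgt e))) ∨
    (G.joinSetoid B (G.src (onE e)) (onV (G.tgt e)) ∧
      G.joinSetoid B (G.tgt (onE e)) (onV (G.src e)))
  flip : ∀ e ∉ B, onE e = e → G.joinSetoid B (onV (G.src e)) (G.tgt e)
  cut : ∀ e, onE e ≠ e → ∃ U : Set G.V, (∀ v, onV v ∈ U ↔ v ∈ U) ∧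
    ¬ (G.src e ∈ U ↔ G.tgt e ∈ U) ∧
    ∀ e', e' ≠ e → e' ≠ onE e → (G.src e' ∈ U ↔ G.tgt e' ∈ U)

/-- A hyperelliptic involution that fixes the vertices of positive weight. -/
structure WHypInv (G : WGraph) (B : Set G.E) extends HypInv G.toMultigraph B where
  weight : ∀ v, G.w v ≠ 0 → G.joinSetoid B (onV v) v

namespace HypInv

variable {G : Multigraph} {B : Set G.E} (H : HypInv G B)
include H

theorem notMem_of_ne {e : G.E} (he : H.onE e ≠ e) : e ∉ B := fun h => he (H.onE_of_mem e h)

theorem onE_injective : Function.Injective H.onE := fun a b h => by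
  rw [← H.onE_onE a, h, H.onE_onE]

/-- Edges of `B` are fixed, so they are neither `e` nor its partner and do not cross the cut. -/
theorem cut_saturated {e : G.E} (he : H.onE e ≠ e) {U : Set G.V}
    (hU : ∀ e', e' ≠ e → e' ≠ H.onE e → (G.src e' ∈ U ↔ G.tgt e' ∈ U)) {a b : G.V}
    (hab : G.joinSetoid B a b) : a ∈ U ↔ b ∈ U := by
  refine join_mem_iff (fun x hx => hU x ?_ ?_) hab
  · rintro rfl
    exact he (H.onE_of_mem _ hx)
  · rintro rfl
    apply he
    rw [← H.onE_of_mem _ hx, H.onE_onE]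

end HypInv

theorem join_eq_of_forall_notMem {G : Multigraph} {B : Set G.E} (hB : ∀ e, e ∉ B) {a b : G.V} :
    G.joinSetoid B a b ↔ a = b := by
  rw [Set.eq_empty_of_forall_notMem hB]
  exact join_empty

namespace WHypInv

variable {G : WGraph} {B : Set G.E} (H : WHypInv G B)

open WGraph

/-- The edges of a contraction that lie in a given set. -/
abbrev restrict (Z B : Set G.E) : Set (G.contract Z).E := {e | e.1 ∈ B}

theorem liftEdges_restrict (Z B : Set G.E) : liftEdges Z (restrict Z B) = Z ∪ B := by
  ext x
  constructor
  · rintro (h | ⟨_, h⟩)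
    exacts [Or.inl h, Or.inr h]
  · rintro (h | h)
    · exact Or.inl h
    · by_cases hx : x ∈ Z
      exacts [Or.inl hx, Or.inr ⟨hx, h⟩]

theorem join_restrict {Z B : Set G.E} {a b : G.V} :
    (G.contract Z).joinSetoid (restrict Z B) (G.proj Z a) (G.proj Z b) ↔
      G.joinSetoid (Z ∪ B) a b := by
  rw [join_contract, liftEdges_restrict]

include H in
theorem join_union_onV {Z : Set G.E} (hZ : ∀ e ∈ Z, H.onE e ∈ Z) {a b : G.V}
    (hab : G.joinSetoid (Z ∪ B) a b) : G.joinSetoid (Z ∪ B) (H.onV a) (H.onV b) := by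
  have hm : ∀ {a b}, G.joinSetoid B a b → G.joinSetoid (Z ∪ B) a b :=
    fun h => join_mono Set.subset_union_right h
  let J := G.joinSetoid (Z ∪ B)
  refine join_map H.onV (fun e he => ?_) hab
  by_cases hB : e ∈ B
  · exact hm (H.onV_congr (join_edge hB))
  · have he' : J (G.src (H.onE e)) (G.tgt (H.onE e)) :=
      join_edge (Or.inl (hZ e (he.resolve_right hB)))
    rcases H.ends e hB with ⟨h1, h2⟩ | ⟨h1, h2⟩
    · exact J.trans (J.symm (hm h1)) (J.trans he' (hm h2))
    · exact J.trans (J.symm (hm h2)) (J.trans (J.symm he') (hm h1))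

include H in
-- Suppose the component of `v` is moved away from itself. Then it contains no weighted vertex, as
-- those are fixed. An edge of it outside `B` is not flipped, since flipping would join the
-- component to its image; so it crosses a cut with its partner, which lies in the image and not in
-- the component. Edges in `B` are bridges. Hence the component is a tree, and its contraction has
-- weight zero.
theorem join_onV_of_contractWeight (hG : G.Connected) {Z : Set G.E}
    (hZ : ∀ e ∈ Z, H.onE e ∈ Z) (v : G.V) (hv : (G.contract Z).w (G.proj Z v) ≠ 0) :
    G.joinSetoid (Z ∪ B) (H.onV v) v := by
  by_contra hn
  let J := G.joinSetoid (Z ∪ B)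
  have hm : ∀ {a b}, G.joinSetoid B a b → J a b := fun h => join_mono Set.subset_union_right h
  have hmZ : ∀ {a b}, G.joinSetoid Z a b → J a b := fun h => join_mono Set.subset_union_left h
  -- no vertex of the component is joined to its image
  have hno : ∀ x y, G.proj Z x = G.proj Z v → J v y → ¬ J (H.onV x) y := by
    intro x y hx hy h
    have h1 : J x v := hmZ (Quotient.exact hx)
    exact hn (J.trans (H.join_union_onV hZ (J.symm h1)) (J.trans h (J.symm hy)))
  have hno' : ∀ x, G.proj Z x = G.proj Z v → ¬ J (H.onV x) x := fun x hx =>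
    hno x x hx (J.symm (hmZ (Quotient.exact hx)))
  apply hv
  change G.contractWeight Z _ = 0
  unfold contractWeight
  rw [Nat.add_eq_zero_iff]
  constructor
  · refine Finset.sum_eq_zero fun x _ => ?_
    by_contra hx
    exact hno' x.1 x.2 (hm (H.weight x.1 hx))
  · refine Nat.sub_eq_zero_of_le (card_component_lt Z _ fun e he hc => ?_)
    by_cases hB : e ∈ B
    · have hb := H.isBridge e hB
      rw [isBridge_iff hG] at hb
      refine ⟨{x | G.joinSetoid {e' | e' ≠ e} (G.src e) x}, fun h => hb (h.1 ((G.joinSetoid _).refl _)),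
        fun e' _ _ hne => ?_⟩
      have h1 : G.joinSetoid {e' | e' ≠ e} (G.src e') (G.tgt e') := join_edge hne
      exact ⟨fun h => Setoid.trans' _ h h1, fun h => Setoid.trans' _ h (Setoid.symm' _ h1)⟩
    · have hvs : J v (G.src e) := J.symm (hmZ (Quotient.exact hc))
      have hst : J (G.src e) (G.tgt e) := join_edge (Or.inl he)
      have hfl : H.onE e ≠ e := fun h =>
        hno _ (G.tgt e) hc (J.trans hvs hst) (hm (H.flip e hB h))
      obtain ⟨U, _, h2, h3⟩ := H.cut e hfl
      refine ⟨U, h2, fun e' _ hc' hne => h3 e' hne ?_⟩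
      rintro rfl
      have h4 : J v (G.src (H.onE e)) := J.symm (hmZ (Quotient.exact hc'))
      rcases H.ends e hB with ⟨h1, _⟩ | ⟨h1, _⟩
      · exact hno _ _ hc h4 (J.symm (hm h1))
      · refine hno (G.tgt e) _ ?_ h4 (J.symm (hm h1))
        exact (Quotient.sound (Setoid.symm' _ (join_edge he))).trans hc

/-- A hyperelliptic involution induces one on the contraction of an invariant set of edges. -/
def contract (hG : G.Connected) (Z : Set G.E) (hZ : ∀ e ∈ Z, H.onE e ∈ Z) :
    WHypInv (G.contract Z) (restrict Z B) where
  onV c := G.proj Z (H.onV c.out)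
  onE e := ⟨H.onE e.1, fun h => e.2 (H.onE_onE e.1 ▸ hZ _ h)⟩
  isBridge e he := (isBridge_contract e).2 (H.isBridge _ he)
  onV_congr := by
    intro a b hab
    rw [← Quotient.out_eq a, ← Quotient.out_eq b] at hab
    exact join_restrict.2 (H.join_union_onV hZ (join_restrict.1 hab))
  onV_onV c := by
    obtain ⟨v, rfl⟩ := proj_surjective c
    have hm : ∀ {a b}, G.joinSetoid Z a b → G.joinSetoid (Z ∪ B) a b :=
      fun h => join_mono Set.subset_union_left h
    refine join_restrict.2 (Setoid.trans' _ (H.join_union_onV hZ (hm (Quotient.mk_out _))) ?_)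
    refine Setoid.trans' _ (H.join_union_onV hZ (H.join_union_onV hZ (hm (Quotient.mk_out _)))) ?_
    exact join_mono Set.subset_union_right (H.onV_onV v)
  onE_onE e := Subtype.ext (H.onE_onE e.1)
  onE_of_mem e he := Subtype.ext (H.onE_of_mem e.1 he)
  ends e he := by
    have hm : ∀ {a b}, G.joinSetoid B a b → G.joinSetoid (Z ∪ B) a b :=
      fun h => join_mono Set.subset_union_right h
    have ho : ∀ x, G.joinSetoid (Z ∪ B) (H.onV x) (H.onV (G.proj Z x).out) := fun x =>
      H.join_union_onV hZ (join_mono Set.subset_union_left (Setoid.symm' _ (Quotient.mk_out x)))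
    rcases H.ends e.1 he with ⟨h1, h2⟩ | ⟨h1, h2⟩
    · exact Or.inl ⟨join_restrict.2 (Setoid.trans' _ (hm h1) (ho _)),
        join_restrict.2 (Setoid.trans' _ (hm h2) (ho _))⟩
    · exact Or.inr ⟨join_restrict.2 (Setoid.trans' _ (hm h1) (ho _)),
        join_restrict.2 (Setoid.trans' _ (hm h2) (ho _))⟩
  flip e he h := by
    refine join_restrict.2 (Setoid.trans' _ (H.join_union_onV hZ
      (join_mono Set.subset_union_left (Quotient.mk_out (G.src e.1)))) ?_)
    exact join_mono Set.subset_union_right (H.flip e.1 he (congrArg Subtype.val h))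
  cut e he := by
    have he' : H.onE e.1 ≠ e.1 := fun h => he (Subtype.ext h)
    obtain ⟨U, h1, h2, h3⟩ := H.cut e.1 he'
    -- Neither `e` nor its partner is contracted, so `U` is a union of contracted components and
    -- descends.
    have hs : ∀ x, (G.proj Z x).out ∈ U ↔ x ∈ U := fun x => by
      refine join_mem_iff (fun y hy => h3 y ?_ ?_) (Quotient.mk_out x)
      · rintro rfl
        exact e.2 hy
      · rintro rfl
        exact e.2 (H.onE_onE e.1 ▸ hZ _ hy)
    refine ⟨{c | c.out ∈ U}, fun c => ?_, ?_, fun e' h4 h5 => ?_⟩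
    · exact (hs _).trans (h1 _)
    · exact fun h => h2 ((hs _).symm.trans (h.trans (hs _)))
    · exact (hs _).trans ((h3 e'.1 (fun h => h4 (Subtype.ext h))
        fun h => h5 (Subtype.ext h)).trans (hs _).symm)
  weight c hc := by
    obtain ⟨v, rfl⟩ := proj_surjective c
    refine join_restrict.2 (Setoid.trans' _ (H.join_union_onV hZ
      (join_mono Set.subset_union_left (Quotient.mk_out v))) ?_)
    exact H.join_onV_of_contractWeight hG hZ v hc

/-! ### Uniqueness of the pairing of edges -/

include H in
-- There are at most two orbits of edges, and each contributes at most one edge end at a moved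
-- vertex. There is no loop at `v`, because a flipped loop would fix `v` and an edge of a cut is not
-- a loop. An edge and its partner do not both meet `v`, because conjugate vertices lie on the same
-- side of their cut.
theorem valence_le_two (hB : ∀ e, e ∉ B) (e₀ e₁ : G.E)
    (hE : ∀ x, x = e₀ ∨ x = H.onE e₀ ∨ x = e₁ ∨ x = H.onE e₁) (v : G.V) (hv : H.onV v ≠ v) :
    G.valence v ≤ 2 := by
  have J : ∀ {a b}, G.joinSetoid B a b ↔ a = b := join_eq_of_forall_notMem hB
  have hι : ∀ x, H.onV (H.onV x) = x := fun x => J.1 (H.onV_onV x)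
  have hA : ∀ x, G.src x = v → G.tgt x ≠ v := by
    intro x h1 h2
    by_cases hx : H.onE x = x
    · have := J.1 (H.flip x (hB x) hx)
      rw [h1, h2] at this
      exact hv this
    · obtain ⟨U, _, h3, _⟩ := H.cut x hx
      exact h3 (by rw [h1, h2])
  have hC : ∀ x, H.onE x ≠ x → H.onV (G.src x) ≠ G.tgt x := by
    intro x hx h
    obtain ⟨U, h1, h2, _⟩ := H.cut x hx
    exact h2 (by rw [← h, h1])
  have hD : ∀ x, H.onE x ≠ x → (G.src x = v ∨ G.tgt x = v) →
      G.src (H.onE x) ≠ v ∧ G.tgt (H.onE x) ≠ v := by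
    intro x hx h
    have h3 := hC x hx
    have h4 : H.onV (G.tgt x) ≠ G.src x := fun h => h3 (by rw [← h, hι])
    rcases H.ends x (hB x) with ⟨h1, h2⟩ | ⟨h1, h2⟩ <;> rw [J.1 h1, J.1 h2] <;>
      rcases h with rfl | rfl <;> constructor <;> assumption
  let f : {e : G.E // G.src e = v} ⊕ {e : G.E // G.tgt e = v} → Bool := fun x =>
    decide (Sum.elim Subtype.val Subtype.val x = e₀ ∨ Sum.elim Subtype.val Subtype.val x = H.onE e₀)
  have key : ∀ x y : G.E, decide (x = e₀ ∨ x = H.onE e₀) = decide (y = e₀ ∨ y = H.onE e₀) →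
      (G.src x = v ∨ G.tgt x = v) → (G.src y = v ∨ G.tgt y = v) → x = y := by
    intro x y hxy hx hy
    by_contra hne
    have h1 : y = H.onE x := by
      have h1 := hE x
      have h2 := hE y
      have := H.onE_onE e₀
      have := H.onE_onE e₁
      grind
    subst h1
    have := hD x (fun h => hne h.symm) hx
    tauto
  have hf : Function.Injective f := by
    rintro (⟨x, hx⟩ | ⟨x, hx⟩) (⟨y, hy⟩ | ⟨y, hy⟩) hxy
    · obtain rfl := key x y hxy (Or.inl hx) (Or.inl hy)
      rfl
    · obtain rfl := key x y hxy (Or.inl hx) (Or.inr hy)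
      exact (hA x hx hy).elim
    · obtain rfl := key x y hxy (Or.inr hx) (Or.inl hy)
      exact (hA x hy hx).elim
    · obtain rfl := key x y hxy (Or.inr hx) (Or.inr hy)
      rfl
  have := Nat.card_le_card_of_injective f hf
  rw [Nat.card_sum] at this
  simpa [valence] using this

include H in
-- Contract everything except the orbits of `e₀` and `e₁`. A moved vertex would have weight zero,
-- hence valence at least three by stability but at most two by `valence_le_two`; so all vertices
-- are fixed. Now flipped edges are loops and partners are parallel. If `e₀` and `e₁` are not
-- partners, each of them is a loop or parallel to an edge that stays, and removing both does not
-- disconnect.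
theorem onE_eq_of_not_connectedBy (hB : ∀ e, e ∉ B) (hG : G.Connected) (hs : G.Stable)
    (e₀ e₁ : G.E) (hc : ¬ G.ConnectedBy {x | x ≠ e₀ ∧ x ≠ e₁}) : e₁ = H.onE e₀ := by
  by_contra hne
  let Z : Set G.E := {x | x ≠ e₀ ∧ x ≠ H.onE e₀ ∧ x ≠ e₁ ∧ x ≠ H.onE e₁}
  have h0 := H.onE_onE e₀
  have h1 := H.onE_onE e₁
  have hZ : ∀ e ∈ Z, H.onE e ∈ Z := by
    rintro e ⟨a, b, c, d⟩
    refine ⟨?_, ?_, ?_, ?_⟩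
    · rintro rfl; exact b (H.onE_onE e).symm
    · exact fun h => a (H.onE_injective h)
    · rintro rfl; exact d (H.onE_onE e).symm
    · exact fun h => c (H.onE_injective h)
  let H' := H.contract hG Z hZ
  have hB' : ∀ e, e ∉ restrict Z B := fun e => hB e.1
  have J : ∀ {a b}, (G.contract Z).joinSetoid (restrict Z B) a b ↔ a = b :=
    join_eq_of_forall_notMem hB'
  let e₀' : (G.contract Z).E := ⟨e₀, fun h => h.1 rfl⟩
  let e₁' : (G.contract Z).E := ⟨e₁, fun h => h.2.2.1 rfl⟩
  have hfix : ∀ v, H'.onV v = v := by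
    intro v
    by_contra hv
    have hw : (G.contract Z).w v = 0 := by
      by_contra hw
      exact hv (J.1 (H'.weight v hw))
    have h3 := stable_contract (Z := Z) hs v hw
    have h4 := H'.valence_le_two hB' e₀' e₁' (fun x => ?_) v hv
    · omega
    · have hx : ¬ (x.1 ≠ e₀ ∧ x.1 ≠ H.onE e₀ ∧ x.1 ≠ e₁ ∧ x.1 ≠ H.onE e₁) := x.2
      have h5 : x.1 = e₀ ∨ x.1 = H.onE e₀ ∨ x.1 = e₁ ∨ x.1 = H.onE e₁ := by tauto
      rcases h5 with h | h | h | h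
      · exact Or.inl (Subtype.ext h)
      · exact Or.inr (Or.inl (Subtype.ext h))
      · exact Or.inr (Or.inr (Or.inl (Subtype.ext h)))
      · exact Or.inr (Or.inr (Or.inr (Subtype.ext h)))
  have hcon : (G.contract Z).ConnectedBy {x | x ≠ e₀' ∧ x ≠ e₁'} := by
    have hcc := connected_contract (Z := Z) hG
    let K := (G.contract Z).joinSetoid {x | x ≠ e₀' ∧ x ≠ e₁'}
    -- All vertices being fixed, such an edge is a loop or has a surviving parallel partner.
    have key : ∀ x : (G.contract Z).E, H'.onE x = x ∨ (H'.onE x ≠ e₀' ∧ H'.onE x ≠ e₁') →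
        K ((G.contract Z).src x) ((G.contract Z).tgt x) := by
      rintro x (hx | hx)
      · have := J.1 (H'.flip x (hB' x) hx)
        rw [hfix] at this
        rw [this]
      · have h6 : K _ _ := join_edge (S := {x | x ≠ e₀' ∧ x ≠ e₁'}) hx
        rcases H'.ends x (hB' x) with ⟨h1, h2⟩ | ⟨h1, h2⟩ <;>
          rw [J.1 h1, J.1 h2, hfix, hfix] at h6
        exacts [h6, K.symm h6]
    refine ⟨hcc.1, fun a b => joinSetoid_le K (fun x _ => ?_) (hcc.2 a b)⟩
    have hv : ∀ y : (G.contract Z).E, ∀ z, H'.onE y = z ↔ H.onE y.1 = z.1 :=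
      fun y z => Subtype.ext_iff
    by_cases hx0 : x = e₀'
    · subst hx0
      refine key _ (or_iff_not_imp_left.2 fun h => ⟨h, fun h' => hne ?_⟩)
      exact ((hv _ _).1 h').symm
    · by_cases hx1 : x = e₁'
      · subst hx1
        refine key _ (or_iff_not_imp_left.2 fun h => ⟨fun h' => hne ?_, h⟩)
        have h7 : H.onE e₁ = e₀ := (hv _ _).1 h'
        rw [← h7, h1]
      · exact join_edge (show x ∈ {x | x ≠ e₀' ∧ x ≠ e₁'} from ⟨hx0, hx1⟩)
  refine hc ((connectedBy_contract.1 hcon).mono ?_)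
  rintro x (h | ⟨h, h2⟩)
  · exact ⟨h.1, h.2.2.1⟩
  · exact ⟨fun h' => h2.1 (Subtype.ext h'), fun h' => h2.2 (Subtype.ext h')⟩

include H in
/-- In a stable 2-edge-connected graph, the partner of an edge under the hyperelliptic involution
is determined by the edge cuts with two edges. -/
theorem onE_eq_iff (hB : ∀ e, e ∉ B) (hG : G.Connected) (hs : G.Stable) {e₀ e₁ : G.E}
    (hne : e₁ ≠ e₀) : e₁ = H.onE e₀ ↔ ¬ G.ConnectedBy {x | x ≠ e₀ ∧ x ≠ e₁} := by
  refine ⟨?_, H.onE_eq_of_not_connectedBy hB hG hs e₀ e₁⟩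
  rintro rfl hc
  obtain ⟨U, _, h2, h3⟩ := H.cut e₀ hne
  exact h2 (join_mem_iff (fun x hx => h3 x hx.1 hx.2) (hc.2 _ _))

end WHypInv

end

section

open Multigraph

/-! ### From harmonic morphisms to involutions -/

theorem exists_fiber_involution {α β : Type} (f : α → β)
    (h : ∀ x y z, f x = f y → f x = f z → x = y ∨ x = z ∨ y = z) :
    ∃ p : α → α, (∀ x, p (p x) = x) ∧ (∀ x, f (p x) = f x) ∧
      ∀ x y, f y = f x → y = x ∨ y = p x := by
  have h1 : ∀ x, ∃ y, f y = f x ∧ ∀ z, f z = f x → z = x ∨ z = y := by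
    intro x
    by_cases hx : ∃ y, y ≠ x ∧ f y = f x
    · obtain ⟨y, hy, hf⟩ := hx
      refine ⟨y, hf, fun z hz => ?_⟩
      have := h x y z hf.symm hz.symm
      grind
    · push Not at hx
      exact ⟨x, rfl, fun z hz => Or.inl (by by_contra hn; exact hx z hn hz)⟩
  choose p hp1 hp2 using h1
  refine ⟨p, fun x => ?_, hp1, hp2⟩
  rcases hp2 x (p (p x)) ((hp1 _).trans (hp1 _)) with h2 | h2
  · exact h2
  · rcases hp2 (p x) x (hp1 x).symm with h3 | h3
    · rw [h2]; exact h3.symm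
    · exact h3.symm

namespace Multigraph

variable {G K : Multigraph}

theorem IsTree.src_ne_tgt (hK : K.IsTree) (k : K.E) : K.src k ≠ K.tgt k := fun h =>
  (isBridge_iff hK.1 k).1 (hK.2 k) (h ▸ (K.joinSetoid _).refl _)

theorem mem_ends {e : G.E} {x : G.V} : x ∈ G.ends e ↔ x = G.src e ∨ x = G.tgt e := Sym2.mem_iff

theorem ends_eq_of_mem {e : G.E} {x y : G.V} (hx : x ∈ G.ends e) (hy : y ∈ G.ends e)
    (h : x ≠ y) : G.ends e = s(x, y) := by
  rw [mem_ends] at hx hy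
  unfold ends
  rcases hx with rfl | rfl <;> rcases hy with rfl | rfl
  exacts [(h rfl).elim, rfl, Sym2.eq_swap, (h rfl).elim]

namespace Morphism

variable (φ : G.Morphism K)

theorem apply_mem_ends {e : G.E} {k : K.E} (he : φ.onE e = Sum.inr k) {x : G.V}
    (hx : x ∈ G.ends e) : φ.onV x ∈ K.ends k := by
  rw [φ.horizontal e k he]
  exact Sym2.mem_map.2 ⟨x, hx, rfl⟩

theorem eq_of_mem_ends (hK : K.IsTree) {e : G.E} {k : K.E} (he : φ.onE e = Sum.inr k)
    {x y : G.V} (hx : x ∈ G.ends e) (hy : y ∈ G.ends e) (h : φ.onV x = φ.onV y) : x = y := by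
  by_contra hne
  have h1 := φ.horizontal e k he
  rw [ends_eq_of_mem hx hy hne, Sym2.map_mk, h] at h1
  rcases Sym2.eq_iff.1 h1 with ⟨h2, h3⟩ | ⟨h2, h3⟩ <;> exact hK.src_ne_tgt k (h2.trans h3.symm)

/-- Harmonicity spreads the positive multiplicity from one edge at `φ x` to all of them. -/
theorem exists_edge (hh : φ.Harmonic) (hn : φ.Nondegenerate) {x : G.V} {k : K.E}
    (hk : φ.onV x ∈ K.ends k) : ∃ e, x ∈ G.ends e ∧ φ.onE e = Sum.inr k := by
  obtain ⟨k', h1, h2⟩ := hn x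
  rw [hh x k' k h1 hk] at h2
  obtain ⟨⟨e, he⟩⟩ := (Nat.card_pos_iff.1 h2).1
  exact ⟨e, he⟩

theorem fiber_card_two (hd : φ.HasDegree 2) {e₁ e₂ e₃ : G.E} {k : K.E}
    (h₁ : φ.onE e₁ = Sum.inr k) (h₂ : φ.onE e₂ = Sum.inr k) (h₃ : φ.onE e₃ = Sum.inr k) :
    e₁ = e₂ ∨ e₁ = e₃ ∨ e₂ = e₃ := by
  obtain ⟨⟨x, hx⟩, ⟨y, hy⟩, _, hu⟩ := Nat.card_eq_two_iff.1 (hd.1 k)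
  have key : ∀ e, φ.onE e = Sum.inr k → e = x ∨ e = y := by
    intro e he
    have : (⟨e, he⟩ : {e // φ.onE e = Sum.inr k}) ∈ ({⟨x, hx⟩, ⟨y, hy⟩} : Set _) := hu ▸ trivial
    simpa using this
  have := key _ h₁
  have := key _ h₂
  have := key _ h₃
  grind

theorem exists_other (hd : φ.HasDegree 2) {e : G.E} {k : K.E}
    (_ : φ.onE e = Sum.inr k) : ∃ e', e' ≠ e ∧ φ.onE e' = Sum.inr k := by
  obtain ⟨⟨x, hx⟩, ⟨y, hy⟩, hne, _⟩ := Nat.card_eq_two_iff.1 (hd.1 k)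
  by_cases hxe : x = e
  · exact ⟨y, fun h => hne (Subtype.ext (hxe.trans h.symm)), hy⟩
  · exact ⟨x, hxe, hx⟩

/-- An edge `k` at the common image lifts to an edge at each of the three points. Only two edges lie
over `k`, and each has a single end over a given vertex, because a tree has no loops. -/
theorem fiber_le_two (hK : K.IsTree) (hh : φ.Harmonic) (hn : φ.Nondegenerate)
    (hd : φ.HasDegree 2) (x y z : G.V) (hxy : φ.onV x = φ.onV y) (hxz : φ.onV x = φ.onV z) :
    x = y ∨ x = z ∨ y = z := by
  obtain ⟨k, hk, _⟩ := hn x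
  obtain ⟨e₁, h₁, h₁'⟩ := φ.exists_edge hh hn hk
  obtain ⟨e₂, h₂, h₂'⟩ := φ.exists_edge hh hn (hxy ▸ hk)
  obtain ⟨e₃, h₃, h₃'⟩ := φ.exists_edge hh hn (hxz ▸ hk)
  rcases φ.fiber_card_two hd h₁' h₂' h₃' with rfl | rfl | rfl
  · exact Or.inl (φ.eq_of_mem_ends hK h₁' h₁ h₂ hxy)
  · exact Or.inr (Or.inl (φ.eq_of_mem_ends hK h₁' h₁ h₃ hxz))
  · exact Or.inr (Or.inr (φ.eq_of_mem_ends hK h₂' h₂ h₃ (hxy.symm.trans hxz)))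

/-- The involution swaps the two elements of each fibre. A fixed edge is vertical; its ends are
distinct points of one fibre, so it is flipped. Two partners lie over an edge of the tree, whose two
sides pull back to the required cut. -/
theorem exists_hypInv (hG : ∀ e, ¬ G.IsLoop e) (hK : K.IsTree) (hh : φ.Harmonic)
    (hn : φ.Nondegenerate) (hd : φ.HasDegree 2) :
    ∃ H : HypInv G ∅, (∀ x, φ.onV (H.onV x) = φ.onV x) ∧
      ∀ e e', e' ≠ e → (e' = H.onE e ↔ ∃ k, φ.onE e = Sum.inr k ∧ φ.onE e' = Sum.inr k) := by
  obtain ⟨p, hpp, hfp, hp⟩ := exists_fiber_involution φ.onV (φ.fiber_le_two hK hh hn hd)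
  -- A vertical edge gets a fibre of its own, so that the swap fixes it.
  let f : G.E → G.E ⊕ K.E := fun e => Sum.elim (fun _ => Sum.inl e) Sum.inr (φ.onE e)
  have hf : ∀ e k, f e = Sum.inr k ↔ φ.onE e = Sum.inr k := by
    intro e k
    cases h : φ.onE e <;> simp [f, h]
  have hf' : ∀ e e', f e = f e' → e = e' ∨ ∃ k, φ.onE e = Sum.inr k ∧ φ.onE e' = Sum.inr k := by
    intro e e' he
    cases h : φ.onE e with
    | inl y =>
      cases h' : φ.onE e' with
      | inl y' => left; simpa [f, h, h'] using he
      | inr k => simp [f, h, h'] at he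
    | inr k =>
      have h1 := (hf e k).2 h
      exact Or.inr ⟨k, rfl, (hf e' k).1 (he ▸ h1)⟩
  obtain ⟨q, hqq, hfq, hq⟩ := exists_fiber_involution f (by
    intro x y z hxy hxz
    rcases hf' x y hxy with h | ⟨k, h1, h2⟩
    · exact Or.inl h
    · rcases hf' x z hxz with h | ⟨k', h3, h4⟩
      · exact Or.inr (Or.inl h)
      · obtain rfl : k = k' := Sum.inr.inj (h1.symm.trans h3)
        exact φ.fiber_card_two hd h1 h2 h4)
  have hqe : ∀ e e', e' ≠ e → (e' = q e ↔ ∃ k, φ.onE e = Sum.inr k ∧ φ.onE e' = Sum.inr k) := by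
    intro e e' hne
    constructor
    · rintro rfl
      exact (hf' e _ (hfq e).symm).resolve_left hne.symm
    · rintro ⟨k, h1, h2⟩
      exact (hq e e' (((hf e' k).2 h2).trans ((hf e k).2 h1).symm)).resolve_left hne
  have hends : ∀ e e' k, e ≠ e' → φ.onE e = Sum.inr k → φ.onE e' = Sum.inr k →
      ∀ x ∈ G.ends e, ∀ x' ∈ G.ends e', φ.onV x = φ.onV x' → x' = p x := by
    intro e e' k hne he he' x hx x' hx' hxx
    rcases hp x x' hxx.symm with rfl | h
    · rcases hp x' (p x') (hfp x') with h1 | h1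
      · exact h1.symm
      -- Both edges already start at this point. If the fibre had a second point, a third edge over
      -- `k` would start there.
      · by_cases hpx : p x' = x'
        · exact hpx.symm
        · exfalso
          have hk : φ.onV (p x') ∈ K.ends k := by
            rw [hfp]; exact φ.apply_mem_ends he hx
          obtain ⟨e₃, h3, h4⟩ := φ.exists_edge hh hn hk
          rcases φ.fiber_card_two hd he he' h4 with h5 | rfl | rfl
          · exact hne h5
          · exact hpx (φ.eq_of_mem_ends hK he h3 hx (hfp _))
          · exact hpx (φ.eq_of_mem_ends hK he' h3 hx' (hfp _))
    · exact h
  have hs : ∀ e, G.src e ∈ G.ends e := fun e => mem_ends.2 (Or.inl rfl)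
  have ht : ∀ e, G.tgt e ∈ G.ends e := fun e => mem_ends.2 (Or.inr rfl)
  have hvert : ∀ e, q e = e → ∃ y, φ.onE e = Sum.inl y := by
    intro e he
    cases h : φ.onE e with
    | inl y => exact ⟨y, rfl⟩
    | inr k =>
      obtain ⟨e', h1, h2⟩ := φ.exists_other hd h
      exact (h1 (((hqe e e' h1).2 ⟨k, h, h2⟩).trans he)).elim
  have hflip : ∀ e, q e = e → p (G.src e) = G.tgt e := by
    intro e he
    obtain ⟨y, hy⟩ := hvert e he
    have h1 := φ.vertical e y hy _ (hs e)
    have h2 := φ.vertical e y hy _ (ht e)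
    exact ((hp (G.src e) (G.tgt e) (h2.trans h1.symm)).resolve_left fun h => hG e h.symm).symm
  refine ⟨{
    onV := p
    onE := q
    isBridge := fun e he => he.elim
    onV_congr := fun {a b} h => by rw [join_empty.1 h]
    onV_onV := fun v => join_empty.2 (hpp v)
    onE_onE := hqq
    onE_of_mem := fun e he => he.elim
    ends := ?_
    flip := fun e _ he => join_empty.2 (hflip e he)
    cut := ?_ }, hfp, hqe⟩
  · intro e _
    simp only [join_empty]
    by_cases he : q e = e
    · right
      rw [he, ← hflip e he, hpp]
      exact ⟨rfl, rfl⟩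
    · obtain ⟨k, h1, h2⟩ := (hqe e (q e) he).1 rfl
      have h3 := φ.horizontal _ _ h1
      rw [φ.horizontal _ _ h2] at h3
      unfold Multigraph.ends at h3
      rw [Sym2.map_mk, Sym2.map_mk, Sym2.eq_iff] at h3
      have h4 := hends e (q e) k (Ne.symm he) h1 h2
      rcases h3 with ⟨h5, h6⟩ | ⟨h5, h6⟩
      · exact Or.inl ⟨h4 _ (hs e) _ (hs _) h5.symm, h4 _ (ht e) _ (ht _) h6.symm⟩
      · exact Or.inr ⟨h4 _ (ht e) _ (hs _) h5.symm, h4 _ (hs e) _ (ht _) h6.symm⟩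
  · intro e he
    obtain ⟨k, h1, h2⟩ := (hqe e (q e) he).1 rfl
    let J := K.joinSetoid {k' | k' ≠ k}
    refine ⟨{x | J (φ.onV (G.src e)) (φ.onV x)}, fun v => ?_, ?_, ?_⟩
    · change J _ _ ↔ J _ _
      rw [hfp]
    · intro h
      have h3 : J (φ.onV (G.src e)) (φ.onV (G.tgt e)) := h.1 (J.refl _)
      have hb := (isBridge_iff hK.1 k).1 (hK.2 k)
      have h4 := φ.horizontal _ _ h1
      unfold Multigraph.ends at h4
      rw [Sym2.map_mk, Sym2.eq_iff] at h4
      rcases h4 with ⟨h5, h6⟩ | ⟨h5, h6⟩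
      · rw [h5, h6] at hb; exact hb h3
      · rw [h5, h6] at hb; exact hb (J.symm h3)
    · intro e' hne hne'
      have h3 : J (φ.onV (G.src e')) (φ.onV (G.tgt e')) := by
        cases h : φ.onE e' with
        | inl y =>
          rw [φ.vertical e' y h _ (hs e'), φ.vertical e' y h _ (ht e')]
        | inr k' =>
          have hk : k' ≠ k := by
            rintro rfl
            exact hne' ((hqe e e' hne).2 ⟨_, h1, h⟩)
          have h4 := φ.horizontal _ _ h
          unfold Multigraph.ends at h4
          rw [Sym2.map_mk, Sym2.eq_iff] at h4
          have h5 : J (K.src k') (K.tgt k') := join_edge (S := {k' | k' ≠ k}) hk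
          rcases h4 with ⟨h6, h7⟩ | ⟨h6, h7⟩ <;> rw [h6, h7] at h5
          exacts [h5, J.symm h5]
      exact ⟨fun h => J.trans h h3, fun h => J.trans h (J.symm h3)⟩

end Morphism

theorem subdivideLoops_not_isLoop (G : Multigraph) (e : G.subdivideLoops.E) :
    ¬ G.subdivideLoops.IsLoop e := by
  rcases e with ⟨e, he⟩ | ⟨e, _ | _⟩
  · exact fun h => he (Sum.inl_injective h)
  · exact Sum.inl_ne_inr
  · exact Sum.inr_ne_inl

/-- A vertex of `G` in the subdivision. -/
def oldV (G : Multigraph) (v : G.V) : G.subdivideLoops.V := Sum.inl v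

/-- The vertex in the interior of a loop. -/
def midV (G : Multigraph) (l : {e : G.E // G.IsLoop e}) : G.subdivideLoops.V := Sum.inr l

/-- A half of a subdivided loop. -/
def half (G : Multigraph) (l : {e : G.E // G.IsLoop e}) (b : Bool) : G.subdivideLoops.E :=
  Sum.inr (l, b)

theorem oldV_injective : Function.Injective G.oldV := fun _ _ h => Sum.inl_injective h

theorem oldV_ne_midV (v : G.V) (l : {e : G.E // G.IsLoop e}) : G.oldV v ≠ G.midV l :=
  Sum.inl_ne_inr

theorem half_true_ne_false (l : {e : G.E // G.IsLoop e}) : G.half l true ≠ G.half l false :=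
  fun h => Bool.noConfusion (congrArg Prod.snd (Sum.inr_injective h))

theorem ends_half (l : {e : G.E // G.IsLoop e}) (b : Bool) :
    G.subdivideLoops.ends (G.half l b) = s(G.oldV (G.src l.1), G.midV l) := by
  cases b
  · rfl
  · refine Eq.trans ?_ Sym2.eq_swap
    exact congrArg (fun x => s(G.midV l, G.oldV x)) l.2.symm

/-- The two halves of a subdivided loop lie over the same edge of a tree. -/
theorem Morphism.half_loops (φ : G.subdivideLoops.Morphism K) (hK : K.IsTree)
    (hn : φ.Nondegenerate) (l : {e : G.E // G.IsLoop e}) :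
    ∃ k, φ.onE (G.half l false) = Sum.inr k ∧ φ.onE (G.half l true) = Sum.inr k := by
  obtain ⟨k, _, h2⟩ := hn (G.midV l)
  obtain ⟨⟨e, he, hk⟩⟩ := (Nat.card_pos_iff.1 h2).1
  have h3 : ∃ b, e = G.half l b := by
    rw [mem_ends] at he
    rcases e with e | ⟨l', _ | _⟩
    · rcases he with h | h <;> exact (Sum.inr_ne_inl h).elim
    · rcases he with h | h
      · exact (Sum.inr_ne_inl h).elim
      · exact ⟨_, congrArg (fun x => G.half x _) (Sum.inr_injective h).symm⟩
    · rcases he with h | h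
      · exact ⟨_, congrArg (fun x => G.half x _) (Sum.inr_injective h).symm⟩
      · exact (Sum.inr_ne_inl h).elim
  obtain ⟨b, rfl⟩ := h3
  have h4 := φ.horizontal _ _ hk
  rw [ends_half, Sym2.map_mk] at h4
  have hne : φ.onV (G.oldV (G.src l.1)) ≠ φ.onV (G.midV l) := fun h => by
    rw [h] at h4
    rcases Sym2.eq_iff.1 h4 with ⟨h5, h6⟩ | ⟨h5, h6⟩ <;> exact hK.src_ne_tgt k (h5.trans h6.symm)
  -- The two halves have the same ends. So the other half is not vertical, and it cannot lie over a
  -- second edge with the ends of `k`, since `k` is a bridge.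
  have key : ∀ b', φ.onE (G.half l b') = Sum.inr k := by
    intro b'
    cases h : φ.onE (G.half l b') with
    | inl y =>
      have h5 := φ.vertical _ _ h
      rw [ends_half] at h5
      exact (hne ((h5 _ (Sym2.mem_mk_left _ _)).trans (h5 _ (Sym2.mem_mk_right _ _)).symm)).elim
    | inr k' =>
      by_contra hkk
      have hkk : k' ≠ k := fun h => hkk (by rw [h])
      have h5 := φ.horizontal _ _ h
      rw [ends_half, Sym2.map_mk, ← h4] at h5
      refine (isBridge_iff hK.1 k).1 (hK.2 k) (Relation.EqvGen.rel _ _ ⟨k', hkk, h5⟩)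
  exact ⟨k, key _, key _⟩

end Multigraph

namespace WGraph

/-- A loop of `G^w` at a vertex of positive weight. -/
def weightLoop (G : WGraph) (v : G.V) (hv : G.w v ≠ 0) :
    {e : G.addLoops.E // G.addLoops.IsLoop e} :=
  ⟨Sum.inr ⟨v, ⟨0, Nat.pos_of_ne_zero hv⟩⟩, rfl⟩

end WGraph

namespace CGraph

/-- Either `G` has one vertex and the identity will do, or it has two vertices and `G^w` has no
loops, so that exchanging the vertices flips every edge. -/
theorem exists_wHypInv_of_card_two (T : CGraph) (hc : T.Connected)
    (h2 : Nat.card T.loopless.V = 2) :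
    ∃ H : WHypInv T.toWGraph ∅, ∀ e, H.onE e = e := by
  have hsum : Nat.card T.V + Nat.card {e : T.addLoops.E // T.addLoops.IsLoop e} = 2 := by
    rw [← Nat.card_sum]; exact h2
  have := hc.1
  have hpos : 0 < Nat.card T.V := Nat.card_pos
  by_cases h1 : Nat.card T.V = 1
  · have hs : Subsingleton T.V := (Nat.card_eq_one_iff_unique.1 h1).1
    refine ⟨{
      onV := id
      onE := id
      isBridge := fun e he => he.elim
      onV_congr := fun h => h
      onV_onV := fun v => (T.joinSetoid _).refl _
      onE_onE := fun e => rfl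
      onE_of_mem := fun e he => rfl
      ends := fun e _ => Or.inl ⟨(T.joinSetoid _).refl _, (T.joinSetoid _).refl _⟩
      flip := fun e _ _ => join_empty.2 (Subsingleton.elim _ _)
      cut := fun e he => (he rfl).elim
      weight := fun v _ => (T.joinSetoid _).refl _ }, fun e => rfl⟩
  · have hV : Nat.card T.V = 2 := by
      rcases Nat.eq_zero_or_pos (Nat.card {e : T.addLoops.E // T.addLoops.IsLoop e}) with h | h <;>
        omega
    have hL : IsEmpty {e : T.addLoops.E // T.addLoops.IsLoop e} := by
      rw [← Finite.card_eq_zero_iff]; omega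
    have hnl : ∀ e, ¬ T.IsLoop e := fun e he => hL.elim ⟨Sum.inl e, he⟩
    obtain ⟨x, y, hxy, hu⟩ := Nat.card_eq_two_iff.1 hV
    have hflip : ∀ e : T.E, Equiv.swap x y (T.src e) = T.tgt e := by
      intro e
      have h1 : T.src e ∈ ({x, y} : Set T.V) := hu ▸ trivial
      have h2 : T.tgt e ∈ ({x, y} : Set T.V) := hu ▸ trivial
      have h3 := hnl e
      unfold IsLoop at h3
      rcases h1 with h1 | h1 <;> rcases h2 with h2 | h2
      · exact (h3 (h1.trans h2.symm)).elim
      · rw [h1, h2, Equiv.swap_apply_left]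
      · rw [h1, h2, Equiv.swap_apply_right]
      · exact (h3 (h1.trans h2.symm)).elim
    refine ⟨{
      onV := Equiv.swap x y
      onE := id
      isBridge := fun e he => he.elim
      onV_congr := fun {a b} h => by rw [join_empty.1 h]
      onV_onV := fun v => by rw [Equiv.swap_apply_self]
      onE_onE := fun e => rfl
      onE_of_mem := fun e he => rfl
      ends := fun e _ => Or.inr ⟨by rw [← hflip e, Equiv.swap_apply_self]; rfl, by
        rw [hflip]; rfl⟩
      flip := fun e _ _ => join_empty.2 (hflip e)
      cut := fun e he => (he rfl).elim
      weight := fun v hv => hL.elim (T.weightLoop v hv) }, fun e => rfl⟩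

/-- The involution of `G^w_-` preserves each subdivided loop and fixes its base vertex, hence
restricts to `G`. A vertex of positive weight is fixed because it carries an added loop. -/
theorem TwoHyperelliptic.exists_wHypInv {T : CGraph} (h : T.TwoHyperelliptic) :
    ∃ H : WHypInv T.toWGraph ∅, ∀ e e', T.r e e' ↔ e' = e ∨ e' = H.onE e := by
  obtain ⟨h2, ⟨hc, hr⟩ | ⟨K, φ, hK, hh, hn, hd, hr⟩⟩ := h
  · obtain ⟨H, hH⟩ := T.exists_wHypInv_of_card_two h2.connected hc
    exact ⟨H, fun e e' => by rw [hr, hH]; exact ⟨fun h => Or.inl h.symm, fun h => by grind⟩⟩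
  · obtain ⟨H, hφ, hE⟩ := φ.exists_hypInv (subdivideLoops_not_isLoop _) hK hh hn hd
    have hι : ∀ x, H.onV (H.onV x) = x := fun x => join_empty.1 (H.onV_onV x)
    have hl : ∀ l, H.onE (T.addLoops.half l false) = T.addLoops.half l true ∧
        H.onV (T.addLoops.midV l) = T.addLoops.midV l ∧
        H.onV (T.addLoops.oldV (T.addLoops.src l.1)) = T.addLoops.oldV (T.addLoops.src l.1) := by
      intro l
      obtain ⟨k, hk1, hk2⟩ := φ.half_loops hK hn l
      have h1 : H.onE (T.addLoops.half l false) = T.addLoops.half l true :=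
        ((hE _ _ (half_true_ne_false l)).2 ⟨k, hk1, hk2⟩).symm
      have h3 := H.ends (T.addLoops.half l false) (fun h => h)
      rw [h1] at h3
      simp only [join_empty] at h3
      refine ⟨h1, ?_⟩
      rcases h3 with ⟨h4, h5⟩ | ⟨h4, h5⟩
      -- The base and the middle vertex of a loop have different images in the tree, so they are not
      -- exchanged.
      · exfalso
        have h6 : φ.onV (T.addLoops.midV l) = φ.onV (T.addLoops.oldV (T.addLoops.src l.1)) :=
          (congrArg φ.onV h4).trans (hφ _)
        have h7 := φ.eq_of_mem_ends hK hk1 (x := T.addLoops.midV l)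
          (y := T.addLoops.oldV (T.addLoops.src l.1)) (mem_ends.2 (Or.inr rfl)) (mem_ends.2 (Or.inl rfl)) h6
        exact oldV_ne_midV _ _ h7.symm
      · refine ⟨h4.symm, h5.symm.trans ?_⟩
        exact congrArg T.addLoops.oldV l.2.symm
    have hl' : ∀ l, H.onE (T.addLoops.half l true) = T.addLoops.half l false := fun l => by
      exact (congrArg H.onE (hl l).1.symm).trans (H.onE_onE _)
    have hV : ∀ v : T.V, ∃ v' : T.V, H.onV (T.addLoops.oldV v) = T.addLoops.oldV v' := by
      intro v
      rcases h : H.onV (T.addLoops.oldV v) with v' | l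
      · exact ⟨v', rfl⟩
      · have := hι (T.addLoops.oldV v)
        exact (oldV_ne_midV (G := T.addLoops) v l ((this.symm.trans (congrArg H.onV h)).trans (hl l).2.1)).elim
    choose p hp using hV
    have hEE : ∀ e : T.E, ∃ e' : T.E, ∀ he : ¬ T.IsLoop e, ∃ he' : ¬ T.IsLoop e',
        H.onE (T.looplessEdge e he) = T.looplessEdge e' he' := by
      intro e
      by_cases he : T.IsLoop e
      · exact ⟨e, fun h => (h he).elim⟩
      · rcases h : H.onE (T.looplessEdge e he) with ⟨e' | x, he'⟩ | ⟨l, b⟩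
        · exact ⟨e', fun _ => ⟨he', h⟩⟩
        · exact (he' rfl).elim
        · exfalso
          have h1 := H.onE_onE (T.looplessEdge e he)
          rw [h] at h1
          cases b with
          | false => exact Sum.inr_ne_inl ((hl l).1.symm.trans h1)
          | true => exact Sum.inr_ne_inl ((hl' l).symm.trans h1)
    choose q' hq' using hEE
    -- A loop of `G` is not an edge of `G^w_-`; exchanging its halves there amounts to fixing it
    -- here.
    let q : T.E → T.E := fun e => if T.IsLoop e then e else q' e
    have hq : ∀ e (he : ¬ T.IsLoop e), ∃ he' : ¬ T.IsLoop (q e),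
        H.onE (T.looplessEdge e he) = T.looplessEdge (q e) he' := by
      intro e he
      obtain ⟨h1, h2⟩ := hq' e he
      have h3 : q e = q' e := if_neg he
      exact ⟨by rw [h3]; exact h1, h2.trans (by simp only [h3])⟩
    have hql : ∀ e, T.IsLoop e → q e = e := fun e he => if_pos he
    have hinj : ∀ e he e' he', T.looplessEdge e he = T.looplessEdge e' he' → e = e' :=
      fun e he e' he' h => Sum.inl_injective (congrArg Subtype.val (Sum.inl_injective h))
    have hloop : ∀ e, T.IsLoop e → p (T.src e) = T.src e := fun e he =>
      Sum.inl_injective ((hp _).symm.trans (hl ⟨Sum.inl e, he⟩).2.2)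
    refine ⟨{
      onV := p
      onE := q
      isBridge := fun e he => he.elim
      onV_congr := fun {a b} h => by rw [join_empty.1 h]
      onV_onV := fun v => join_empty.2 (oldV_injective (G := T.addLoops)
        ((hp _).symm.trans ((congrArg H.onV (hp v).symm).trans (hι _))))
      onE_onE := ?_
      onE_of_mem := fun e he => he.elim
      ends := ?_
      flip := ?_
      cut := ?_
      weight := fun v hv => join_empty.2 <| Sum.inl_injective
        ((hp v).symm.trans (hl (T.weightLoop v hv)).2.2) }, ?_⟩
    · intro e
      by_cases he : T.IsLoop e
      · rw [hql e he, hql e he]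
      · obtain ⟨he', h1⟩ := hq e he
        obtain ⟨he'', h3⟩ := hq (q e) he'
        rw [← h1, H.onE_onE] at h3
        exact (hinj _ _ _ _ h3).symm
    · intro e _
      simp only [join_empty]
      by_cases he : T.IsLoop e
      · rw [hql e he, ← (show T.src e = T.tgt e from he), hloop e he]
        exact Or.inl ⟨rfl, rfl⟩
      · obtain ⟨he', h1⟩ := hq e he
        have h3 := H.ends (T.looplessEdge e he) (fun h => h)
        rw [h1] at h3
        simp only [join_empty] at h3
        rcases h3 with ⟨h4, h5⟩ | ⟨h4, h5⟩
        · exact Or.inl ⟨Sum.inl_injective (h4.trans (hp _)), Sum.inl_injective (h5.trans (hp _))⟩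
        · exact Or.inr ⟨Sum.inl_injective (h4.trans (hp _)), Sum.inl_injective (h5.trans (hp _))⟩
    · intro e _ h
      rw [join_empty]
      by_cases he : T.IsLoop e
      · rw [hloop e he]; exact he
      · obtain ⟨he', h1⟩ := hq e he
        have h3 := H.flip (T.looplessEdge e he) (fun h => h) (by
          rw [h1]; simp only [h])
        exact Sum.inl_injective ((hp _).symm.trans (join_empty.1 h3))
    · intro e he
      have hel : ¬ T.IsLoop e := fun h => he (hql e h)
      obtain ⟨he', h1⟩ := hq e hel
      obtain ⟨U, h3, h4, h5⟩ := H.cut (T.looplessEdge e hel) (by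
        rw [h1]; exact fun h => he (hinj _ _ _ _ h))
      refine ⟨{v | T.addLoops.oldV v ∈ U}, fun v => ?_, h4, fun e' hne hne' => ?_⟩
      · change T.addLoops.oldV (p v) ∈ U ↔ _
        rw [← hp]
        exact h3 _
      · by_cases hl' : T.IsLoop e'
        · rw [show T.src e' = T.tgt e' from hl']
        · refine h5 (T.looplessEdge e' hl') (fun h => hne (hinj _ _ _ _ h)) fun h => hne' ?_
          rw [h1] at h
          exact hinj _ _ _ _ h
    · intro e e'
      rw [hr]
      constructor
      · rintro (h | ⟨he, he', k, h1, h3⟩)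
        · exact Or.inl h.symm
        · by_cases hne : e' = e
          · exact Or.inl hne
          · have h4 := (hE (T.looplessEdge e he) (T.looplessEdge e' he')
              (fun h => hne (hinj _ _ _ _ h))).2 ⟨k, h1, h3⟩
            obtain ⟨he'', h5⟩ := hq e he
            rw [h5] at h4
            exact Or.inr (hinj _ _ _ _ h4)
      · rintro (h | h)
        · exact Or.inl h.symm
        · by_cases hne : e' = e
          · exact Or.inl hne.symm
          · have hel : ¬ T.IsLoop e := fun h' => hne (h.trans (hql e h'))
            obtain ⟨he', h1⟩ := hq e hel
            subst h
            obtain ⟨k, h3, h4⟩ := (hE (T.looplessEdge e hel) (T.looplessEdge (q e) he')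
              (fun h => hne (hinj _ _ _ _ h))).1 h1.symm
            exact Or.inr ⟨hel, he', k, h3, h4⟩

end CGraph

/-- A hyperelliptic involution of a contraction of bridges, as one of the original graph. -/
def HypInv.lift {G : WGraph} {Z : Set G.E} (hZ : ∀ e ∈ Z, G.IsBridge e)
    (H : HypInv (G.contract Z).toMultigraph ∅) : HypInv G.toMultigraph Z where
  onV v := Quotient.out (H.onV (G.proj Z v))
  onE e := if h : e ∈ Z then e else (H.onE ⟨e, h⟩).1
  isBridge := hZ
  onV_congr := by
    intro a b h
    rw [show G.proj Z a = G.proj Z b from Quotient.sound h]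
  onV_onV v := by
    refine Quotient.exact (s := G.joinSetoid Z) ?_
    refine (Quotient.out_eq _).trans ?_
    have h : G.proj Z (Quotient.out (H.onV (G.proj Z v))) = H.onV (G.proj Z v) := Quotient.out_eq _
    rw [h]
    exact join_empty.1 (H.onV_onV _)
  onE_onE e := by
    by_cases h : e ∈ Z
    · simp [h]
    · have h1 := H.onE_onE (⟨e, h⟩ : {e // e ∉ Z})
      have h2 : (H.onE ⟨e, h⟩).1 ∉ Z := (H.onE ⟨e, h⟩).2
      rw [dif_neg h, dif_neg h2]
      exact congrArg Subtype.val h1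
  onE_of_mem e he := dif_pos he
  ends e he := by
    rw [dif_neg he]
    have key : ∀ (x : G.V) (c : (G.contract Z).V), (G.contract Z).joinSetoid ∅ (G.proj Z x) c →
        G.joinSetoid Z x (Quotient.out c) := fun x c h =>
      Quotient.exact ((join_empty.1 h).trans (Quotient.out_eq c).symm)
    rcases H.ends (⟨e, he⟩ : {e // e ∉ Z}) (fun h => h) with ⟨h1, h2⟩ | ⟨h1, h2⟩
    · exact Or.inl ⟨key _ _ h1, key _ _ h2⟩
    · exact Or.inr ⟨key _ _ h1, key _ _ h2⟩
  flip e he h := by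
    rw [dif_neg he] at h
    have h1 := join_empty.1 (H.flip (⟨e, he⟩ : {e // e ∉ Z}) (fun h => h) (Subtype.ext h))
    exact Quotient.exact ((Quotient.out_eq _).trans h1)
  cut e h := by
    by_cases he : e ∈ Z
    · exact (h (dif_pos he)).elim
    · rw [dif_neg he] at h
      obtain ⟨U, h1, h2, h3⟩ := H.cut (⟨e, he⟩ : {e // e ∉ Z})
        (fun h' => h (congrArg Subtype.val h'))
      refine ⟨{v | G.proj Z v ∈ U}, fun v => ?_, h2, fun e' hne hne' => ?_⟩
      · change G.proj Z (Quotient.out _) ∈ U ↔ _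
        rw [show G.proj Z (Quotient.out (H.onV (G.proj Z v))) = H.onV (G.proj Z v) from
          Quotient.out_eq _]
        exact h1 _
      · rw [dif_neg he] at hne'
        by_cases he' : e' ∈ Z
        · change G.proj Z _ ∈ U ↔ G.proj Z _ ∈ U
          rw [WGraph.proj_eq_iff.2 (join_edge he')]
        · exact h3 (⟨e', he'⟩ : {e // e ∉ Z}) (fun h => hne (congrArg Subtype.val h))
            fun h => hne' (congrArg Subtype.val h)

theorem CGraph.Hyperelliptic.exists_wHypInv {T : CGraph} (h : T.Hyperelliptic) :
    ∃ H : WHypInv T.toWGraph {e | T.IsBridge e}, ∀ e e', T.r e e' ↔ e' = e ∨ e' = H.onE e := by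
  obtain ⟨hb, h2⟩ := h
  obtain ⟨H, hr⟩ := h2.exists_wHypInv
  let H' := H.toHypInv.lift (G := T.toWGraph) (Z := {e | T.IsBridge e}) fun e he => he
  refine ⟨{ H' with weight := fun v hv => ?_ }, fun e e' => ?_⟩
  · have h1 : (T.toWGraph.contract {e | T.IsBridge e}).w (T.proj _ v) ≠ 0 := fun h =>
      hv (WGraph.w_eq_zero_of_contract _ h v rfl)
    exact Quotient.exact ((Quotient.out_eq _).trans (join_empty.1 (H.weight _ h1)))
  · change _ ↔ e' = e ∨ e' = if h : e ∈ {e | T.IsBridge e} then e else (H.onE ⟨e, h⟩).1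
    by_cases he : e ∈ {e | T.IsBridge e}
    · rw [dif_pos he, or_self]
      exact ⟨fun h => (hb e e' he h).symm, fun h => h ▸ T.r.refl e⟩
    · rw [dif_neg he]
      by_cases he' : e' ∈ {e | T.IsBridge e}
      · constructor
        · exact fun h => Or.inl (hb e' e he' (T.r.symm h))
        · rintro (h | h)
          · exact h ▸ T.r.refl e
          · exact ((H.onE ⟨e, he⟩).2 (h ▸ he')).elim
      · refine (hr ⟨e, he⟩ ⟨e', he'⟩).trans (or_congr Subtype.ext_iff Subtype.ext_iff)

end

section

open Multigraph

/-! ### From involutions to harmonic morphisms -/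

theorem card_subtype_pair {α : Type} {p : α → Prop} {a b : α} (hne : a ≠ b)
    (h : ∀ x, p x ↔ x = a ∨ x = b) : Nat.card {x // p x} = 2 := by
  rw [show {x // p x} = ({x | p x} : Set α) from rfl, Nat.card_coe_set_eq,
    show {x | p x} = {a, b} from Set.ext h, Set.ncard_pair hne]

theorem card_subtype_singleton {α : Type} {p : α → Prop} {a : α}
    (h : ∀ x, p x ↔ x = a) : Nat.card {x // p x} = 1 := by
  rw [show {x // p x} = ({x | p x} : Set α) from rfl, Nat.card_coe_set_eq,
    show {x | p x} = {a} from Set.ext h, Set.ncard_singleton]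

namespace HypInv

variable {G : Multigraph} (H : HypInv G ∅)

theorem onV_onV_eq (v : G.V) : H.onV (H.onV v) = v := join_empty.1 (H.onV_onV v)

theorem ends_eq (e : G.E) :
    (G.src (H.onE e) = H.onV (G.src e) ∧ G.tgt (H.onE e) = H.onV (G.tgt e)) ∨
    (G.src (H.onE e) = H.onV (G.tgt e) ∧ G.tgt (H.onE e) = H.onV (G.src e)) := by
  have := H.ends e fun h => h
  simpa only [join_empty] using this

theorem onV_src {e : G.E} (he : H.onE e = e) : H.onV (G.src e) = G.tgt e :=
  join_empty.1 (H.flip e (fun h => h) he)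

theorem onE_loop {e : G.E} (he : G.IsLoop e) : H.onE e = e := by
  by_contra h
  obtain ⟨U, _, h2, _⟩ := H.cut e h
  exact h2 (by rw [show G.src e = G.tgt e from he])

theorem onV_src_ne {e : G.E} (he : H.onE e ≠ e) : H.onV (G.src e) ≠ G.tgt e := by
  intro h
  obtain ⟨U, h1, h2, _⟩ := H.cut e he
  exact h2 (by rw [← h, h1])

/-- The orbits of vertices. -/
def orbitV : Setoid G.V where
  r a b := b = a ∨ b = H.onV a
  iseqv := by
    refine ⟨fun _ => Or.inl rfl, ?_, ?_⟩
    · rintro x y (rfl | rfl)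
      exacts [Or.inl rfl, Or.inr (H.onV_onV_eq x).symm]
    · rintro x y z (rfl | rfl) (rfl | rfl)
      exacts [Or.inl rfl, Or.inr rfl, Or.inr rfl, Or.inl (H.onV_onV_eq x)]

/-- The orbits of edges that are not flipped. -/
def orbitE : Setoid {e : G.E // H.onE e ≠ e} where
  r a b := b.1 = a.1 ∨ b.1 = H.onE a.1
  iseqv := by
    refine ⟨fun _ => Or.inl rfl, ?_, ?_⟩
    · rintro x y (h | h)
      exacts [Or.inl h.symm, Or.inr (by rw [h, H.onE_onE])]
    · rintro x y z (h | h) (k | k)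
      exacts [Or.inl (k.trans h), Or.inr (by rw [k, h]), Or.inr (by rw [k, h]),
        Or.inl (by rw [k, h, H.onE_onE])]

/-- The quotient by a hyperelliptic involution, with the flipped edges collapsed. -/
def quot : Multigraph where
  V := Quotient H.orbitV
  E := Quotient H.orbitE
  src k := Quotient.mk _ (G.src k.out.1)
  tgt k := Quotient.mk _ (G.tgt k.out.1)

/-- The orbit of a vertex. -/
def orb (v : G.V) : H.quot.V := Quotient.mk H.orbitV v

theorem orb_eq_iff {a b : G.V} : H.orb a = H.orb b ↔ b = a ∨ b = H.onV a := Quotient.eq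

theorem orb_onV (v : G.V) : H.orb (H.onV v) = H.orb v :=
  (H.orb_eq_iff.2 (Or.inr rfl)).symm

/-- The orbit of an edge. -/
def orbE (e : G.E) (he : H.onE e ≠ e) : H.quot.E := Quotient.mk H.orbitE ⟨e, he⟩

theorem exists_orbE (k : H.quot.E) : ∃ e he, k = H.orbE e he ∧
    H.quot.src k = H.orb (G.src e) ∧ H.quot.tgt k = H.orb (G.tgt e) :=
  ⟨k.out.1, k.out.2, (Quotient.out_eq k).symm, rfl, rfl⟩

theorem orbE_eq_iff {e e' : G.E} {he : H.onE e ≠ e} {he' : H.onE e' ≠ e'} :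
    H.orbE e he = H.orbE e' he' ↔ e' = e ∨ e' = H.onE e := Quotient.eq

theorem ends_orbE (e : G.E) (he : H.onE e ≠ e) :
    H.quot.ends (H.orbE e he) = s(H.orb (G.src e), H.orb (G.tgt e)) := by
  obtain ⟨e', he', h1, h2, h3⟩ := H.exists_orbE (H.orbE e he)
  unfold Multigraph.ends
  rw [h2, h3]
  rcases H.orbE_eq_iff.1 h1 with rfl | rfl
  · rfl
  · rcases H.ends_eq e with ⟨h4, h5⟩ | ⟨h4, h5⟩ <;> rw [h4, h5, orb_onV, orb_onV]
    exact Sym2.eq_swap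

/-- The quotient morphism. -/
def quotMap : G.Morphism H.quot where
  onV := H.orb
  onE e := if h : H.onE e ≠ e then Sum.inr (H.orbE e h) else Sum.inl (H.orb (G.src e))
  vertical e y h x hx := by
    by_cases he : H.onE e ≠ e
    · rw [dif_pos he] at h; cases h
    · rw [dif_neg he] at h
      rw [← Sum.inl_injective h]
      rcases mem_ends.1 hx with rfl | rfl
      · rfl
      · rw [← H.onV_src (not_not.1 he), orb_onV]
  horizontal e k h := by
    by_cases he : H.onE e ≠ e
    · rw [dif_pos he] at h
      rw [← Sum.inr_injective h, ends_orbE]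
      rfl
    · rw [dif_neg he] at h; cases h

theorem quotMap_eq_iff {e : G.E} {k : H.quot.E} :
    H.quotMap.onE e = Sum.inr k ↔ ∃ he, H.orbE e he = k := by
  by_cases he : H.onE e ≠ e
  · simp [quotMap, he]
  · have h1 : H.quotMap.onE e = Sum.inl (H.orb (G.src e)) := dif_neg he
    rw [h1]
    exact ⟨fun h => (Sum.inl_ne_inr h).elim, fun ⟨h, _⟩ => (he h).elim⟩

theorem quotMap_orbE_iff {e e' : G.E} (he : H.onE e ≠ e) :
    H.quotMap.onE e' = Sum.inr (H.orbE e he) ↔ e' = e ∨ e' = H.onE e := by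
  rw [quotMap_eq_iff]
  constructor
  · rintro ⟨h1, h2⟩
    exact H.orbE_eq_iff.1 h2.symm
  · intro h
    have h' : H.onE e' ≠ e' := by
      rcases h with rfl | rfl
      · exact he
      · rw [H.onE_onE]; exact he.symm
    exact ⟨h', (H.orbE_eq_iff.2 h).symm⟩

/-- The cut of an edge and its partner has invariant sides, so it descends to the quotient, where it
is crossed by one edge only. Hence every edge of the quotient is a bridge. -/
theorem quot_isTree (hG : G.Connected) : H.quot.IsTree := by
  have hc : H.quot.Connected := by
    refine ⟨hG.1.map H.orb, fun a b => ?_⟩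
    induction a using Quotient.inductionOn with | _ a => ?_
    induction b using Quotient.inductionOn with | _ b => ?_
    refine join_map (H := H.quot) H.orb (fun e _ => ?_) (hG.2 a b)
    by_cases he : H.onE e = e
    · rw [← H.onV_src he, orb_onV]
    · exact Relation.EqvGen.rel _ _ ⟨_, trivial, H.ends_orbE e he⟩
  refine ⟨hc, fun k => (isBridge_iff hc k).2 ?_⟩
  obtain ⟨e, he, rfl, h1, h2⟩ := H.exists_orbE k
  obtain ⟨U, hU, h3, h4⟩ := H.cut e he
  have hs : ∀ v, Quotient.out (H.orb v) ∈ U ↔ v ∈ U := by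
    intro v
    have h5 : H.orb (Quotient.out (H.orb v)) = H.orb v := Quotient.out_eq _
    rcases H.orb_eq_iff.1 h5 with h | h
    · rw [← h]
    · rw [← hU, ← h]
  intro hj
  have h6 := join_mem_iff (G := H.quot) (U := {c | Quotient.out c ∈ U}) (fun k' hk' => ?_) hj
  · rw [h1, h2] at h6
    exact h3 ((hs _).symm.trans (h6.trans (hs _)))
  · obtain ⟨e', he', rfl, h7, h8⟩ := H.exists_orbE k'
    rw [h7, h8]
    have hne : ¬ (e' = e ∨ e' = H.onE e) := fun h => hk' (H.orbE_eq_iff.2 h).symm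
    exact (hs _).trans ((h4 e' (fun h => hne (Or.inl h)) fun h => hne (Or.inr h)).trans (hs _).symm)

theorem mem_ends_onE {e : G.E} {x : G.V} (hx : x ∈ G.ends e) : H.onV x ∈ G.ends (H.onE e) := by
  rw [mem_ends] at hx ⊢
  rcases H.ends_eq e with ⟨h1, h2⟩ | ⟨h1, h2⟩ <;> rw [h1, h2] <;> rcases hx with rfl | rfl <;> simp

/-- Both edges of an orbit meet a fixed vertex, and only one of them meets a moved vertex. That the
value does not depend on `k` is harmonicity. -/
theorem multAt_quotMap (x : G.V) (k : H.quot.E) (hk : H.orb x ∈ H.quot.ends k) :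
    H.quotMap.multAt x k = if H.onV x = x then 2 else 1 := by
  have h1 : ∃ e he, k = H.orbE e he ∧ x ∈ G.ends e := by
    obtain ⟨e, he, rfl, _, _⟩ := H.exists_orbE k
    have h2 : ∃ y ∈ G.ends e, H.orb x = H.orb y := by
      rw [ends_orbE] at hk
      rcases Sym2.mem_iff.1 hk with h | h
      · exact ⟨_, mem_ends.2 (Or.inl rfl), h⟩
      · exact ⟨_, mem_ends.2 (Or.inr rfl), h⟩
    obtain ⟨y, hy, hxy⟩ := h2
    rcases H.orb_eq_iff.1 hxy with rfl | rfl
    · exact ⟨e, he, rfl, hy⟩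
    · refine ⟨H.onE e, by rw [H.onE_onE]; exact he.symm, ?_, ?_⟩
      · exact H.orbE_eq_iff.2 (Or.inr rfl)
      · have := H.mem_ends_onE hy
        rwa [H.onV_onV_eq] at this
  obtain ⟨e, he, rfl, hx⟩ := h1
  have h3 : x ∈ G.ends (H.onE e) ↔ H.onV x = x := by
    constructor
    · intro h
      have h4 := H.onV_src_ne he
      have h5 := H.onV_onV_eq
      rw [mem_ends] at h hx
      rcases H.ends_eq e with ⟨h1, h2⟩ | ⟨h1, h2⟩ <;> rw [h1, h2] at h <;> grind
    · intro h
      rw [← h]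
      exact H.mem_ends_onE hx
  unfold Morphism.multAt
  split_ifs with h
  · refine card_subtype_pair (Ne.symm he) fun e' => ?_
    rw [quotMap_orbE_iff]
    refine ⟨fun h => h.2, fun h' => ⟨?_, h'⟩⟩
    rcases h' with rfl | rfl
    exacts [hx, h3.2 h]
  · refine card_subtype_singleton (a := e) fun e' => ?_
    rw [quotMap_orbE_iff]
    constructor
    · rintro ⟨h1, rfl | rfl⟩
      exacts [rfl, (h (h3.1 h1)).elim]
    · rintro rfl
      exact ⟨hx, Or.inl rfl⟩

theorem quotMap_harmonic : H.quotMap.Harmonic := fun x k₁ k₂ h₁ h₂ => by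
  rw [H.multAt_quotMap x k₁ h₁, H.multAt_quotMap x k₂ h₂]

/-- The quotient is connected and has an edge, so none of its vertices is isolated. -/
theorem quotMap_nondegenerate (hG : G.Connected) {e : G.E} (he : H.onE e ≠ e) :
    H.quotMap.Nondegenerate := by
  intro x
  have h1 : ∃ k, H.orb x ∈ H.quot.ends k := by
    by_contra hn
    push Not at hn
    have hc := (H.quot_isTree hG).1.2 (H.orb x) (H.quot.src (H.orbE e he))
    have := join_mem_iff (U := {H.orb x}) (fun k _ => ?_) hc
    · exact hn (H.orbE e he) (mem_ends.2 (Or.inl (this.1 rfl).symm))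
    · have := hn k
      rw [mem_ends] at this
      push Not at this
      exact ⟨fun h => (this.1 h.symm).elim, fun h => (this.2 h.symm).elim⟩
  obtain ⟨k, hk⟩ := h1
  refine ⟨k, hk, ?_⟩
  rw [H.multAt_quotMap x k hk]
  split_ifs <;> norm_num

theorem quotMap_hasDegree {e : G.E} (he : H.onE e ≠ e) : H.quotMap.HasDegree 2 := by
  refine ⟨fun k => ?_, fun h => h.elim (H.orbE e he)⟩
  obtain ⟨e', he', rfl, _, _⟩ := H.exists_orbE k
  exact card_subtype_pair (Ne.symm he') fun x => H.quotMap_orbE_iff he'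

end HypInv

theorem Multigraph.subdivideLoops_connected {G : Multigraph} (hG : G.Connected) :
    G.subdivideLoops.Connected := by
  let J := G.subdivideLoops.joinSetoid Set.univ
  have h1 : ∀ a b, J (G.oldV a) (G.oldV b) := fun a b => by
    refine join_map (H := G.subdivideLoops) (S' := Set.univ) G.oldV (fun e _ => ?_) (hG.2 a b)
    by_cases he : G.IsLoop e
    · rw [show G.src e = G.tgt e from he]
    · exact join_edge (G := G.subdivideLoops) (e := Sum.inl ⟨e, he⟩) trivial
  have h2 : ∀ l, J (G.oldV (G.src l.1)) (G.midV l) := fun l =>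
    join_edge (G := G.subdivideLoops) (e := G.half l false) trivial
  refine ⟨hG.1.map G.oldV, ?_⟩
  rintro (a | l) (b | l')
  · exact h1 a b
  · exact J.trans (h1 a _) (h2 l')
  · exact J.trans (J.symm (h2 l)) (h1 _ b)
  · exact J.trans (J.symm (h2 l)) (J.trans (h1 _ _) (h2 l'))

theorem WGraph.addLoops_connected {G : WGraph} (hG : G.Connected) : G.addLoops.Connected :=
  ⟨hG.1, fun a b => join_map (G := G.toMultigraph) (H := G.addLoops) (S' := Set.univ) id
    (fun e _ => join_edge (G := G.addLoops) (e := Sum.inl e) trivial) (hG.2 a b)⟩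

namespace WHypInv

variable {G : WGraph} (H : WHypInv G ∅)

theorem not_isLoop_onE {e : G.E} (he : ¬ G.IsLoop e) : ¬ G.IsLoop (H.onE e) := fun h =>
  he (by rw [← H.onE_onE e, H.onE_loop h]; exact h)

theorem onV_loop (l : {e : G.addLoops.E // G.addLoops.IsLoop e}) :
    H.onV (G.addLoops.src l.1) = G.addLoops.src l.1 := by
  obtain ⟨e | p, hl⟩ := l
  · exact (H.onV_src (H.onE_loop hl)).trans (Eq.symm hl)
  · exact join_empty.1 (H.weight p.1 (Nat.pos_iff_ne_zero.1 (Fin.pos p.2)))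

/-- The action on the vertices of `G^w_-`. -/
def looplessV : G.addLoops.subdivideLoops.V → G.addLoops.subdivideLoops.V
  | .inl v => .inl (H.onV v)
  | .inr l => .inr l

/-- The action on the edges of `G^w_-`. -/
def looplessE : G.addLoops.subdivideLoops.E → G.addLoops.subdivideLoops.E
  | .inl ⟨.inl e, he⟩ => .inl ⟨.inl (H.onE e), H.not_isLoop_onE he⟩
  | .inl ⟨.inr p, he⟩ => .inl ⟨.inr p, he⟩
  | .inr (l, b) => .inr (l, !b)

/-- The hyperelliptic involution on `G^w_-`. -/
def loopless : HypInv G.addLoops.subdivideLoops ∅ where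
  onV := H.looplessV
  onE := H.looplessE
  isBridge e he := he.elim
  onV_congr h := by rw [join_empty.1 h]
  onV_onV v := by
    rw [join_empty]
    rcases v with v | l
    · exact congrArg Sum.inl (H.onV_onV_eq v)
    · rfl
  onE_onE e := by
    rcases e with ⟨e | p, he⟩ | ⟨l, b⟩
    · exact congrArg Sum.inl (Subtype.ext (congrArg Sum.inl (H.onE_onE e)))
    · rfl
    · cases b <;> rfl
  onE_of_mem e he := he.elim
  ends e _ := by
    simp only [join_empty]
    rcases e with ⟨e | p, he⟩ | ⟨l, b⟩
    · rcases H.ends_eq e with ⟨h1, h2⟩ | ⟨h1, h2⟩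
      · exact Or.inl ⟨congrArg Sum.inl h1, congrArg Sum.inl h2⟩
      · exact Or.inr ⟨congrArg Sum.inl h1, congrArg Sum.inl h2⟩
    · exact (he rfl).elim
    · have h := H.onV_loop l
      have hl : G.addLoops.src l.1 = G.addLoops.tgt l.1 := l.2
      right
      cases b
      · exact ⟨rfl, congrArg Sum.inl (hl.symm.trans h.symm)⟩
      · refine ⟨congrArg Sum.inl ?_, rfl⟩
        rw [← hl]; exact h.symm
  flip e _ h := by
    rw [join_empty]
    rcases e with ⟨e | p, he⟩ | ⟨l, b⟩
    · have h1 : H.onE e = e :=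
        Sum.inl_injective (congrArg Subtype.val (Sum.inl_injective h))
      exact congrArg Sum.inl (H.onV_src h1)
    · exact (he rfl).elim
    · cases b <;> exact absurd (congrArg Prod.snd (Sum.inr_injective h)) (by simp)
  cut e h := by
    rcases e with ⟨e | p, he⟩ | ⟨l, b⟩
    · have h1 : H.onE e ≠ e := fun h' =>
        h (congrArg Sum.inl (Subtype.ext (congrArg Sum.inl h')))
      obtain ⟨U, h2, h3, h4⟩ := H.cut e h1
      -- Middle vertices of loops go to the side of their base vertex.
      let U' : Set G.addLoops.subdivideLoops.V :=
        {x | Sum.elim (fun v => v ∈ U) (fun l => G.addLoops.src l.1 ∈ U) x}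
      refine ⟨U', ?_, h3, ?_⟩
      · rintro (v | l)
        exacts [h2 v, Iff.rfl]
      · rintro (⟨e' | p, he'⟩ | ⟨l, _ | _⟩) hne hne'
        · refine h4 e' ?_ ?_
          · rintro rfl; exact hne rfl
          · rintro rfl; exact hne' rfl
        · exact (he' rfl).elim
        · exact Iff.rfl
        · have hl : G.addLoops.src l.1 = G.addLoops.tgt l.1 := l.2
          change G.addLoops.src l.1 ∈ U ↔ G.addLoops.tgt l.1 ∈ U
          rw [hl]
    · exact (he rfl).elim
    -- The two halves of a loop are the only edges at its middle vertex, which is fixed, so they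
    -- form the cut around it.
    · refine ⟨{G.addLoops.midV l}, ?_, ?_, ?_⟩
      · rintro (v | l')
        · exact ⟨fun h => (Sum.inl_ne_inr h).elim, fun h => (Sum.inl_ne_inr h).elim⟩
        · exact Iff.rfl
      · cases b
        · exact fun h => Sum.inl_ne_inr (h.2 rfl)
        · exact fun h => Sum.inl_ne_inr (h.1 rfl)
      · have hm : ∀ l', l' ≠ l → G.addLoops.midV l' ≠ G.addLoops.midV l := fun l' h h' =>
          h (Sum.inr_injective h')
        have ho : ∀ v, G.addLoops.oldV v ≠ G.addLoops.midV l := fun v => oldV_ne_midV v l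
        rintro (⟨e' | p, he'⟩ | ⟨l', b'⟩) hne hne'
        · exact ⟨fun h => (Sum.inl_ne_inr h).elim, fun h => (Sum.inl_ne_inr h).elim⟩
        · exact (he' rfl).elim
        · have hll : l' ≠ l := by
            rintro rfl
            by_cases hb : b' = b
            · exact hne (by rw [hb])
            · refine hne' (congrArg Sum.inr (congrArg (Prod.mk l') ?_))
              cases b <;> cases b' <;> simp_all
          cases b'
          · exact ⟨fun h => (ho _ h).elim, fun h => (hm l' hll h).elim⟩
          · exact ⟨fun h => (hm l' hll h).elim, fun h => (ho _ h).elim⟩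

end WHypInv

/-- If no edge of `G^w_-` is paired with another one, then `G^w_-` has two vertices. -/
theorem WHypInv.card_loopless {G : WGraph} (H : WHypInv G ∅) (hG : G.Connected)
    (hs : G.Stable) (hfix : ∀ e, H.loopless.onE e = e) :
    Nat.card G.addLoops.subdivideLoops.V = 2 ∧ ∀ e, H.onE e = e := by
  have hL : IsEmpty {e : G.addLoops.E // G.addLoops.IsLoop e} := by
    refine ⟨fun l => ?_⟩
    exact absurd (congrArg Prod.snd (Sum.inr_injective (hfix (Sum.inr (l, false))))) (by simp)
  have hnl : ∀ e, ¬ G.IsLoop e := fun e he => hL.elim ⟨Sum.inl e, he⟩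
  have hE : ∀ e, H.onE e = e := fun e =>
    Sum.inl_injective (congrArg Subtype.val (Sum.inl_injective (hfix (Sum.inl ⟨Sum.inl e, hnl e⟩))))
  refine ⟨?_, hE⟩
  obtain ⟨v⟩ := hG.1
  -- As every edge is flipped, no edge leaves the orbit of `v`.
  have hV : ∀ x, x = v ∨ x = H.onV v := by
    intro x
    have h1 := join_mem_iff (U := {v, H.onV v}) (fun e _ => ?_) (hG.2 v x)
    · exact h1.1 (Or.inl rfl)
    · have h2 := H.onV_src (hE e)
      have h3 := H.onV_onV_eq
      simp only [Set.mem_insert_iff, Set.mem_singleton_iff]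
      grind
  -- Otherwise `v` would be the only vertex; in the absence of loops there would be no edges and no
  -- weight, against stability.
  have hne : H.onV v ≠ v := by
    intro h
    have hV' : ∀ x, x = v := fun x => by
      have := hV x
      rwa [h, or_self] at this
    have hemp : IsEmpty G.E := ⟨fun e => hnl e ((hV' _).trans (hV' _).symm)⟩
    have hw : G.w v = 0 := by
      by_contra hw
      exact hL.elim (G.weightLoop v hw)
    have := hs v hw
    unfold valence at this
    rw [Nat.card_of_isEmpty, Nat.card_of_isEmpty] at this
    omega
  have h1 : Nat.card G.V = 2 := by
    rw [← card_subtype_pair (p := fun _ : G.V => True) hne.symm fun x => by simpa using hV x]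
    exact Nat.card_congr (Equiv.subtypeUnivEquiv fun _ => trivial).symm
  have h2 : Nat.card G.addLoops.subdivideLoops.V =
      Nat.card G.V + Nat.card {e : G.addLoops.E // G.addLoops.IsLoop e} := Nat.card_sum
  rw [h2, h1, Nat.card_of_isEmpty]

namespace CGraph

/-- If the involution of `G^w_-` has no partners at all, the quotient has no edges and the quotient
map does not have degree two; this is where the exceptional case of the definition is needed. -/
theorem twoHyperelliptic_of_wHypInv (T : CGraph) (h2 : T.TwoEdgeConnected) (hs : T.Stable)
    (H : WHypInv T.toWGraph ∅) (hr : ∀ e e', T.r e e' ↔ e' = e ∨ e' = H.onE e) :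
    T.TwoHyperelliptic := by
  refine ⟨h2, ?_⟩
  by_cases hfix : ∀ e, H.loopless.onE e = e
  · obtain ⟨h3, h4⟩ := H.card_loopless h2.connected hs hfix
    refine Or.inl ⟨h3, fun e e' => ?_⟩
    rw [hr, h4]
    exact ⟨fun h => by rcases h with h | h <;> exact h.symm, fun h => Or.inl h.symm⟩
  · push Not at hfix
    obtain ⟨e₀, he₀⟩ := hfix
    have hc := subdivideLoops_connected (WGraph.addLoops_connected h2.connected)
    refine Or.inr ⟨H.loopless.quot, H.loopless.quotMap, H.loopless.quot_isTree hc,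
      H.loopless.quotMap_harmonic, H.loopless.quotMap_nondegenerate hc he₀,
      H.loopless.quotMap_hasDegree he₀, fun e e' => ?_⟩
    have hinj : ∀ e he e' he', T.looplessEdge e he = T.looplessEdge e' he' → e = e' :=
      fun e he e' he' h => Sum.inl_injective (congrArg Subtype.val (Sum.inl_injective h))
    rw [hr]
    constructor
    · rintro (h | h)
      · exact Or.inl h.symm
      · by_cases hne : e' = e
        · exact Or.inl hne.symm
        · subst h
          have hel : ¬ T.IsLoop e := fun h => hne (H.onE_loop h)
          have h5 : H.loopless.onE (T.looplessEdge e hel) ≠ T.looplessEdge e hel :=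
            fun h => hne (hinj _ (H.not_isLoop_onE hel) _ _ h)
          exact Or.inr ⟨hel, H.not_isLoop_onE hel, H.loopless.orbE _ h5,
            (H.loopless.quotMap_orbE_iff h5).2 (Or.inl rfl),
            (H.loopless.quotMap_orbE_iff h5).2 (Or.inr rfl)⟩
    · rintro (h | ⟨he, he', k, h3, h4⟩)
      · exact Or.inl h.symm
      · obtain ⟨h5, rfl⟩ := H.loopless.quotMap_eq_iff.1 h3
        rcases (H.loopless.quotMap_orbE_iff h5).1 h4 with h6 | h6
        · exact Or.inl (hinj _ _ _ _ h6)
        · exact Or.inr (hinj _ he' _ (H.not_isLoop_onE he) h6)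

end CGraph

/-- Replace the set of bridges by the empty set. -/
def WHypInv.ofEmpty {G : WGraph} {B : Set G.E} (H : WHypInv G B) (hB : B = ∅) : WHypInv G ∅ :=
  hB ▸ H

theorem WHypInv.ofEmpty_onE {G : WGraph} {B : Set G.E} (H : WHypInv G B) (hB : B = ∅) (e : G.E) :
    (H.ofEmpty hB).onE e = H.onE e := by
  subst hB; rfl

namespace CGraph

theorem hyperelliptic_of_wHypInv (T : CGraph) (hT : T.IsType)
    (H : WHypInv T.toWGraph {e | T.IsBridge e})
    (hr : ∀ e e', T.r e e' ↔ e' = e ∨ e' = H.onE e) : T.Hyperelliptic := by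
  refine ⟨fun e e' he h => ?_, ?_⟩
  · rcases (hr e e').1 h with h | h
    · exact h.symm
    · rw [H.onE_of_mem e he] at h
      exact h.symm
  · let Z := {e | T.IsBridge e}
    have hZ : ∀ e ∈ Z, H.onE e ∈ Z := fun e he => by rwa [H.onE_of_mem e he]
    have hB : WHypInv.restrict Z Z = (∅ : Set (T.toWGraph.contract Z).E) :=
      Set.eq_empty_of_forall_notMem fun e he => e.2 he
    refine (T.contract Z).twoHyperelliptic_of_wHypInv
      (WGraph.twoEdgeConnected_contract_bridges hT.1) (WGraph.stable_contract hT.2)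
      ((H.contract hT.1 Z hZ).ofEmpty hB) fun e e' => ?_
    refine Iff.trans ?_ (or_congr Iff.rfl (Eq.congr_right ((H.contract hT.1 Z hZ).ofEmpty_onE hB e)).symm)
    exact (hr e.1 e'.1).trans (or_congr Subtype.ext_iff.symm
      (Subtype.ext_iff (a1 := e') (a2 := (H.contract hT.1 Z hZ).onE e)).symm)

/-- The relation of a 2-edge-connected hyperelliptic type is determined by the graph. -/
theorem TwoHyperelliptic.rel_iff {T : CGraph} (h : T.TwoHyperelliptic) (hs : T.Stable)
    (e e' : T.E) : T.r e e' ↔ e' = e ∨ ¬ T.ConnectedBy {x | x ≠ e ∧ x ≠ e'} := by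
  obtain ⟨H, hr⟩ := h.exists_wHypInv
  rw [hr]
  by_cases hne : e' = e
  · simp [hne]
  · rw [H.onE_eq_iff (fun _ h => h) h.1.connected hs hne]

theorem TwoHyperelliptic.rel_unique {G : WGraph} {r r' : Setoid G.E} (hs : G.Stable)
    (h : (CGraph.mk G r).TwoHyperelliptic) (h' : (CGraph.mk G r').TwoHyperelliptic) : r = r' :=
  Setoid.ext fun e e' => (h.rel_iff hs e e').trans (h'.rel_iff hs e e').symm

theorem Hyperelliptic.rel_unique {G : WGraph} {r r' : Setoid G.E} (hs : G.Stable)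
    (h : (CGraph.mk G r).Hyperelliptic) (h' : (CGraph.mk G r').Hyperelliptic) : r = r' := by
  have key := TwoHyperelliptic.rel_unique (WGraph.stable_contract hs) h.2 h'.2
  have hb : ∀ {r : Setoid G.E} (_ : (CGraph.mk G r).Hyperelliptic) (e e' : G.E),
      (G.IsBridge e ∨ G.IsBridge e') → (r e e' ↔ e = e') := by
    intro r h e e' he
    refine ⟨fun hee => ?_, fun hee => hee ▸ r.refl e⟩
    rcases he with he | he
    · exact h.1 e e' he hee
    · exact (h.1 e' e he (r.symm hee)).symm
  refine Setoid.ext fun e e' => ?_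
  by_cases he : G.IsBridge e ∨ G.IsBridge e'
  · exact (hb h e e' he).trans (hb h' e e' he).symm
  · push Not at he
    exact Setoid.ext_iff.1 key (⟨e, he.1⟩ : {e // e ∉ {e | G.IsBridge e}})
      (⟨e', he.2⟩ : {e // e ∉ {e | G.IsBridge e}})

end CGraph

end

section

/-! ### Principal divisors from piecewise linear functions -/

/-- The function that is constant outside `[a, b]` and has slope one on `[a, b]`. -/
def ramp (a b s : ℝ) : ℝ := max a (min s b) - a

theorem ramp_of_le {a b s : ℝ} (h : s ≤ a) : ramp a b s = 0 := by
  unfold ramp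
  rw [max_eq_left ((min_le_left _ _).trans h), sub_self]

theorem ramp_of_mem {a b s : ℝ} (h : a ≤ s) (h' : s ≤ b) : ramp a b s = s - a := by
  unfold ramp
  rw [min_eq_left h', max_eq_right h]

theorem ramp_of_ge {a b s : ℝ} (hab : a ≤ b) (h : b ≤ s) : ramp a b s = b - a := by
  unfold ramp
  rw [min_eq_right h, max_eq_right hab]

theorem continuous_ramp (a b : ℝ) : Continuous (ramp a b) := by
  unfold ramp
  fun_prop

theorem hasDerivWithinAt_ramp_right {a b : ℝ} (hab : a ≤ b) (s : ℝ) :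
    HasDerivWithinAt (ramp a b) (if a ≤ s ∧ s < b then 1 else 0) (Set.Ici s) s := by
  rcases lt_or_ge s a with h | h
  · rw [if_neg fun h' => absurd h'.1 (not_le.2 h)]
    refine (hasDerivWithinAt_const s _ (0 : ℝ)).congr_of_eventuallyEq ?_ (ramp_of_le h.le)
    filter_upwards [mem_nhdsWithin_of_mem_nhds (Iio_mem_nhds h)] with x hx
    exact ramp_of_le (le_of_lt hx)
  · rcases lt_or_ge s b with h' | h'
    · rw [if_pos ⟨h, h'⟩]
      refine ((hasDerivAt_id s).sub_const a).hasDerivWithinAt.congr_of_eventuallyEq ?_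
        (ramp_of_mem h h'.le)
      filter_upwards [self_mem_nhdsWithin, mem_nhdsWithin_of_mem_nhds (Iio_mem_nhds h')]
        with x hx hx'
      exact ramp_of_mem (h.trans hx) (le_of_lt hx')
    · rw [if_neg fun h'' => absurd h''.2 (not_lt.2 h')]
      refine (hasDerivWithinAt_const s _ (b - a)).congr_of_eventuallyEq ?_ (ramp_of_ge hab h')
      filter_upwards [self_mem_nhdsWithin] with x hx
      exact ramp_of_ge hab (h'.trans hx)

theorem hasDerivWithinAt_ramp_left {a b : ℝ} (hab : a ≤ b) (s : ℝ) :
    HasDerivWithinAt (ramp a b) (if a < s ∧ s ≤ b then 1 else 0) (Set.Iic s) s := by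
  rcases le_or_gt s a with h | h
  · rw [if_neg fun h' => absurd h'.1 (not_lt.2 h)]
    refine (hasDerivWithinAt_const s _ (0 : ℝ)).congr_of_eventuallyEq ?_ (ramp_of_le h)
    filter_upwards [self_mem_nhdsWithin] with x hx
    exact ramp_of_le (le_trans hx h)
  · rcases le_or_gt s b with h' | h'
    · rw [if_pos ⟨h, h'⟩]
      refine ((hasDerivAt_id s).sub_const a).hasDerivWithinAt.congr_of_eventuallyEq ?_
        (ramp_of_mem h.le h')
      filter_upwards [self_mem_nhdsWithin, mem_nhdsWithin_of_mem_nhds (Ioi_mem_nhds h)]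
        with x hx hx'
      exact ramp_of_mem (le_of_lt hx') (le_trans hx h')
    · rw [if_neg fun h'' => absurd h''.2 (not_le.2 h')]
      refine (hasDerivWithinAt_const s _ (b - a)).congr_of_eventuallyEq ?_ (ramp_of_ge hab h'.le)
      filter_upwards [mem_nhdsWithin_of_mem_nhds (Ioi_mem_nhds h')] with x hx
      exact ramp_of_ge hab (le_of_lt hx)

theorem ramp_eventually {a b : ℝ} (hab : a ≤ b) {t : ℝ} (ha : t ≠ a) (hb : t ≠ b) :
    ∀ᶠ s in 𝓝 t, ramp a b s = ramp a b t + (if a < t ∧ t < b then 1 else 0) * (s - t) := by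
  rcases lt_or_gt_of_ne ha with h | h
  · rw [if_neg fun h' => absurd h'.1 (not_lt.2 h.le)]
    filter_upwards [Iio_mem_nhds h] with s hs
    rw [ramp_of_le h.le, ramp_of_le (le_of_lt hs)]; ring
  · rcases lt_or_gt_of_ne hb with h' | h'
    · rw [if_pos ⟨h, h'⟩]
      filter_upwards [Ioo_mem_nhds h h'] with s hs
      rw [ramp_of_mem h.le h'.le, ramp_of_mem hs.1.le hs.2.le]; ring
    · rw [if_neg fun h'' => absurd h''.2 (not_lt.2 h'.le)]
      filter_upwards [Ioi_mem_nhds h'] with s hs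
      rw [ramp_of_ge hab h'.le, ramp_of_ge hab (le_of_lt hs)]; ring

namespace Model

variable {M : Model}

/-- The divisor of a point. -/
abbrev chip (M : Model) (x : M.Point) : M.Div := Finsupp.single x 1

/-- A vertex, as a point of the metric graph. -/
def vpt (M : Model) (v : M.V) : M.Point := Sum.inl v

theorem vpt_injective : Function.Injective M.vpt := fun _ _ h => Sum.inl_injective h

theorem edgePoint_inr (e : M.E) {t : ℝ} (ht : t ∈ Set.Ioo (0 : ℝ) (M.len e)) :
    M.edgePoint e t = Sum.inr ⟨e, t, ht⟩ := dif_pos ht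

theorem edgePoint_of_nonpos (e : M.E) {t : ℝ} (ht : t ≤ 0) :
    M.edgePoint e t = M.vpt (M.src e) :=
  (dif_neg fun h => absurd h.1 (not_lt.2 ht)).trans (if_pos ht)

theorem edgePoint_of_ge (hl : ∀ e, 0 < M.len e) (e : M.E) {t : ℝ} (ht : M.len e ≤ t) :
    M.edgePoint e t = M.vpt (M.tgt e) :=
  (dif_neg fun h => absurd h.2 (not_lt.2 ht)).trans (if_neg (not_le.2 ((hl e).trans_le ht)))

theorem edgePoint_zero (e : M.E) : M.edgePoint e 0 = M.vpt (M.src e) :=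
  edgePoint_of_nonpos e le_rfl

theorem edgePoint_len (hl : ∀ e, 0 < M.len e) (e : M.E) :
    M.edgePoint e (M.len e) = M.vpt (M.tgt e) := edgePoint_of_ge hl e le_rfl

theorem edgePoint_eq_inr_iff (e e' : M.E) (t t' : ℝ) (ht' : t' ∈ Set.Ioo (0 : ℝ) (M.len e')) :
    M.edgePoint e t = Sum.inr ⟨e', t', ht'⟩ ↔ e = e' ∧ t = t' := by
  constructor
  · intro h
    by_cases ht : t ∈ Set.Ioo (0 : ℝ) (M.len e)
    · rw [edgePoint_inr e ht] at h
      have h1 := Sum.inr_injective h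
      obtain rfl : e = e' := congrArg Sigma.fst h1
      exact ⟨rfl, congrArg Subtype.val (eq_of_heq (Sigma.mk.inj h1).2)⟩
    · have h1 := (dif_neg ht).symm.trans h
      by_cases h0 : t ≤ 0
      · exact (Sum.inl_ne_inr ((if_pos h0).symm.trans h1)).elim
      · exact (Sum.inl_ne_inr ((if_neg h0).symm.trans h1)).elim
  · rintro ⟨rfl, rfl⟩
    exact edgePoint_inr e ht'

theorem edgePoint_eq_inl_iff (hl : ∀ e, 0 < M.len e) (e : M.E) (t : ℝ) (v : M.V) :
    M.edgePoint e t = M.vpt v ↔ (t ≤ 0 ∧ M.src e = v) ∨ (M.len e ≤ t ∧ M.tgt e = v) := by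
  rcases le_or_gt t 0 with h | h
  · rw [edgePoint_of_nonpos e h]
    have := hl e
    constructor
    · exact fun h' => Or.inl ⟨h, vpt_injective h'⟩
    · rintro (⟨_, rfl⟩ | ⟨h', _⟩)
      · rfl
      · linarith
  · rcases le_or_gt (M.len e) t with h' | h'
    · rw [edgePoint_of_ge hl e h']
      constructor
      · exact fun h'' => Or.inr ⟨h', vpt_injective h''⟩
      · rintro (⟨h'', _⟩ | ⟨_, rfl⟩)
        · linarith
        · rfl
    · rw [edgePoint_inr e ⟨h, h'⟩]
      constructor
      · exact fun h'' => (Sum.inr_ne_inl h'').elim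
      · rintro (⟨h'', _⟩ | ⟨h'', _⟩) <;> linarith

/-- Data for a rational function: values at the vertices and finitely many ramps on the edges that
account for the differences of these values. -/
structure RampData (M : Model) where
  J : Type
  [fintypeJ : Fintype J]
  c : J → M.E
  α : J → ℝ
  β : J → ℝ
  n : J → ℤ
  F : M.V → ℝ
  nonneg : ∀ j, 0 ≤ α j
  le : ∀ j, α j ≤ β j
  le_len : ∀ j, β j ≤ M.len (c j)
  diff : ∀ e, F (M.tgt e) - F (M.src e) = ∑ j, if c j = e then n j * (β j - α j) else 0

attribute [instance] RampData.fintypeJ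

namespace RampData

variable (R : RampData M)

/-- The divisor of the rational function. -/
def div : M.Div :=
  ∑ j, R.n j • (M.chip (M.edgePoint (R.c j) (R.α j)) - M.chip (M.edgePoint (R.c j) (R.β j)))

/-- The rational function along an edge. -/
def profile (e : M.E) (s : ℝ) : ℝ :=
  R.F (M.src e) + ∑ j, if R.c j = e then R.n j * ramp (R.α j) (R.β j) s else 0

/-- The rational function. -/
def toFun : M.Point → ℝ
  | .inl v => R.F v
  | .inr ⟨e, t⟩ => R.profile e t.1

theorem profile_zero (e : M.E) : R.profile e 0 = R.F (M.src e) := by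
  unfold profile
  rw [Finset.sum_eq_zero, add_zero]
  intro j _
  split_ifs
  · rw [ramp_of_le (R.nonneg j), mul_zero]
  · rfl

theorem profile_len (e : M.E) : R.profile e (M.len e) = R.F (M.tgt e) := by
  rw [sub_eq_iff_eq_add'.1 (R.diff e)]
  unfold profile
  congr 1
  refine Finset.sum_congr rfl fun j _ => ?_
  split_ifs with h
  · rw [ramp_of_ge (R.le j) (h ▸ R.le_len j)]
  · rfl

theorem toFun_edgePoint (hl : ∀ e, 0 < M.len e) (e : M.E) {s : ℝ} (h0 : 0 ≤ s)
    (h1 : s ≤ M.len e) : R.toFun (M.edgePoint e s) = R.profile e s := by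
  rcases h0.eq_or_lt with rfl | h0
  · rw [edgePoint_zero, profile_zero]; rfl
  · rcases h1.eq_or_lt with rfl | h1
    · rw [edgePoint_len hl, profile_len]; rfl
    · rw [edgePoint_inr e ⟨h0, h1⟩]; rfl

theorem continuous_profile (e : M.E) : Continuous (R.profile e) := by
  unfold profile
  refine continuous_const.add (continuous_finsetSum _ fun j _ => ?_)
  split_ifs
  · exact continuous_const.mul (continuous_ramp _ _)
  · exact continuous_const

theorem isRational (hl : ∀ e, 0 < M.len e) : M.IsRational R.toFun := by
  intro e
  refine ⟨(R.continuous_profile e).continuousOn.congr fun s hs =>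
    R.toFun_edgePoint hl e hs.1 hs.2, Finset.univ.image R.α ∪ Finset.univ.image R.β,
    fun t ht hB => ?_⟩
  simp only [Finset.mem_union, Finset.mem_image, Finset.mem_univ, true_and, not_or, not_exists]
    at hB
  refine ⟨∑ j, if R.c j = e then R.n j * (if R.α j < t ∧ t < R.β j then 1 else 0) else 0, ?_⟩
  have h1 : ∀ᶠ s in 𝓝 t, ∀ j, ramp (R.α j) (R.β j) s = ramp (R.α j) (R.β j) t +
      (if R.α j < t ∧ t < R.β j then 1 else 0) * (s - t) :=
    Filter.eventually_all.2 fun j =>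
      ramp_eventually (R.le j) (fun h => hB.1 j h.symm) fun h => hB.2 j h.symm
  filter_upwards [h1, Ioo_mem_nhds ht.1 ht.2] with s hs hs'
  rw [R.toFun_edgePoint hl e hs'.1.le hs'.2.le, R.toFun_edgePoint hl e ht.1.le ht.2.le]
  unfold profile
  push_cast
  rw [add_assoc, Finset.sum_mul, ← Finset.sum_add_distrib]
  congr 1
  refine Finset.sum_congr rfl fun j _ => ?_
  split_ifs with hj hj'
  · rw [hs j, if_pos hj']; ring
  · rw [hs j, if_neg hj']; ring
  · ring

theorem slopeFwd_eq (hl : ∀ e, 0 < M.len e) (e : M.E) {t : ℝ} (h0 : 0 ≤ t) (h1 : t < M.len e) :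
    M.slopeFwd R.toFun e t =
      ∑ j, if R.c j = e then (R.n j : ℝ) * (if R.α j ≤ t ∧ t < R.β j then 1 else 0) else 0 := by
  refine HasDerivWithinAt.derivWithin ?_ (uniqueDiffWithinAt_Ici t)
  have h2 : HasDerivWithinAt (R.profile e) (∑ j, if R.c j = e then
      (R.n j : ℝ) * (if R.α j ≤ t ∧ t < R.β j then 1 else 0) else 0) (Set.Ici t) t := by
    refine HasDerivWithinAt.const_add _ (HasDerivWithinAt.fun_sum fun j _ => ?_)
    split_ifs with h3 h4
    · have := (hasDerivWithinAt_ramp_right (R.le j) t).const_mul (R.n j : ℝ)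
      rwa [if_pos h4] at this
    · have := (hasDerivWithinAt_ramp_right (R.le j) t).const_mul (R.n j : ℝ)
      rwa [if_neg h4] at this
    · exact hasDerivWithinAt_const _ _ _
  refine h2.congr_of_eventuallyEq ?_ (R.toFun_edgePoint hl e h0 h1.le)
  filter_upwards [self_mem_nhdsWithin, mem_nhdsWithin_of_mem_nhds (Iio_mem_nhds h1)] with s hs hs'
  exact R.toFun_edgePoint hl e (h0.trans hs) (le_of_lt hs')

theorem slopeBwd_eq (hl : ∀ e, 0 < M.len e) (e : M.E) {t : ℝ} (h0 : 0 < t) (h1 : t ≤ M.len e) :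
    M.slopeBwd R.toFun e t =
      -∑ j, if R.c j = e then (R.n j : ℝ) * (if R.α j < t ∧ t ≤ R.β j then 1 else 0) else 0 := by
  refine congrArg Neg.neg (HasDerivWithinAt.derivWithin ?_ (uniqueDiffWithinAt_Iic t))
  have h2 : HasDerivWithinAt (R.profile e) (∑ j, if R.c j = e then
      (R.n j : ℝ) * (if R.α j < t ∧ t ≤ R.β j then 1 else 0) else 0) (Set.Iic t) t := by
    refine HasDerivWithinAt.const_add _ (HasDerivWithinAt.fun_sum fun j _ => ?_)
    split_ifs with h3 h4
    · have := (hasDerivWithinAt_ramp_left (R.le j) t).const_mul (R.n j : ℝ)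
      rwa [if_pos h4] at this
    · have := (hasDerivWithinAt_ramp_left (R.le j) t).const_mul (R.n j : ℝ)
      rwa [if_neg h4] at this
    · exact hasDerivWithinAt_const _ _ _
  refine h2.congr_of_eventuallyEq ?_ (R.toFun_edgePoint hl e h0.le h1)
  filter_upwards [self_mem_nhdsWithin, mem_nhdsWithin_of_mem_nhds (Ioi_mem_nhds h0)] with s hs hs'
  exact R.toFun_edgePoint hl e (le_of_lt hs') (le_trans hs h1)

theorem div_apply (x : M.Point) : (R.div x : ℝ) = ∑ j, (R.n j : ℝ) *
    ((if M.edgePoint (R.c j) (R.α j) = x then 1 else 0) -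
      (if M.edgePoint (R.c j) (R.β j) = x then 1 else 0)) := by
  unfold div chip
  rw [Finsupp.finsetSum_apply]
  push_cast
  refine Finset.sum_congr rfl fun j _ => ?_
  rw [Pi.smul_apply, Pi.sub_apply, Finsupp.single_apply, Finsupp.single_apply, smul_eq_mul]
  push_cast
  rfl

theorem sum_subtype_ite {ι κ : Type} [Fintype ι] [Fintype κ] (c : ι → κ) (p : κ → Prop)
    (g : ι → ℝ) : ∑ e : {e // p e}, ∑ j, (if c j = e.1 then g j else 0) =
      ∑ j, if p (c j) then g j else 0 := by
  rw [Finset.sum_comm]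
  refine Finset.sum_congr rfl fun j _ => ?_
  by_cases h : p (c j)
  · rw [if_pos h, Finset.sum_eq_single (⟨c j, h⟩ : {e // p e})]
    · rw [if_pos rfl]
    · exact fun e _ he => if_neg fun h' => he (Subtype.ext h'.symm)
    · exact fun h' => (h' (Finset.mem_univ _)).elim
  · rw [if_neg h]
    exact Finset.sum_eq_zero fun e _ => if_neg fun (h' : c j = e.1) => h (h' ▸ e.2)

/-- Bookkeeping at a vertex: a ramp over `[a, b]` has a slope at the initial end of the edge if `a ≤
0 < b`, and at the terminal end if `a < l ≤ b`. Both conditions are jumps of indicator functions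
between `a` and `b`. -/
theorem ite_endpoints {a b l : ℝ} (hb : a ≤ b) (P Q : Prop) (n : ℝ) :
    n * (((if a ≤ 0 then if P then 1 else 0 else 0) + (if l ≤ a then if Q then 1 else 0 else 0)) -
      ((if b ≤ 0 then if P then 1 else 0 else 0) + (if l ≤ b then if Q then 1 else 0 else 0))) =
    (if P then n * (if a ≤ 0 ∧ 0 < b then 1 else 0) else 0) +
      (if Q then -(n * (if a < l ∧ l ≤ b then 1 else 0)) else 0) := by
  have h1 : (if a ≤ 0 ∧ 0 < b then (1 : ℝ) else 0) =
      (if a ≤ 0 then 1 else 0) - (if b ≤ 0 then 1 else 0) := by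
    split_ifs <;> first | (exfalso; grind) | ring
  have h2 : (if a < l ∧ l ≤ b then (1 : ℝ) else 0) =
      (if l ≤ b then 1 else 0) - (if l ≤ a then 1 else 0) := by
    split_ifs <;> first | (exfalso; grind) | ring
  rw [h1, h2]
  by_cases hP : P <;> by_cases hQ : Q <;> simp only [hP, hQ, if_true, if_false, ite_self] <;> ring

/-- A ramp of slope `n` has outgoing slope `n` where it begins and `-n` where it ends. At all other
points its two slopes cancel. -/
theorem divAt_toFun (hl : ∀ e, 0 < M.len e) (x : M.Point) :
    (R.div x : ℝ) = M.divAt R.toFun x := by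
  rw [div_apply]
  rcases x with v | ⟨e, t, ht⟩
  · have h1 : ∀ e : {e : M.E // M.src e = v}, M.slopeFwd R.toFun e.1 0 = _ := fun e =>
      R.slopeFwd_eq hl e.1 le_rfl (hl _)
    have h2 : ∀ e : {e : M.E // M.tgt e = v}, M.slopeBwd R.toFun e.1 (M.len e.1) =
        ∑ j, if R.c j = e.1 then -((R.n j : ℝ) *
          (if R.α j < M.len (R.c j) ∧ M.len (R.c j) ≤ R.β j then 1 else 0)) else 0 := fun e => by
      rw [R.slopeBwd_eq hl e.1 (hl _) le_rfl, ← Finset.sum_neg_distrib]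
      refine Finset.sum_congr rfl fun j _ => ?_
      by_cases h : R.c j = e.1
      · rw [if_pos h, if_pos h, h]
      · rw [if_neg h, if_neg h, neg_zero]
    change _ = ∑ e : {e : M.E // M.src e = v}, M.slopeFwd R.toFun e.1 0 +
      ∑ e : {e : M.E // M.tgt e = v}, M.slopeBwd R.toFun e.1 (M.len e.1)
    rw [Finset.sum_congr rfl fun e _ => h1 e, Finset.sum_congr rfl fun e _ => h2 e,
      sum_subtype_ite R.c (fun e => M.src e = v), sum_subtype_ite R.c (fun e => M.tgt e = v),
      ← Finset.sum_add_distrib]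
    refine Finset.sum_congr rfl fun j _ => ?_
    have hb := R.le j
    have hd := hl (R.c j)
    have e1 : ∀ s, (if M.edgePoint (R.c j) s = M.vpt v then (1 : ℝ) else 0) =
        (if s ≤ 0 then if M.src (R.c j) = v then 1 else 0 else 0) +
        (if M.len (R.c j) ≤ s then if M.tgt (R.c j) = v then 1 else 0 else 0) := by
      intro s
      rw [edgePoint_eq_inl_iff hl]
      by_cases h3 : s ≤ 0
      · have h4 : ¬ M.len (R.c j) ≤ s := by linarith
        simp [h3, h4]
      · simp [h3, ← ite_and]
    exact (congrArg₂ (fun x y => (R.n j : ℝ) * (x - y)) (e1 _) (e1 _)).trans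
      (ite_endpoints hb _ _ _)
  · change _ = M.slopeFwd R.toFun e t + M.slopeBwd R.toFun e t
    rw [R.slopeFwd_eq hl e ht.1.le ht.2, R.slopeBwd_eq hl e ht.1 ht.2.le, ← sub_eq_add_neg,
      ← Finset.sum_sub_distrib]
    refine Finset.sum_congr rfl fun j _ => ?_
    have hb := R.le j
    simp only [edgePoint_eq_inr_iff]
    by_cases h : R.c j = e
    · simp only [h, true_and, if_true]
      split_ifs <;> first | (exfalso; grind) | ring
    · simp [h]

theorem isPrincipal (hl : ∀ e, 0 < M.len e) : M.IsPrincipal R.div :=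
  ⟨R.toFun, R.isRational hl, R.divAt_toFun hl⟩

end RampData

end Model

end

section

/-! ### Piecewise linear data of rational functions -/

/-- The integer slope is locally constant, hence constant on the open interval. The mean value
theorem carries the formula to the end points. -/
theorem affine_of_locally_affine {g : ℝ → ℝ} {a b : ℝ} (hab : a < b)
    (hg : ContinuousOn g (Set.Icc a b))
    (h : ∀ t ∈ Set.Ioo a b, ∃ n : ℤ, ∀ᶠ s in 𝓝 t, g s = g t + n * (s - t)) :
    ∃ n : ℤ, ∀ s ∈ Set.Icc a b, g s = g a + n * (s - a) := by
  choose! N hN using h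
  have hconst : ∀ x ∈ Set.Ioo a b, ∀ y ∈ Set.Ioo a b, N x = N y := by
    intro x hx y hy
    refine isPreconnected_Ioo.constant (f := N) (fun t ht => ?_) hx hy
    refine ContinuousAt.continuousWithinAt ?_
    refine (continuousAt_const (y := N t)).congr ?_
    filter_upwards [(hN t ht).eventually_nhds, Ioo_mem_nhds ht.1 ht.2] with s hs hsI
    have h1 : HasDerivAt g (N t) s := by
      have h2 : HasDerivAt (fun u => g t + N t * (u - t)) (N t) s := by
        simpa using (((hasDerivAt_id s).sub_const t).const_mul (N t : ℝ)).const_add (g t)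
      exact h2.congr_of_eventuallyEq hs
    have h3 : HasDerivAt g (N s) s := by
      have h2 : HasDerivAt (fun u => g s + N s * (u - s)) (N s) s := by
        simpa using (((hasDerivAt_id s).sub_const s).const_mul (N s : ℝ)).const_add (g s)
      exact h2.congr_of_eventuallyEq (hN s hsI)
    exact_mod_cast h1.unique h3
  obtain ⟨m, hm⟩ := Set.nonempty_Ioo.2 hab
  refine ⟨N m, fun s hs => ?_⟩
  rcases hs.1.eq_or_lt with rfl | hs1
  · ring
  · obtain ⟨c, _, hc⟩ := exists_hasDerivAt_eq_slope g (fun _ => (N m : ℝ)) hs1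
      (hg.mono (Set.Icc_subset_Icc_right hs.2)) fun x hx => by
        have hx' : x ∈ Set.Ioo a b := ⟨hx.1, hx.2.trans_le hs.2⟩
        rw [hconst m hm x hx']
        have h2 : HasDerivAt (fun u => g x + N x * (u - x)) (N x) x := by
          simpa using (((hasDerivAt_id x).sub_const x).const_mul (N x : ℝ)).const_add (g x)
        exact h2.congr_of_eventuallyEq (hN x hx')
    rw [hc, div_mul_cancel₀ _ (sub_ne_zero.2 hs1.ne')]
    ring

theorem exists_partition {g : ℝ → ℝ} {l : ℝ} (hl : 0 < l) (hg : ContinuousOn g (Set.Icc 0 l))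
    (B : Finset ℝ) (h : ∀ t ∈ Set.Ioo 0 l, t ∉ B →
      ∃ n : ℤ, ∀ᶠ s in 𝓝 t, g s = g t + n * (s - t)) :
    ∃ (k : ℕ) (t : ℕ → ℝ) (n : ℕ → ℤ), t 0 = 0 ∧ t k = l ∧ (∀ i < k, t i < t (i + 1)) ∧
      ∀ i < k, ∀ s, t i ≤ s → s ≤ t (i + 1) → g s = g (t i) + n i * (s - t i) := by
  -- The break points are the two ends and the exceptional points between them, listed in increasing
  -- order.
  let S : Finset ℝ := insert 0 (insert l (B.filter fun x => x ∈ Set.Ioo 0 l))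
  have hS : ∀ x ∈ S, 0 ≤ x ∧ x ≤ l := by
    intro x hx
    simp only [S, Finset.mem_insert, Finset.mem_filter] at hx
    rcases hx with rfl | rfl | ⟨_, hx⟩
    exacts [⟨le_rfl, hl.le⟩, ⟨hl.le, le_rfl⟩, ⟨hx.1.le, hx.2.le⟩]
  have h0 : (0 : ℝ) ∈ S := by simp [S]
  have h1 : l ∈ S := by simp [S]
  have hcard : 0 < S.card := Finset.card_pos.2 ⟨0, h0⟩
  obtain ⟨k, hk⟩ : ∃ k, S.card = k + 1 := ⟨S.card - 1, by omega⟩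
  let o := S.orderEmbOfFin hk
  have ho : ∀ i, o i ∈ S := fun i => S.orderEmbOfFin_mem hk i
  have hsurj : ∀ x ∈ S, ∃ i, o i = x := fun x hx => by
    have : x ∈ Set.range o := by rw [S.range_orderEmbOfFin hk]; exact hx
    exact this
  let t : ℕ → ℝ := fun i => if h : i < k + 1 then o ⟨i, h⟩ else l
  have ht : ∀ i (h : i < k + 1), t i = o ⟨i, h⟩ := fun i h => dif_pos h
  have hlt : ∀ i < k, t i < t (i + 1) := fun i hi => by
    rw [ht i (by omega), ht (i + 1) (by omega)]
    exact o.strictMono (Fin.mk_lt_mk.2 (Nat.lt_succ_self i))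
  have hint : ∀ i < k, ∃ n : ℤ, ∀ s ∈ Set.Icc (t i) (t (i + 1)),
      g s = g (t i) + n * (s - t i) := by
    intro i hi
    have hi0 : 0 ≤ t i := by rw [ht i (by omega)]; exact (hS _ (ho _)).1
    have hi1 : t (i + 1) ≤ l := by rw [ht (i + 1) (by omega)]; exact (hS _ (ho _)).2
    refine affine_of_locally_affine (hlt i hi) (hg.mono (Set.Icc_subset_Icc hi0 hi1)) fun s hs => ?_
    refine h s ⟨hi0.trans_lt hs.1, hs.2.trans_le hi1⟩ fun hB => ?_
    obtain ⟨j, hj⟩ := hsurj s (by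
      simp only [S, Finset.mem_insert, Finset.mem_filter]
      exact Or.inr (Or.inr ⟨hB, hi0.trans_lt hs.1, hs.2.trans_le hi1⟩))
    rw [ht i (by omega), ht (i + 1) (by omega), ← hj] at hs
    have h3 := o.lt_iff_lt.1 hs.1
    have h4 := o.lt_iff_lt.1 hs.2
    rw [Fin.lt_def] at h3 h4
    simp only at h3 h4
    omega
  choose! n hn using hint
  refine ⟨k, t, n, ?_, ?_, hlt, fun i hi s h3 h4 => hn i hi s ⟨h3, h4⟩⟩
  · obtain ⟨j, hj⟩ := hsurj 0 h0
    refine le_antisymm ?_ (by rw [ht 0 (by omega)]; exact (hS _ (ho _)).1)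
    rw [ht 0 (by omega), ← hj]
    exact o.monotone (Fin.mk_le_of_le_val (Nat.zero_le _))
  · obtain ⟨j, hj⟩ := hsurj l h1
    refine le_antisymm (by rw [ht k (by omega)]; exact (hS _ (ho _)).2) ?_
    rw [ht k (by omega), ← hj]
    exact o.monotone (Fin.le_def.2 (by simp only; omega))

namespace Model

variable {M : Model}

/-- A rational function with divisor `D`, linear on the pieces of a subdivision of the edges. -/
structure PLData (M : Model) (D : M.Div) where
  f : M.Point → ℝ
  k : M.E → ℕ
  t : M.E → ℕ → ℝ
  n : M.E → ℕ → ℤ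
  t_zero : ∀ e, t e 0 = 0
  t_last : ∀ e, t e (k e) = M.len e
  t_lt : ∀ e, ∀ i < k e, t e i < t e (i + 1)
  f_eq : ∀ e, ∀ i < k e, ∀ s, t e i ≤ s → s ≤ t e (i + 1) →
    f (M.edgePoint e s) = f (M.edgePoint e (t e i)) + n e i * (s - t e i)
  div_eq : D = ∑ e, ∑ i ∈ Finset.range (k e),
    n e i • (M.chip (M.edgePoint e (t e i)) - M.chip (M.edgePoint e (t e (i + 1))))

theorem sum_partition {t : ℕ → ℝ} {n : ℕ → ℤ} {g : ℝ → ℝ} {k : ℕ}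
    (hlt : ∀ i < k, t i < t (i + 1))
    (hg : ∀ i < k, ∀ s, t i ≤ s → s ≤ t (i + 1) → g s = g (t i) + n i * (s - t i))
    {s : ℝ} (hs : t 0 ≤ s) :
    ∑ i ∈ Finset.range k, n i * ramp (t i) (t (i + 1)) s = g (min s (t k)) - g (t 0) := by
  induction k with
  | zero => simp [min_eq_right hs]
  | succ k ih =>
    rw [Finset.sum_range_succ, ih (fun i hi => hlt i (by omega)) fun i hi => hg i (by omega)]
    have h1 := hlt k (by omega)
    have h2 := hg k (by omega)
    rcases le_total s (t k) with h | h
    · rw [ramp_of_le h, min_eq_left h, min_eq_left (h.trans h1.le)]; ring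
    · rw [min_eq_right h]
      rcases le_total s (t (k + 1)) with h' | h'
      · rw [min_eq_left h', ramp_of_mem h h', h2 s h h']; ring
      · rw [min_eq_right h', ramp_of_ge h1.le h', h2 _ h1.le le_rfl]; ring

theorem t_mono {t : ℕ → ℝ} {k : ℕ} (hlt : ∀ i < k, t i < t (i + 1)) {i j : ℕ} (hij : i ≤ j)
    (hj : j ≤ k) : t i ≤ t j := by
  induction j, hij using Nat.le_induction with
  | base => exact le_rfl
  | succ m hm ih => exact (ih (by omega)).trans (hlt m (by omega)).le

/-- A rational function coincides with the function built from one ramp on each of its pieces, so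
its divisor is the explicit divisor of these ramps. -/
theorem IsPrincipal.exists_plData (hl : ∀ e, 0 < M.len e) {D : M.Div} (hD : M.IsPrincipal D) :
    Nonempty (M.PLData D) := by
  obtain ⟨f, hf, hdiv⟩ := hD
  have h1 : ∀ e, ∃ (k : ℕ) (t : ℕ → ℝ) (n : ℕ → ℤ), t 0 = 0 ∧ t k = M.len e ∧
      (∀ i < k, t i < t (i + 1)) ∧ ∀ i < k, ∀ s, t i ≤ s → s ≤ t (i + 1) →
        f (M.edgePoint e s) = f (M.edgePoint e (t i)) + n i * (s - t i) := fun e => by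
    obtain ⟨B, hB⟩ := (hf e).2
    exact exists_partition (g := fun s => f (M.edgePoint e s)) (hl e) (hf e).1 B hB
  choose k t n h0 hk hlt haff using h1
  have hm0 : ∀ e, ∀ i ≤ k e, 0 ≤ t e i := fun e i hi => by
    rw [← h0 e]; exact t_mono (hlt e) (Nat.zero_le _) hi
  have hml : ∀ e, ∀ i ≤ k e, t e i ≤ M.len e := fun e i hi => by
    rw [← hk e]; exact t_mono (hlt e) hi le_rfl
  have hsum : ∀ (e : M.E) (s : ℝ), 0 ≤ s → s ≤ M.len e →
      ∑ i ∈ Finset.range (k e), n e i * ramp (t e i) (t e (i + 1)) s =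
        f (M.edgePoint e s) - f (M.vpt (M.src e)) := fun e s hs hs' => by
    rw [sum_partition (hlt e) (haff e) (by rwa [h0]), hk, min_eq_left hs', h0, edgePoint_zero]
  have hJ : ∀ (e : M.E) (g : (Σ e, Fin (k e)) → ℝ),
      ∑ j : Σ e, Fin (k e), (if j.1 = e then g j else 0) = ∑ i : Fin (k e), g ⟨e, i⟩ := by
    intro e g
    rw [Fintype.sum_sigma, Finset.sum_eq_single e]
    · simp
    · intro b _ hb; simp [hb]
    · exact fun h => (h (Finset.mem_univ _)).elim
  let R : M.RampData :=
    { J := Σ e, Fin (k e)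
      c := fun j => j.1
      α := fun j => t j.1 j.2
      β := fun j => t j.1 (j.2 + 1)
      n := fun j => n j.1 j.2
      F := fun v => f (M.vpt v)
      nonneg := fun j => hm0 _ _ j.2.2.le
      le := fun j => (hlt _ _ j.2.2).le
      le_len := fun j => hml _ _ j.2.2
      diff := fun e => by
        rw [hJ e fun j => (n j.1 j.2 : ℝ) * (t j.1 (j.2 + 1) - t j.1 j.2),
          Finset.sum_range (n := k e) (f := fun i => (n e i : ℝ) * (t e (i + 1) - t e i)) |>.symm,
          ← edgePoint_len hl, ← hsum e _ (hl e).le le_rfl]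
        refine Finset.sum_congr rfl fun i hi => ?_
        rw [Finset.mem_range] at hi
        rw [ramp_of_ge (hlt e i hi).le (hml e _ hi)] }
  have hR : R.toFun = f := by
    funext x
    rcases x with v | ⟨e, s, hs⟩
    · rfl
    · change f (M.vpt (M.src e)) + ∑ j : Σ e, Fin (k e), (if j.1 = e then
        (n j.1 j.2 : ℝ) * ramp (t j.1 j.2) (t j.1 (j.2 + 1)) s else 0) = _
      rw [hJ e fun j => (n j.1 j.2 : ℝ) * ramp (t j.1 j.2) (t j.1 (j.2 + 1)) s,
        Finset.sum_range (n := k e) (f := fun i => (n e i : ℝ) * ramp (t e i) (t e (i + 1)) s)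
          |>.symm, hsum e s hs.1.le hs.2.le, edgePoint_inr e hs]
      ring
  have hDR : D = R.div := Finsupp.ext fun x => by
    have := (hdiv x).trans ((R.divAt_toFun hl x).trans (by rw [hR])).symm
    exact_mod_cast this
  refine ⟨⟨f, k, t, n, h0, hk, hlt, haff, hDR.trans ?_⟩⟩
  unfold RampData.div
  refine (Fintype.sum_sigma _).trans (Finset.sum_congr rfl fun e _ => ?_)
  exact (Finset.sum_range (n := k e) (f := fun i =>
    n e i • (M.chip (M.edgePoint e (t e i)) - M.chip (M.edgePoint e (t e (i + 1)))))).symm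

namespace PLData

variable {D : M.Div} (P : M.PLData D)

theorem t_nonneg (e : M.E) {i : ℕ} (hi : i ≤ P.k e) : 0 ≤ P.t e i := by
  rw [← P.t_zero e]; exact t_mono (P.t_lt e) (Nat.zero_le _) hi

theorem t_le_len (e : M.E) {i : ℕ} (hi : i ≤ P.k e) : P.t e i ≤ M.len e := by
  rw [← P.t_last e]; exact t_mono (P.t_lt e) hi le_rfl

theorem f_succ (e : M.E) {i : ℕ} (hi : i < P.k e) :
    P.f (M.edgePoint e (P.t e (i + 1))) - P.f (M.edgePoint e (P.t e i)) =
      P.n e i * (P.t e (i + 1) - P.t e i) := by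
  rw [P.f_eq e i hi _ (P.t_lt e i hi).le le_rfl]; ring

/-- The ramps of piecewise linear data, one for each piece. -/
def toRampData (hl : ∀ e, 0 < M.len e) : M.RampData where
  J := Σ e, Fin (P.k e)
  c j := j.1
  α j := P.t j.1 j.2
  β j := P.t j.1 (j.2 + 1)
  n j := P.n j.1 j.2
  F v := P.f (M.vpt v)
  nonneg j := P.t_nonneg _ j.2.2.le
  le j := (P.t_lt _ _ j.2.2).le
  le_len j := P.t_le_len _ j.2.2
  diff e := by
    rw [Fintype.sum_sigma, Finset.sum_eq_single e]
    · simp only [if_true]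
      rw [Finset.sum_range (n := P.k e)
        (f := fun i => (P.n e i : ℝ) * (P.t e (i + 1) - P.t e i)) |>.symm,
        ← edgePoint_len hl, ← edgePoint_zero, ← P.t_zero e, ← P.t_last e,
        ← Finset.sum_range_sub (fun i => P.f (M.edgePoint e (P.t e i)))]
      refine Finset.sum_congr rfl fun i hi => P.f_succ e (Finset.mem_range.1 hi)
    · intro b _ hb; simp [hb]
    · exact fun h => (h (Finset.mem_univ _)).elim

theorem toRampData_div (hl : ∀ e, 0 < M.len e) : (P.toRampData hl).div = D := by
  refine Eq.trans ?_ P.div_eq.symm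
  refine (Fintype.sum_sigma _).trans (Finset.sum_congr rfl fun e _ => ?_)
  exact (Finset.sum_range (n := P.k e) (f := fun i => P.n e i •
    (M.chip (M.edgePoint e (P.t e i)) - M.chip (M.edgePoint e (P.t e (i + 1)))))).symm

end PLData

/-- After this no slope has to be computed again: adding functions means taking all their ramps
together. -/
theorem isPrincipal_iff_rampData (hl : ∀ e, 0 < M.len e) {D : M.Div} :
    M.IsPrincipal D ↔ ∃ R : M.RampData, R.div = D := by
  constructor
  · intro h
    obtain ⟨P⟩ := h.exists_plData hl
    exact ⟨P.toRampData hl, P.toRampData_div hl⟩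
  · rintro ⟨R, rfl⟩
    exact R.isPrincipal hl

theorem isPrincipal_zero (hl : ∀ e, 0 < M.len e) : M.IsPrincipal 0 :=
  (isPrincipal_iff_rampData hl).2 ⟨{
    J := Empty, c := fun j => j.elim, α := fun j => j.elim, β := fun j => j.elim,
    n := fun j => j.elim, F := fun _ => 0, nonneg := fun j => j.elim, le := fun j => j.elim,
    le_len := fun j => j.elim, diff := fun e => by simp }, by simp [RampData.div]⟩

theorem IsPrincipal.add (hl : ∀ e, 0 < M.len e) {D D' : M.Div} (h : M.IsPrincipal D)
    (h' : M.IsPrincipal D') : M.IsPrincipal (D + D') := by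
  rw [isPrincipal_iff_rampData hl] at *
  obtain ⟨R, rfl⟩ := h
  obtain ⟨R', rfl⟩ := h'
  refine ⟨{
    J := R.J ⊕ R'.J
    c := Sum.elim R.c R'.c
    α := Sum.elim R.α R'.α
    β := Sum.elim R.β R'.β
    n := Sum.elim R.n R'.n
    F := fun v => R.F v + R'.F v
    nonneg := by rintro (j | j); exacts [R.nonneg j, R'.nonneg j]
    le := by rintro (j | j); exacts [R.le j, R'.le j]
    le_len := by rintro (j | j); exacts [R.le_len j, R'.le_len j]
    diff := fun e => ?_ }, ?_⟩
  · rw [Fintype.sum_sum_type]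
    refine Eq.trans ?_ (congrArg₂ (· + ·) (R.diff e) (R'.diff e))
    ring
  · exact Fintype.sum_sum_type _

theorem IsPrincipal.neg (hl : ∀ e, 0 < M.len e) {D : M.Div} (h : M.IsPrincipal D) :
    M.IsPrincipal (-D) := by
  rw [isPrincipal_iff_rampData hl] at *
  obtain ⟨R, rfl⟩ := h
  refine ⟨{ R with n := fun j => -R.n j, F := fun v => -R.F v, diff := fun e => ?_ }, ?_⟩
  · have := R.diff e
    rw [show -R.F (M.tgt e) - -R.F (M.src e) = -(R.F (M.tgt e) - R.F (M.src e)) by ring, this,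
      ← Finset.sum_neg_distrib]
    refine Finset.sum_congr rfl fun j _ => ?_
    split_ifs
    · push_cast; ring
    · ring
  · change ∑ j, _ = -∑ j, _
    rw [← Finset.sum_neg_distrib]
    exact Finset.sum_congr rfl fun j _ => neg_smul _ _

theorem LinEquiv.refl (hl : ∀ e, 0 < M.len e) (D : M.Div) : M.LinEquiv D D := by
  unfold LinEquiv
  rw [sub_self]
  exact isPrincipal_zero hl

theorem LinEquiv.symm (hl : ∀ e, 0 < M.len e) {D D' : M.Div} (h : M.LinEquiv D D') :
    M.LinEquiv D' D := by
  unfold LinEquiv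
  rw [← neg_sub]
  exact IsPrincipal.neg hl h

theorem LinEquiv.trans (hl : ∀ e, 0 < M.len e) {D D' D'' : M.Div} (h : M.LinEquiv D D')
    (h' : M.LinEquiv D' D'') : M.LinEquiv D D'' := by
  unfold LinEquiv
  rw [← sub_add_sub_cancel D D' D'']
  exact IsPrincipal.add hl h h'

theorem LinEquiv.add (hl : ∀ e, 0 < M.len e) {A A' B B' : M.Div} (h : M.LinEquiv A A')
    (h' : M.LinEquiv B B') : M.LinEquiv (A + B) (A' + B') := by
  unfold LinEquiv
  rw [add_sub_add_comm]
  exact IsPrincipal.add hl h h'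

theorem LinEquiv.congr_sub {A B C D : M.Div} (h : M.LinEquiv A B) (h' : A - B = C - D) :
    M.LinEquiv C D := by
  unfold LinEquiv at *
  rwa [← h']

/-- The degree as a linear map. -/
theorem deg_eq (D : M.Div) : M.deg D = Finsupp.linearCombination ℤ (fun _ => (1 : ℤ)) D := by
  simp [deg, Finsupp.linearCombination_apply]

theorem deg_add (D D' : M.Div) : M.deg (D + D') = M.deg D + M.deg D' := by
  simp only [deg_eq, map_add]

theorem deg_sub (D D' : M.Div) : M.deg (D - D') = M.deg D - M.deg D' := by
  simp only [deg_eq, map_sub]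

theorem deg_chip (x : M.Point) : M.deg (M.chip x) = 1 := by
  simp [deg_eq]

theorem IsPrincipal.deg_eq_zero (hl : ∀ e, 0 < M.len e) {D : M.Div} (h : M.IsPrincipal D) :
    M.deg D = 0 := by
  obtain ⟨R, rfl⟩ := (isPrincipal_iff_rampData hl).1 h
  unfold RampData.div
  rw [deg_eq, map_sum]
  refine Finset.sum_eq_zero fun j _ => ?_
  rw [map_smul, map_sub, ← deg_eq, ← deg_eq, deg_chip, deg_chip, sub_self, smul_zero]

theorem LinEquiv.deg_eq (hl : ∀ e, 0 < M.len e) {D D' : M.Div} (h : M.LinEquiv D D') :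
    M.deg D = M.deg D' := by
  have := IsPrincipal.deg_eq_zero hl h
  rw [deg_sub] at this
  linarith

theorem eq_zero_of_deg {A : M.Div} (hA : 0 ≤ A) (h : M.deg A = 0) : A = 0 := by
  ext x
  have h1 : ∀ y ∈ A.support, 0 ≤ A y := fun y _ => hA y
  have h2 := (Finset.sum_eq_zero_iff_of_nonneg h1).1 h
  by_cases hx : x ∈ A.support
  · exact h2 x hx
  · exact Finsupp.notMem_support_iff.1 hx

/-- An effective divisor of positive degree contains a point. -/
theorem exists_chip_of_deg {A : M.Div} (hA : 0 ≤ A) {d : ℕ} (h : M.deg A = d + 1) :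
    ∃ (x : M.Point) (A' : M.Div), 0 ≤ A' ∧ A = A' + M.chip x ∧ M.deg A' = d := by
  have hne : A ≠ 0 := by
    rintro rfl
    simp [deg] at h
    omega
  obtain ⟨x, hx⟩ := Finsupp.ne_iff.1 hne
  have hx1 : 1 ≤ A x := by
    have := hA x
    simp only [Finsupp.coe_zero, Pi.zero_apply] at this hx
    omega
  refine ⟨x, A - M.chip x, fun y => ?_, (sub_add_cancel _ _).symm, ?_⟩
  · simp only [Finsupp.coe_zero, Pi.zero_apply, Finsupp.sub_apply, Finsupp.single_apply]
    have := hA y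
    simp only [Finsupp.coe_zero, Pi.zero_apply] at this
    split_ifs with hxy
    · subst hxy; omega
    · omega
  · rw [deg_sub, deg_chip, h]; ring

theorem eq_chip_of_deg {A : M.Div} (hA : 0 ≤ A) (h : M.deg A = 1) : ∃ x, A = M.chip x := by
  obtain ⟨x, A', h1, rfl, h3⟩ := exists_chip_of_deg hA (d := 0) (by simpa using h)
  exact ⟨x, by rw [eq_zero_of_deg h1 (by simpa using h3), zero_add]⟩

theorem chip_nonneg (x : M.Point) : 0 ≤ M.chip x := Finsupp.single_nonneg.2 zero_le_one

end Model

end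

section

open Multigraph

namespace Model

variable {M : Model}

/-! ### Level sets of rational functions -/

/-- The coefficients of a divisor in a set of points, added up. -/
def wt (U : Set M.Point) : M.Div →ₗ[ℤ] ℤ :=
  Finsupp.linearCombination ℤ fun x => if x ∈ U then (1 : ℤ) else 0

theorem wt_chip (U : Set M.Point) (x : M.Point) : wt U (M.chip x) = if x ∈ U then 1 else 0 := by
  simp [wt]

theorem exists_edgePoint (x : M.Point) :
    (∃ v, x = M.vpt v) ∨ ∃ e s, 0 < s ∧ s < M.len e ∧ x = M.edgePoint e s := by
  rcases x with v | ⟨e, s, hs⟩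
  · exact Or.inl ⟨v, rfl⟩
  · exact Or.inr ⟨e, s, hs.1, hs.2, (edgePoint_inr e hs).symm⟩

namespace PLData

variable {D : M.Div} (P : M.PLData D)

/-- The pieces of the edges. -/
abbrev Piece : Type := Σ e, Fin (P.k e)

/-- The initial point of a piece. -/
def p₀ (j : P.Piece) : M.Point := M.edgePoint j.1 (P.t j.1 j.2)

/-- The terminal point of a piece. -/
def p₁ (j : P.Piece) : M.Point := M.edgePoint j.1 (P.t j.1 (j.2 + 1))

/-- The slope on a piece. -/
def slope (j : P.Piece) : ℤ := P.n j.1 j.2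

/-- The length of a piece. -/
def length (j : P.Piece) : ℝ := P.t j.1 (j.2 + 1) - P.t j.1 j.2

theorem length_pos (j : P.Piece) : 0 < P.length j := sub_pos.2 (P.t_lt _ _ j.2.2)

theorem f_p₁ (j : P.Piece) : P.f (P.p₁ j) - P.f (P.p₀ j) = P.slope j * P.length j :=
  P.f_succ j.1 j.2.2

theorem div_eq_sum (hl : ∀ e, 0 < M.len e) :
    D = ∑ j : P.Piece, P.slope j • (M.chip (P.p₀ j) - M.chip (P.p₁ j)) :=
  (P.toRampData_div hl).symm

/-- A telescoping sum along the edge. -/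
theorem sum_edge (g : M.Point → ℤ) (hl : ∀ e, 0 < M.len e) (e : M.E) :
    ∑ j : P.Piece, (if j.1 = e then g (P.p₁ j) - g (P.p₀ j) else 0) =
      g (M.vpt (M.tgt e)) - g (M.vpt (M.src e)) := by
  rw [Fintype.sum_sigma, Finset.sum_eq_single e]
  · simp only [if_true]
    rw [← edgePoint_len hl, ← edgePoint_zero, ← P.t_zero e, ← P.t_last e,
      ← Finset.sum_range_sub (fun i => g (M.edgePoint e (P.t e i))), Finset.sum_range]
    rfl
  · intro b _ hb; simp [hb]
  · exact fun h => (h (Finset.mem_univ _)).elim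

/-- The two ends of a piece are on different sides of the level `τ`. -/
def Straddle (τ : ℝ) (j : P.Piece) : Prop := ¬ (P.f (P.p₀ j) ≤ τ ↔ P.f (P.p₁ j) ≤ τ)

theorem exists_piece (e : M.E) {s : ℝ} (h0 : 0 ≤ s) (h1 : s ≤ M.len e) (hl : 0 < M.len e) :
    ∃ j : P.Piece, j.1 = e ∧ P.t e j.2 ≤ s ∧ s ≤ P.t e (j.2 + 1) := by
  have key : ∀ m ≤ P.k e, 0 < m → s ≤ P.t e m → ∃ i < m, P.t e i ≤ s ∧ s ≤ P.t e (i + 1) := by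
    intro m
    induction m with
    | zero => exact fun _ h => (lt_irrefl _ h).elim
    | succ m ih =>
      intro hm _ hs
      rcases le_or_gt s (P.t e m) with h | h
      · rcases Nat.eq_zero_or_pos m with rfl | hm0
        · exact ⟨0, Nat.lt_succ_self 0, by rwa [P.t_zero], hs⟩
        · obtain ⟨i, hi, h2⟩ := ih (by omega) hm0 h
          exact ⟨i, by omega, h2⟩
      · exact ⟨m, Nat.lt_succ_self m, h.le, hs⟩
  have hk : 0 < P.k e := by
    by_contra hk
    have h2 := P.t_last e
    rw [show P.k e = 0 by omega, P.t_zero] at h2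
    exact hl.ne h2
  obtain ⟨i, hi, h2, h3⟩ := key (P.k e) le_rfl hk (by rwa [P.t_last])
  exact ⟨⟨e, i, hi⟩, rfl, h2, h3⟩

theorem f_between (j : P.Piece) {s : ℝ} (h0 : P.t j.1 j.2 ≤ s) (h1 : s ≤ P.t j.1 (j.2 + 1)) :
    (P.f (P.p₀ j) ≤ P.f (M.edgePoint j.1 s) ∧ P.f (M.edgePoint j.1 s) ≤ P.f (P.p₁ j)) ∨
    (P.f (P.p₁ j) ≤ P.f (M.edgePoint j.1 s) ∧ P.f (M.edgePoint j.1 s) ≤ P.f (P.p₀ j)) := by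
  have h2 := P.f_eq j.1 j.2 j.2.2 s h0 h1
  have h3 := P.f_eq j.1 j.2 j.2.2 _ (P.t_lt _ _ j.2.2).le le_rfl
  change P.f _ = P.f (P.p₀ j) + _ at h2
  change P.f (P.p₁ j) = P.f (P.p₀ j) + _ at h3
  have h4 : (P.n j.1 j.2 : ℝ) * (s - P.t j.1 j.2) +
      P.n j.1 j.2 * (P.t j.1 (j.2 + 1) - s) =
      P.n j.1 j.2 * (P.t j.1 (j.2 + 1) - P.t j.1 j.2) := by ring
  rcases le_total 0 (P.n j.1 j.2 : ℝ) with h | h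
  · have h5 := mul_nonneg h (sub_nonneg.2 h0)
    have h6 := mul_nonneg h (sub_nonneg.2 h1)
    left; constructor <;> linarith
  · have h5 := mul_nonpos_of_nonpos_of_nonneg h (sub_nonneg.2 h0)
    have h6 := mul_nonpos_of_nonpos_of_nonneg h (sub_nonneg.2 h1)
    right; constructor <;> linarith

theorem le_iff_of_not_straddle {τ : ℝ} {e : M.E}
    (h : ∀ j : P.Piece, j.1 = e → ¬ P.Straddle τ j) {i : ℕ} (hi : i ≤ P.k e) :
    P.f (M.edgePoint e (P.t e i)) ≤ τ ↔ P.f (M.vpt (M.src e)) ≤ τ := by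
  induction i with
  | zero => rw [P.t_zero, edgePoint_zero]
  | succ i ih =>
    rw [← ih (by omega)]
    exact (not_not.1 (h ⟨e, i, by omega⟩ rfl)).symm

theorem src_iff_tgt_of_not_straddle (hl : ∀ e, 0 < M.len e) {τ : ℝ} {e : M.E}
    (h : ∀ j : P.Piece, j.1 = e → ¬ P.Straddle τ j) :
    P.f (M.vpt (M.src e)) ≤ τ ↔ P.f (M.vpt (M.tgt e)) ≤ τ := by
  rw [← edgePoint_len hl e, ← P.t_last e]
  exact (P.le_iff_of_not_straddle h le_rfl).symm

theorem forall_iff_of_not_straddle (hl : ∀ e, 0 < M.len e) (hc : M.Connected) {τ : ℝ}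
    (h : ∀ j, ¬ P.Straddle τ j) (x y : M.Point) : P.f x ≤ τ ↔ P.f y ≤ τ := by
  have hv : ∀ u v, P.f (M.vpt u) ≤ τ ↔ P.f (M.vpt v) ≤ τ := fun u v =>
    join_mem_iff (U := {v | P.f (M.vpt v) ≤ τ})
      (fun e _ => P.src_iff_tgt_of_not_straddle hl fun j _ => h j) (hc.2 u v)
  have hx : ∀ x, ∃ v, P.f x ≤ τ ↔ P.f (M.vpt v) ≤ τ := by
    intro x
    rcases exists_edgePoint x with ⟨v, rfl⟩ | ⟨e, s, h0, h1, rfl⟩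
    · exact ⟨v, Iff.rfl⟩
    · obtain ⟨j, rfl, h2, h3⟩ := P.exists_piece e h0.le h1.le (hl e)
      refine ⟨M.src j.1, ?_⟩
      rw [← P.le_iff_of_not_straddle (fun j _ => h j) j.2.2.le]
      have h4 := not_not.1 (h j)
      change _ ↔ P.f (P.p₀ j) ≤ τ
      rcases P.f_between j h2 h3 with ⟨h5, h6⟩ | ⟨h5, h6⟩
      · exact ⟨fun h => h5.trans h, fun h => h6.trans (h4.1 h)⟩
      · exact ⟨fun h => h4.2 (h5.trans h), fun h => h6.trans h⟩
  obtain ⟨u, hu⟩ := hx x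
  obtain ⟨v, hv'⟩ := hx y
  rw [hu, hv']
  exact hv u v

/-- In a 2-edge-connected graph, a level that is crossed is crossed at least twice. -/
theorem exists_two_straddle (hl : ∀ e, 0 < M.len e) (h2 : M.TwoEdgeConnected) {τ : ℝ}
    {x y : M.Point} (hx : P.f x ≤ τ) (hy : τ < P.f y) :
    ∃ j₁ j₂, j₁ ≠ j₂ ∧ P.Straddle τ j₁ ∧ P.Straddle τ j₂ := by
  have h1 : ∃ j, P.Straddle τ j := by
    by_contra h
    push Not at h
    exact absurd ((P.forall_iff_of_not_straddle hl h2.connected h x y).1 hx) (not_le.2 hy)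
  obtain ⟨j, hj⟩ := h1
  by_contra hcon
  have hu : ∀ j', P.Straddle τ j' → j' = j := fun j' hj' => by
    by_contra hne
    exact hcon ⟨j', j, hne, hj', hj⟩
  -- If a single piece crossed the level, the other edges would still join the ends of its edge,
  -- putting both ends on the same side. Yet the telescoping sum along that edge would have exactly
  -- one nonzero term.
  have hb := (twoEdgeConnected_iff.1 h2).2 j.1
  rw [isBridge_iff h2.connected, not_not] at hb
  have h3 : P.f (M.vpt (M.src j.1)) ≤ τ ↔ P.f (M.vpt (M.tgt j.1)) ≤ τ :=
    join_mem_iff (U := {v | P.f (M.vpt v) ≤ τ}) (fun e (he : e ≠ j.1) =>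
      P.src_iff_tgt_of_not_straddle hl fun j' hj' hs => he (by rw [← hj', hu j' hs])) hb
  let g : M.Point → ℤ := fun x => if P.f x ≤ τ then 1 else 0
  have h4 := P.sum_edge g hl j.1
  have h5 : g (M.vpt (M.tgt j.1)) = g (M.vpt (M.src j.1)) := by
    simp only [g, h3]
  rw [h5, sub_self, Finset.sum_eq_single j, if_pos rfl] at h4
  · apply hj
    by_contra h6
    simp only [g] at h4
    split_ifs at h4 <;> first | omega | tauto
  · intro b _ hb
    split_ifs
    · by_cases hs : P.Straddle τ b
      · exact (hb (hu b hs)).elim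
      · have := not_not.1 hs
        simp only [g, this, sub_self]
    · rfl
  · exact fun h => (h (Finset.mem_univ _)).elim

/-- The contribution of a piece to the flux at the level `τ`. -/
def flux (τ : ℝ) (j : P.Piece) : ℤ :=
  P.slope j * ((if P.f (P.p₀ j) ≤ τ then 1 else 0) - if P.f (P.p₁ j) ≤ τ then 1 else 0)

/-- A discrete divergence theorem: the degree of the divisor on a sublevel set is the total slope
with which the function leaves it. -/
theorem wt_eq_sum_flux (hl : ∀ e, 0 < M.len e) (τ : ℝ) :
    wt {x | P.f x ≤ τ} D = ∑ j, P.flux τ j := by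
  refine (congrArg (wt _) (P.div_eq_sum hl)).trans ?_
  rw [map_sum]
  refine Finset.sum_congr rfl fun j _ => ?_
  rw [map_smul, map_sub, wt_chip, wt_chip]
  rfl

theorem slope_pos_iff (j : P.Piece) : 0 < P.slope j ↔ P.f (P.p₀ j) < P.f (P.p₁ j) := by
  rw [← sub_pos (b := P.f (P.p₀ j)), P.f_p₁, mul_pos_iff_of_pos_right (P.length_pos j)]
  exact_mod_cast Iff.rfl

theorem slope_neg_iff (j : P.Piece) : P.slope j < 0 ↔ P.f (P.p₁ j) < P.f (P.p₀ j) := by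
  rw [← sub_neg (b := P.f (P.p₀ j)), P.f_p₁, mul_neg_iff]
  have := P.length_pos j
  constructor
  · exact fun h => Or.inr ⟨by exact_mod_cast h, this⟩
  · rintro (⟨_, h⟩ | ⟨h, _⟩)
    · linarith
    · exact_mod_cast h

theorem flux_nonneg (τ : ℝ) (j : P.Piece) : 0 ≤ P.flux τ j := by
  have h1 := P.slope_pos_iff j
  have h2 := P.slope_neg_iff j
  unfold flux
  split_ifs with h3 h4 h4
  · simp
  · have := h1.2 (by linarith)
    omega
  · have := h2.2 (by linarith)
    omega
  · simp

theorem flux_pos {τ : ℝ} {j : P.Piece} (h : P.Straddle τ j) :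
    (P.f (P.p₀ j) ≤ τ ∧ τ < P.f (P.p₁ j) ∧ 1 ≤ P.slope j ∧ P.flux τ j = P.slope j) ∨
    (P.f (P.p₁ j) ≤ τ ∧ τ < P.f (P.p₀ j) ∧ P.slope j ≤ -1 ∧ P.flux τ j = -P.slope j) := by
  have h1 := P.slope_pos_iff j
  have h2 := P.slope_neg_iff j
  unfold Straddle at h
  unfold flux
  by_cases h3 : P.f (P.p₀ j) ≤ τ
  · have h4 : ¬ P.f (P.p₁ j) ≤ τ := by tauto
    rw [if_pos h3, if_neg h4]
    have := h1.2 (by linarith)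
    exact Or.inl ⟨h3, not_le.1 h4, by omega, by ring⟩
  · have h4 : P.f (P.p₁ j) ≤ τ := by tauto
    rw [if_neg h3, if_pos h4]
    have := h2.2 (by linarith)
    exact Or.inr ⟨h4, not_le.1 h3, by omega, by ring⟩

theorem one_le_flux {τ : ℝ} {j : P.Piece} (h : P.Straddle τ j) : 1 ≤ P.flux τ j := by
  rcases P.flux_pos h with ⟨_, _, h3, h4⟩ | ⟨_, _, h3, h4⟩ <;> omega

theorem sum_flux_ge {τ : ℝ} (s : Finset P.Piece) : ∑ j ∈ s, P.flux τ j ≤ ∑ j, P.flux τ j :=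
  Finset.sum_le_sum_of_subset_of_nonneg (Finset.subset_univ s) fun j _ _ => P.flux_nonneg τ j

/-- At least two pieces leave the sublevel set, each with a positive integer slope. All statements
about equivalence on 2-edge-connected graphs below rest on this bound. -/
theorem two_le_wt (hl : ∀ e, 0 < M.len e) (h2 : M.TwoEdgeConnected) {τ : ℝ}
    {x y : M.Point} (hx : P.f x ≤ τ) (hy : τ < P.f y) : 2 ≤ wt {x | P.f x ≤ τ} D := by
  obtain ⟨j₁, j₂, hne, h3, h4⟩ := P.exists_two_straddle hl h2 hx hy
  rw [P.wt_eq_sum_flux hl]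
  refine le_trans ?_ (P.sum_flux_ge {j₁, j₂})
  rw [Finset.sum_pair hne]
  have := P.one_le_flux h3
  have := P.one_le_flux h4
  omega

theorem eq_zero_of_const (hl : ∀ e, 0 < M.len e) (h : ∀ x y, P.f x ≤ P.f y) : D = 0 := by
  rw [P.div_eq_sum hl]
  refine Finset.sum_eq_zero fun j _ => ?_
  have h1 := P.slope_pos_iff j
  have h2 := P.slope_neg_iff j
  have h3 : P.slope j = 0 := by
    have := not_lt.2 (h (P.p₁ j) (P.p₀ j))
    have := not_lt.2 (h (P.p₀ j) (P.p₁ j))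
    have := mt h1.1 (by assumption)
    have := mt h2.1 (by assumption)
    omega
  rw [h3, zero_smul]

end PLData

/-- In a 2-edge-connected metric graph different points are not equivalent. -/
theorem eq_of_chip_linEquiv (hl : ∀ e, 0 < M.len e) (h2 : M.TwoEdgeConnected) {x y : M.Point}
    (h : M.LinEquiv (M.chip x) (M.chip y)) : x = y := by
  obtain ⟨P⟩ := IsPrincipal.exists_plData hl h
  -- A nonconstant function would give some sublevel set degree at least two, but `x - y` has degree
  -- at most one on any set.
  have h0 := P.eq_zero_of_const hl fun a b => by
    by_contra hab
    have := P.two_le_wt hl h2 le_rfl (not_le.1 hab)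
    rw [map_sub, wt_chip, wt_chip] at this
    split_ifs at this <;> omega
  exact Finsupp.single_left_injective one_ne_zero (sub_eq_zero.1 h0)

/-- Two principal ramps across an edge cut. -/
theorem isPrincipal_two_ramps (hl : ∀ e, 0 < M.len e) (U : Set M.V) (e₁ e₂ : M.E)
    (α₁ α₂ δ : ℝ) (n₁ n₂ : ℤ) (hδ : 0 ≤ δ) (h₁ : 0 ≤ α₁) (h₁' : α₁ + δ ≤ M.len e₁)
    (h₂ : 0 ≤ α₂) (h₂' : α₂ + δ ≤ M.len e₂)
    (hU : ∀ e, (if M.tgt e ∈ U then 0 else 1) - (if M.src e ∈ U then 0 else 1) =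
      (if e₁ = e then n₁ else 0) + (if e₂ = e then n₂ else 0)) :
    M.IsPrincipal (n₁ • (M.chip (M.edgePoint e₁ α₁) - M.chip (M.edgePoint e₁ (α₁ + δ))) +
      n₂ • (M.chip (M.edgePoint e₂ α₂) - M.chip (M.edgePoint e₂ (α₂ + δ)))) := by
  -- The function is `0` on `U` and `δ` outside. By `hU` the two ramps account for all its jumps
  -- across the cut.
  let R : M.RampData :=
    { J := Bool
      c := fun b => cond b e₁ e₂
      α := fun b => cond b α₁ α₂
      β := fun b => cond b (α₁ + δ) (α₂ + δ)
      n := fun b => cond b n₁ n₂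
      F := fun v => if v ∈ U then 0 else δ
      nonneg := by rintro (_ | _) <;> assumption
      le := by rintro (_ | _) <;> simpa
      le_len := by rintro (_ | _) <;> assumption
      diff := fun e => by
        have h3 := congrArg (fun n : ℤ => (n : ℝ) * δ) (hU e)
        simp only [Fintype.sum_bool, cond_true, cond_false] at h3 ⊢
        push_cast at h3
        have h4 : ∀ v, (if v ∈ U then (0 : ℝ) else δ) = (if v ∈ U then 0 else 1) * δ := by
          intro v; split_ifs <;> ring
        rw [h4, h4, ← sub_mul, h3, add_mul, ite_mul, ite_mul]
        congr 2 <;> ring }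
  have := R.isPrincipal hl
  unfold RampData.div at this
  rw [Fintype.sum_bool] at this
  exact this

/-- A point of an edge at distance `δ` from the point at `s`, forwards or backwards. -/
def moved (M : Model) (e : M.E) (s : ℝ) (σ : ℤ) (δ : ℝ) : M.Point := M.edgePoint e (s + σ * δ)

/-- Moving two points along two edges. -/
theorem linEquiv_move (hl : ∀ e, 0 < M.len e) (U : Set M.V) (e₁ e₂ : M.E)
    (s₁ s₂ δ : ℝ) (σ₁ σ₂ : ℤ) (hδ : 0 ≤ δ) (hσ₁ : σ₁ = 1 ∨ σ₁ = -1) (hσ₂ : σ₂ = 1 ∨ σ₂ = -1)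
    (h₁ : 0 ≤ s₁ ∧ s₁ ≤ M.len e₁) (h₁' : 0 ≤ s₁ + σ₁ * δ ∧ s₁ + σ₁ * δ ≤ M.len e₁)
    (h₂ : 0 ≤ s₂ ∧ s₂ ≤ M.len e₂) (h₂' : 0 ≤ s₂ + σ₂ * δ ∧ s₂ + σ₂ * δ ≤ M.len e₂)
    (hU : ∀ e, (if M.tgt e ∈ U then 0 else 1) - (if M.src e ∈ U then 0 else 1) =
      (if e₁ = e then σ₁ else 0) + (if e₂ = e then σ₂ else 0)) :
    M.LinEquiv (M.chip (M.edgePoint e₁ s₁) + M.chip (M.edgePoint e₂ s₂))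
      (M.chip (M.moved e₁ s₁ σ₁ δ) + M.chip (M.moved e₂ s₂ σ₂ δ)) := by
  -- A backward move from `s` is a ramp of slope `-1` that begins at `s - δ`.
  have key : ∀ (e : M.E) (s : ℝ) (σ : ℤ), σ = 1 ∨ σ = -1 →
      0 ≤ s ∧ s ≤ M.len e → 0 ≤ s + σ * δ ∧ s + σ * δ ≤ M.len e →
      ∃ α, 0 ≤ α ∧ α + δ ≤ M.len e ∧
        σ • (M.chip (M.edgePoint e α) - M.chip (M.edgePoint e (α + δ))) =
          M.chip (M.edgePoint e s) - M.chip (M.moved e s σ δ) := by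
    rintro e s σ (rfl | rfl) h h'
    · refine ⟨s, h.1, ?_, ?_⟩
      · have := h'.2; push_cast at this; linarith
      · rw [one_smul, moved]; push_cast; rw [one_mul]
    · refine ⟨s - δ, ?_, by linarith [h.2], ?_⟩
      · have := h'.1; push_cast at this; linarith
      · rw [neg_smul, one_smul, neg_sub, moved, sub_add_cancel]
        push_cast
        rw [neg_one_mul, sub_eq_add_neg s δ]
  obtain ⟨α₁, ha, hb, hc⟩ := key e₁ s₁ σ₁ hσ₁ h₁ h₁'
  obtain ⟨α₂, ha', hb', hc'⟩ := key e₂ s₂ σ₂ hσ₂ h₂ h₂'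
  have := isPrincipal_two_ramps hl U e₁ e₂ α₁ α₂ δ σ₁ σ₂ hδ ha hb ha' hb' hU
  rw [hc, hc'] at this
  unfold LinEquiv
  rwa [add_sub_add_comm]

/-! ### Contraction of bridges -/

/-- The contraction of a set of edges of a metric graph. -/
def contract (M : Model) (B : Set M.E) : Model where
  toMultigraph := ((⟨M.toMultigraph, fun _ => 0⟩ : WGraph).contract B).toMultigraph
  len e := M.len e.1

/-- The class of a vertex in the contraction. -/
def projV (M : Model) (B : Set M.E) (v : M.V) : (M.contract B).V :=
  Quotient.mk (M.joinSetoid B) v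

/-- The map of metric graphs. -/
def proj (M : Model) (B : Set M.E) : M.Point → (M.contract B).Point
  | .inl v => (M.contract B).vpt (M.projV B v)
  | .inr ⟨e, t⟩ => if h : e ∈ B then (M.contract B).vpt (M.projV B (M.src e))
      else Sum.inr ⟨⟨e, h⟩, t⟩

/-- The push-forward of divisors. -/
def push (M : Model) (B : Set M.E) : M.Div →+ (M.contract B).Div :=
  Finsupp.mapDomain.addMonoidHom (M.proj B)

theorem push_chip (B : Set M.E) (x : M.Point) :
    M.push B (M.chip x) = (M.contract B).chip (M.proj B x) := Finsupp.mapDomain_single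

theorem proj_vpt (B : Set M.E) (v : M.V) :
    M.proj B (M.vpt v) = (M.contract B).vpt (M.projV B v) := rfl

theorem proj_edgePoint_of_mem {B : Set M.E} {e : M.E} (he : e ∈ B) (t : ℝ) :
    M.proj B (M.edgePoint e t) = (M.contract B).vpt (M.projV B (M.src e)) := by
  by_cases ht : t ∈ Set.Ioo (0 : ℝ) (M.len e)
  · rw [edgePoint_inr e ht]
    exact dif_pos he
  · have h1 : M.edgePoint e t = M.vpt (M.src e) ∨ M.edgePoint e t = M.vpt (M.tgt e) := by
      by_cases h0 : t ≤ 0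
      · exact Or.inl (edgePoint_of_nonpos e h0)
      · exact Or.inr ((dif_neg ht).trans (if_neg h0))
    rcases h1 with h1 | h1 <;> rw [h1, proj_vpt]
    exact congrArg _ (Quotient.sound (Setoid.symm' _ (join_edge he)))

theorem proj_edgePoint {B : Set M.E} {e : M.E} (he : e ∉ B) (t : ℝ) :
    M.proj B (M.edgePoint e t) = (M.contract B).edgePoint ⟨e, he⟩ t := by
  by_cases ht : t ∈ Set.Ioo (0 : ℝ) (M.len e)
  · rw [edgePoint_inr e ht, edgePoint_inr (M := M.contract B) ⟨e, he⟩ ht]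
    exact dif_neg he
  · by_cases h0 : t ≤ 0
    · rw [edgePoint_of_nonpos e h0, edgePoint_of_nonpos (M := M.contract B) ⟨e, he⟩ h0]
      rfl
    · rw [show M.edgePoint e t = M.vpt (M.tgt e) from (dif_neg ht).trans (if_neg h0),
        show (M.contract B).edgePoint ⟨e, he⟩ t = (M.contract B).vpt (M.projV B (M.tgt e)) from
          (dif_neg ht).trans (if_neg h0)]
      rfl

theorem proj_surjective (B : Set M.E) : Function.Surjective (M.proj B) := by
  rintro (c | ⟨⟨e, he⟩, t⟩)
  · obtain ⟨v, rfl⟩ := Quotient.exists_rep c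
    exact ⟨M.vpt v, rfl⟩
  · exact ⟨Sum.inr ⟨e, t⟩, dif_neg he⟩

theorem len_contract_pos (hl : ∀ e, 0 < M.len e) (B : Set M.E) (e : (M.contract B).E) :
    0 < (M.contract B).len e := hl e.1

theorem sum_subtype_of_eq_zero {J A : Type*} [Fintype J] [AddCommMonoid A] (p : J → Prop)
    [Fintype {j // p j}] (g : J → A) (h : ∀ j, ¬ p j → g j = 0) : ∑ j : {j // p j}, g j.1 = ∑ j, g j := by
  rw [← Finset.sum_subtype (Finset.univ.filter p) (by simp)]
  exact Finset.sum_filter_of_ne fun j _ hj => by_contra fun hp => hj (h j hp)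

/-- The push-forward of a principal divisor along a contraction of bridges is principal. -/
theorem IsPrincipal.push (hl : ∀ e, 0 < M.len e) (hc : M.Connected) {B : Set M.E}
    (hB : ∀ e ∈ B, M.IsBridge e) {D : M.Div} (hD : M.IsPrincipal D) :
    (M.contract B).IsPrincipal (M.push B D) := by
  obtain ⟨R, rfl⟩ := (isPrincipal_iff_rampData hl).1 hD
  let W : M.E → Set M.V := fun b => {v | M.joinSetoid {e | e ≠ b} (M.src b) v}
  have hWs : ∀ b, M.src b ∈ W b := fun b => (M.joinSetoid _).refl _
  have hWt : ∀ b ∈ B, M.tgt b ∉ W b := fun b hb => (isBridge_iff hc b).1 (hB b hb)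
  have hW : ∀ b e, e ≠ b → (M.src e ∈ W b ↔ M.tgt e ∈ W b) := fun b e he =>
    ⟨fun h => Setoid.trans' _ h (join_edge (S := {e | e ≠ b}) he),
      fun h => Setoid.trans' _ h (Setoid.symm' _ (join_edge (S := {e | e ≠ b}) he))⟩
  let jump : M.E → ℝ := fun b => R.F (M.tgt b) - R.F (M.src b)
  -- `W b` is the side of the bridge `b` that contains its source. Subtracting the jump across each
  -- bridge from the far side makes the function constant along `B` and leaves the differences along
  -- all other edges unchanged.
  let F' : M.V → ℝ := fun v =>
    R.F v - ∑ b : {b // b ∈ B}, if v ∈ W b.1 then 0 else jump b.1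
  have hF'B : ∀ e ∈ B, F' (M.src e) = F' (M.tgt e) := by
    intro e he
    have h1 : ∑ b : {b // b ∈ B}, (if M.tgt e ∈ W b.1 then 0 else jump b.1) =
        (∑ b : {b // b ∈ B}, if M.src e ∈ W b.1 then 0 else jump b.1) + jump e := by
      rw [← sub_eq_iff_eq_add', ← Finset.sum_sub_distrib,
        Finset.sum_eq_single (⟨e, he⟩ : {b // b ∈ B})]
      · rw [if_neg (hWt e he), if_pos (hWs e), sub_zero]
      · intro b _ hb
        have := hW b.1 e fun h => hb (Subtype.ext h.symm)
        simp only [this, sub_self]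
      · exact fun h => (h (Finset.mem_univ _)).elim
    simp only [F', h1, jump]
    ring
  have hF'N : ∀ e ∉ B, F' (M.tgt e) - F' (M.src e) = R.F (M.tgt e) - R.F (M.src e) := by
    intro e he
    have h1 : ∑ b : {b // b ∈ B}, (if M.tgt e ∈ W b.1 then 0 else jump b.1) =
        ∑ b : {b // b ∈ B}, if M.src e ∈ W b.1 then 0 else jump b.1 :=
      Finset.sum_congr rfl fun b _ => by
        have := hW b.1 e fun h => he (h ▸ b.2)
        simp only [this]
    simp only [F', h1]
    ring
  have hlift : ∀ a b, M.joinSetoid B a b → F' a = F' b := fun a b h =>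
    joinSetoid_le (Setoid.ker F') hF'B h
  let R' : (M.contract B).RampData :=
    { J := {j // R.c j ∉ B}
      c := fun j => ⟨R.c j.1, j.2⟩
      α := fun j => R.α j.1
      β := fun j => R.β j.1
      n := fun j => R.n j.1
      F := Quotient.lift F' hlift
      nonneg := fun j => R.nonneg _
      le := fun j => R.le _
      le_len := fun j => R.le_len _
      diff := fun e => by
        refine (hF'N e.1 e.2).trans ((R.diff e.1).trans ?_)
        refine ((sum_subtype_of_eq_zero (fun j => R.c j ∉ B) _ fun j hj => if_neg fun h : R.c j = e.1 =>
          hj (show R.c j ∉ B from h.symm ▸ e.2)).symm.trans ?_)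
        refine Finset.sum_congr rfl fun j _ => ?_
        congr 1
        exact propext ⟨fun h => Subtype.ext h, fun h => congrArg Subtype.val h⟩ }
  have h3 : M.push B R.div = R'.div := by
    unfold RampData.div
    rw [map_sum]
    refine (sum_subtype_of_eq_zero (fun j => R.c j ∉ B) _ fun j hj => ?_).symm.trans ?_
    · rw [map_zsmul, map_sub, push_chip, push_chip, proj_edgePoint_of_mem (not_not.1 hj),
        proj_edgePoint_of_mem (not_not.1 hj), sub_self, smul_zero]
    · refine Finset.sum_congr rfl fun j _ => ?_
      rw [map_zsmul, map_sub, push_chip, push_chip, proj_edgePoint j.2, proj_edgePoint j.2]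
  rw [h3]
  exact R'.isPrincipal (len_contract_pos hl B)

end Model

end

/-! ### From length-preserving involutions to divisors of degree two and rank one. -/

section

open Multigraph

namespace Model

variable {M : Model}

theorem deg_nonneg {A : M.Div} (hA : 0 ≤ A) : 0 ≤ M.deg A :=
  Finset.sum_nonneg fun x _ => hA x

/-- Linear equivalence of points. -/
def chipSetoid (hl : ∀ e, 0 < M.len e) : Setoid M.Point where
  r x y := M.LinEquiv (M.chip x) (M.chip y)
  iseqv := ⟨fun _ => LinEquiv.refl hl _, LinEquiv.symm hl, LinEquiv.trans hl⟩

/-- The points of a bridge are equivalent. -/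
theorem linEquiv_of_isBridge (hl : ∀ e, 0 < M.len e) (hc : M.Connected) {e : M.E}
    (he : M.IsBridge e) {s : ℝ} (h0 : 0 ≤ s) (h1 : s ≤ M.len e) :
    M.LinEquiv (M.chip (M.vpt (M.src e))) (M.chip (M.edgePoint e s)) := by
  have ht := (isBridge_iff hc e).1 he
  -- A bridge is a cut by itself, so the second ramp is a dummy of slope zero.
  have h := isPrincipal_two_ramps hl {v | M.joinSetoid {e' | e' ≠ e} (M.src e) v} e e 0 0 s 1 0 h0
    le_rfl (by simpa using h1) le_rfl (by simpa using h1) fun e' => by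
      by_cases hee : e' = e
      · subst hee
        simp [ht]
      · have : M.joinSetoid {e'' | e'' ≠ e} (M.src e) (M.src e') ↔
            M.joinSetoid {e'' | e'' ≠ e} (M.src e) (M.tgt e') :=
          ⟨fun h => Setoid.trans' _ h (join_edge (S := {e' | e' ≠ e}) hee),
            fun h => Setoid.trans' _ h (Setoid.symm' _ (join_edge (S := {e' | e' ≠ e}) hee))⟩
        simp [this, Ne.symm hee]
  rwa [one_smul, zero_smul, add_zero, zero_add, edgePoint_zero] at h

theorem linEquiv_of_join (hl : ∀ e, 0 < M.len e) (hc : M.Connected) {B : Set M.E}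
    (hB : ∀ e ∈ B, M.IsBridge e) {a b : M.V} (h : M.joinSetoid B a b) :
    M.LinEquiv (M.chip (M.vpt a)) (M.chip (M.vpt b)) :=
  joinSetoid_le ((chipSetoid hl).comap M.vpt) (fun e he => by
    have := linEquiv_of_isBridge hl hc (hB e he) (hl e).le le_rfl
    rwa [edgePoint_len hl] at this) h

section

variable {B : Set M.E} (H : HypInv M.toMultigraph B)

/-- A vertex and its conjugate. -/
def pairDiv (v : M.V) : M.Div := M.chip (M.vpt v) + M.chip (M.vpt (H.onV v))

/-- The edge and its partner form a cut with invariant sides, so the chips at the source and at its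
conjugate cross it in the same direction. Moving both at equal speed is a linear equivalence. The
two cases are the two orientations of the partner. -/
theorem pairDiv_edge_of_ne (hl : ∀ e, 0 < M.len e) (hc : M.Connected)
    (hlen : ∀ e, M.len (H.onE e) = M.len e) {e : M.E} (he : H.onE e ≠ e) :
    M.LinEquiv (pairDiv H (M.src e)) (pairDiv H (M.tgt e)) ∧ ∀ s, 0 ≤ s → s ≤ M.len e →
      ∃ x, M.LinEquiv (pairDiv H (M.src e)) (M.chip (M.edgePoint e s) + M.chip x) := by
  have hj := fun {a b : M.V} => linEquiv_of_join (a := a) (b := b) hl hc H.isBridge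
  obtain ⟨U, hUi, hUs, hUt, hU⟩ : ∃ U : Set M.V, (∀ v, H.onV v ∈ U ↔ v ∈ U) ∧ M.src e ∈ U ∧
      M.tgt e ∉ U ∧ ∀ e', e' ≠ e → e' ≠ H.onE e → (M.src e' ∈ U ↔ M.tgt e' ∈ U) := by
    obtain ⟨U, h1, h2, h3⟩ := H.cut e he
    by_cases h : M.src e ∈ U
    · exact ⟨U, h1, h, fun h4 => h2 (iff_of_true h h4), h3⟩
    · exact ⟨Uᶜ, fun v => not_congr (h1 v), h, fun h4 => h2 (iff_of_false h h4),
        fun e' h5 h6 => not_congr (h3 e' h5 h6)⟩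
  have hsat := fun {a b : M.V} => H.cut_saturated (a := a) (b := b) he hU
  have hcong := fun {a b c : M.V} (h : M.joinSetoid B b c) =>
    LinEquiv.add hl (LinEquiv.refl hl (M.chip (M.vpt a))) (hj h)
  rcases H.ends e (H.notMem_of_ne he) with ⟨h1, h2⟩ | ⟨h1, h2⟩
  · have hm : ∀ s, 0 ≤ s → s ≤ M.len e → M.LinEquiv (pairDiv H (M.src e))
        (M.chip (M.edgePoint e s) + M.chip (M.edgePoint (H.onE e) s)) := fun s h0 hs => by
      have := linEquiv_move hl U e (H.onE e) 0 0 s 1 1 h0 (Or.inl rfl) (Or.inl rfl)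
        ⟨le_rfl, (hl _).le⟩ (by simpa using ⟨h0, hs⟩) ⟨le_rfl, (hl _).le⟩
        (by simpa [hlen] using ⟨h0, hs⟩) fun e' => by
          have h3 := (hsat h1).trans (hUi _)
          have h4 := (hsat h2).trans (hUi _)
          by_cases he1 : e' = e
          · subst he1; simp [hUs, hUt, he]
          · by_cases he2 : e' = H.onE e
            · subst he2; simp [h3, h4, hUs, hUt, Ne.symm he]
            · simp [hU e' he1 he2, Ne.symm he1, Ne.symm he2]
      simp only [moved, edgePoint_zero, Int.cast_one, one_mul, zero_add] at this
      exact (hcong (Setoid.symm' _ h1)).trans hl this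
    refine ⟨?_, fun s h0 hs => ⟨_, hm s h0 hs⟩⟩
    have := hm _ (hl e).le le_rfl
    rw [edgePoint_len hl, ← hlen, edgePoint_len hl] at this
    exact this.trans hl (hcong h2)
  · have hm : ∀ s, 0 ≤ s → s ≤ M.len e → M.LinEquiv (pairDiv H (M.src e))
        (M.chip (M.edgePoint e s) + M.chip (M.edgePoint (H.onE e) (M.len e - s))) :=
      fun s h0 hs => by
      have := linEquiv_move hl U e (H.onE e) 0 (M.len e) s 1 (-1) h0 (Or.inl rfl) (Or.inr rfl)
        ⟨le_rfl, (hl _).le⟩ (by simpa using ⟨h0, hs⟩) ⟨(hl _).le, (hlen e).ge⟩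
        (by simpa [hlen] using ⟨hs, h0⟩) fun e' => by
          have h3 := (hsat h1).trans (hUi _)
          have h4 := (hsat h2).trans (hUi _)
          by_cases he1 : e' = e
          · subst he1; simp [hUs, hUt, he]
          · by_cases he2 : e' = H.onE e
            · subst he2; simp [h3, h4, hUs, hUt, Ne.symm he]
            · simp [hU e' he1 he2, Ne.symm he1, Ne.symm he2]
      simp only [moved, edgePoint_zero, Int.cast_one, one_mul, zero_add, Int.cast_neg, neg_mul,
        ← sub_eq_add_neg] at this
      rw [← hlen e, edgePoint_len hl, hlen e] at this
      exact (hcong (Setoid.symm' _ h2)).trans hl this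
    refine ⟨?_, fun s h0 hs => ⟨_, hm s h0 hs⟩⟩
    have := hm _ (hl e).le le_rfl
    rw [edgePoint_len hl, sub_self, edgePoint_zero] at this
    exact this.trans hl (hcong h1)

/-- On a flipped edge the chips start at the two ends and move towards each other. Their opposite
slopes cancel over the edge, so `U` is everything and no cut is needed. -/
theorem pairDiv_edge_of_eq (hl : ∀ e, 0 < M.len e) (hc : M.Connected) {e : M.E} (heB : e ∉ B)
    (he : H.onE e = e) :
    M.LinEquiv (pairDiv H (M.src e)) (pairDiv H (M.tgt e)) ∧ ∀ s, 0 ≤ s → s ≤ M.len e →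
      ∃ x, M.LinEquiv (pairDiv H (M.src e)) (M.chip (M.edgePoint e s) + M.chip x) := by
  have hj := fun {a b : M.V} => linEquiv_of_join (a := a) (b := b) hl hc H.isBridge
  have hf := H.flip e heB he
  have h1 : M.LinEquiv (pairDiv H (M.src e))
      (M.chip (M.vpt (M.src e)) + M.chip (M.vpt (M.tgt e))) :=
    LinEquiv.add hl (LinEquiv.refl hl _) (hj hf)
  refine ⟨h1.trans hl ?_, fun s h0 hs => ⟨M.edgePoint e (M.len e - s), h1.trans hl ?_⟩⟩
  · rw [add_comm]
    refine LinEquiv.add hl (LinEquiv.refl hl _) (hj ?_)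
    exact Setoid.trans' _ (Setoid.symm' _ (H.onV_onV _)) (H.onV_congr hf)
  · have := linEquiv_move hl Set.univ e e 0 (M.len e) s 1 (-1) h0 (Or.inl rfl) (Or.inr rfl)
      ⟨le_rfl, (hl _).le⟩ (by simpa using ⟨h0, hs⟩) ⟨(hl _).le, le_rfl⟩
      (by simpa using ⟨hs, h0⟩) fun e' => by
        by_cases he1 : e = e' <;> simp [he1]
    simp only [moved, edgePoint_zero, Int.cast_one, one_mul, zero_add, Int.cast_neg, neg_mul,
      ← sub_eq_add_neg] at this
    rwa [edgePoint_len hl] at this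

/-- All points of a bridge are equivalent, so one chip moves along it and the other one can stay. -/
theorem pairDiv_edge_of_mem (hl : ∀ e, 0 < M.len e) (hc : M.Connected) {e : M.E} (heB : e ∈ B) :
    M.LinEquiv (pairDiv H (M.src e)) (pairDiv H (M.tgt e)) ∧ ∀ s, 0 ≤ s → s ≤ M.len e →
      ∃ x, M.LinEquiv (pairDiv H (M.src e)) (M.chip (M.edgePoint e s) + M.chip x) := by
  have hj := fun {a b : M.V} => linEquiv_of_join (a := a) (b := b) hl hc H.isBridge
  exact ⟨LinEquiv.add hl (hj (join_edge heB)) (hj (H.onV_congr (join_edge heB))),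
    fun s h0 hs => ⟨M.vpt (H.onV (M.src e)), LinEquiv.add hl
      (linEquiv_of_isBridge hl hc (H.isBridge e heB) h0 hs) (LinEquiv.refl hl _)⟩⟩

theorem pairDiv_edge (hl : ∀ e, 0 < M.len e) (hc : M.Connected)
    (hlen : ∀ e, M.len (H.onE e) = M.len e) (e : M.E) :
    M.LinEquiv (pairDiv H (M.src e)) (pairDiv H (M.tgt e)) ∧ ∀ s, 0 ≤ s → s ≤ M.len e →
      ∃ x, M.LinEquiv (pairDiv H (M.src e)) (M.chip (M.edgePoint e s) + M.chip x) := by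
  by_cases heB : e ∈ B
  · exact pairDiv_edge_of_mem H hl hc heB
  · by_cases he : H.onE e = e
    · exact pairDiv_edge_of_eq H hl hc heB he
    · exact pairDiv_edge_of_ne H hl hc hlen he

theorem pairDiv_linEquiv (hl : ∀ e, 0 < M.len e) (hc : M.Connected)
    (hlen : ∀ e, M.len (H.onE e) = M.len e) (a b : M.V) :
    M.LinEquiv (pairDiv H a) (pairDiv H b) :=
  joinSetoid_le (⟨fun a b => M.LinEquiv (pairDiv H a) (pairDiv H b),
    fun _ => LinEquiv.refl hl _, LinEquiv.symm hl, LinEquiv.trans hl⟩ : Setoid M.V)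
    (fun e _ => (pairDiv_edge H hl hc hlen e).1) (hc.2 a b)

theorem exists_conj (hl : ∀ e, 0 < M.len e) (hc : M.Connected)
    (hlen : ∀ e, M.len (H.onE e) = M.len e) (a : M.V) (x : M.Point) :
    ∃ x', M.LinEquiv (pairDiv H a) (M.chip x + M.chip x') := by
  rcases exists_edgePoint x with ⟨v, rfl⟩ | ⟨e, s, h0, h1, rfl⟩
  · exact ⟨_, pairDiv_linEquiv H hl hc hlen a v⟩
  · obtain ⟨x', h⟩ := (pairDiv_edge H hl hc hlen e).2 s h0.le h1.le
    exact ⟨x', (pairDiv_linEquiv H hl hc hlen a _).trans hl h⟩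

end

/-- A graph with a hyperelliptic involution that preserves lengths is hyperelliptic. -/
theorem hyperelliptic_of_hypInv {B : Set M.E} (H : HypInv M.toMultigraph B)
    (hl : ∀ e, 0 < M.len e) (hc : M.Connected) (hlen : ∀ e, M.len (H.onE e) = M.len e)
    (hne : ∃ e, ¬ M.IsBridge e) : M.Hyperelliptic := by
  obtain ⟨a⟩ := hc.1
  have hdeg : M.deg (pairDiv H a) = 2 := by
    unfold pairDiv
    rw [deg_add, deg_chip, deg_chip]; rfl
  refine ⟨pairDiv H a, hdeg, fun A hA h1 => ?_, fun j hj => ?_⟩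
  · obtain ⟨x, rfl⟩ := eq_chip_of_deg hA h1
    obtain ⟨x', h⟩ := exists_conj H hl hc hlen a x
    exact ⟨M.chip x', chip_nonneg _, h.congr_sub (by abel)⟩
  · by_contra hj1
    -- Rank at least two would make all points equivalent. This fails for two points of an edge that
    -- is not a bridge, as they stay distinct when the bridges are contracted.
    have h2 : ∀ x y, M.LinEquiv (pairDiv H a) (M.chip x + M.chip y) := by
      intro x y
      have hj2 : 0 ≤ j - 2 := by omega
      -- The extra chips only bring the degree up to `j`; comparing degrees then forces `j = 2`.
      obtain ⟨A', hA', h3⟩ := hj (M.chip x + M.chip y + (j - 2) • M.chip x)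
        (add_nonneg (add_nonneg (chip_nonneg _) (chip_nonneg _))
          (smul_nonneg hj2 (chip_nonneg _)))
        (by rw [deg_add, deg_add, deg_chip, deg_chip, deg_eq, map_smul, ← deg_eq, deg_chip,
              smul_eq_mul]; ring)
      have h4 := LinEquiv.deg_eq hl h3
      rw [deg_sub, deg_add, deg_add, deg_chip, deg_chip, deg_eq (M := M) (_ • _), map_smul,
        ← deg_eq, deg_chip, hdeg, smul_eq_mul] at h4
      have h5 := deg_nonneg hA'
      have h6 : j = 2 := by omega
      have h7 := eq_zero_of_deg hA' (by omega)
      subst h6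
      exact h3.congr_sub (by rw [h7]; simp)
    have h3 : ∀ x y, M.LinEquiv (M.chip x) (M.chip y) := fun x y =>
      (((h2 x x).symm hl).trans hl (h2 x y)).congr_sub (by abel)
    have h4 : (M.contract {e | M.IsBridge e}).TwoEdgeConnected :=
      WGraph.twoEdgeConnected_contract_bridges hc
    have h5 : ∀ x y, M.proj {e | M.IsBridge e} x = M.proj {e | M.IsBridge e} y := fun x y => by
      have h6 := IsPrincipal.push hl hc (B := {e | M.IsBridge e}) (fun _ he => he) (h3 x y)
      rw [map_sub, push_chip, push_chip] at h6
      exact eq_of_chip_linEquiv (len_contract_pos hl _) h4 h6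
    obtain ⟨e, he⟩ := hne
    have he' := hl e
    have h6 := h5 (M.edgePoint e (M.len e / 3)) (M.edgePoint e (M.len e / 2))
    rw [proj_edgePoint he, proj_edgePoint he] at h6
    have h7 : M.len e / 2 ∈ Set.Ioo (0 : ℝ) (M.len e) := ⟨by linarith, by linarith⟩
    rw [edgePoint_inr (M := M.contract _) ⟨e, he⟩ h7] at h6
    have := ((edgePoint_eq_inr_iff (M := M.contract {e | M.IsBridge e}) _ _ _ _ _).1 h6).2
    linarith

end Model

/-! ### The loops added at the weighted vertices -/

namespace WGraph

variable {G : WGraph}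

theorem isBridge_addLoops {e : G.E} : G.addLoops.IsBridge (Sum.inl e) ↔ G.IsBridge e := by
  refine not_congr ⟨fun h => ⟨h.1, fun a b => ?_⟩, fun h => ⟨h.1, fun a b => ?_⟩⟩
  · refine join_map (G := G.addLoops) (H := G.toMultigraph) id ?_ (h.2 a b)
    rintro (e' | p) he
    · exact join_edge (G := G.toMultigraph) (S := {e' | e' ≠ e})
        fun h => he (congrArg Sum.inl h)
    · exact (G.joinSetoid _).refl _
  · exact join_map (G := G.toMultigraph) (H := G.addLoops) id (fun e' (he : e' ≠ e) =>
      join_edge (G := G.addLoops) (S := {e' | e' ≠ Sum.inl e}) (e := Sum.inl e')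
        fun h => he (Sum.inl_injective h)) (h.2 a b)

theorem not_isBridge_loop (hc : G.Connected) (p : Σ v : G.V, Fin (G.w v)) :
    ¬ G.addLoops.IsBridge (Sum.inr p) := by
  refine mt (isBridge_iff (addLoops_connected hc) (Sum.inr p)).1 (not_not.2 ?_)
  exact (G.addLoops.joinSetoid _).refl _

/-- A combinatorial type is not a tree without weights. -/
theorem exists_not_isBridge (h : G.IsType) : ∃ e, ¬ G.addLoops.IsBridge e := by
  by_contra hcon
  push Not at hcon
  have hw : ∀ v, G.w v = 0 := fun v => by
    by_contra hv
    exact not_isBridge_loop h.1 ⟨v, 0, Nat.pos_of_ne_zero hv⟩ (hcon _)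
  have hE : Nat.card G.E + 1 ≤ Nat.card G.V :=
    haveI := h.1.1
    card_lt_of_forest fun e => (isBridge_iff h.1 e).1 (isBridge_addLoops.1 (hcon _))
  -- A tree without weights would satisfy `3|V| ≤ 2|E| ≤ 2|V| - 2`.
  have h3 : ∑ v : G.V, 3 ≤ ∑ v, G.valence v := Finset.sum_le_sum fun v _ => h.2 v (hw v)
  unfold valence at h3
  rw [Finset.sum_add_distrib, sum_fiber_card, sum_fiber_card, Finset.sum_const, Finset.card_univ,
    ← Nat.card_eq_fintype_card, smul_eq_mul] at h3
  omega

end WGraph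

namespace WHypInv

variable {G : WGraph} {B : Set G.E}

/-- The involution on the graph with added loops. -/
def addLoops (H : WHypInv G B) :
    HypInv G.addLoops (Sum.inl '' B) := by
  have hj : ∀ S : Set G.E, ∀ a b : G.V, G.joinSetoid S a b →
      G.addLoops.joinSetoid (Sum.inl '' S) a b := fun S a b h =>
    join_map (G := G.toMultigraph) (H := G.addLoops) id (fun e he => join_edge (G := G.addLoops)
      (S := Sum.inl '' S) (e := Sum.inl e) ⟨e, he, rfl⟩) h
  have hj' : ∀ S : Set G.E, ∀ a b : G.V, G.addLoops.joinSetoid (Sum.inl '' S) a b →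
      G.joinSetoid S a b := fun S a b h =>
    join_map (G := G.addLoops) (H := G.toMultigraph) id (by
      rintro _ ⟨e, he, rfl⟩
      exact join_edge (G := G.toMultigraph) he) h
  exact {
    onV := H.onV
    onE := Sum.map H.onE id
    isBridge := by
      rintro _ ⟨e, he, rfl⟩
      exact WGraph.isBridge_addLoops.2 (H.isBridge e he)
    onV_congr := fun h => hj _ _ _ (H.onV_congr (hj' _ _ _ h))
    onV_onV := fun v => hj _ _ _ (H.onV_onV v)
    onE_onE := by
      rintro (e | p)
      · exact congrArg Sum.inl (H.onE_onE e)
      · rfl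
    onE_of_mem := by
      rintro _ ⟨e, he, rfl⟩
      exact congrArg Sum.inl (H.onE_of_mem e he)
    ends := by
      rintro (e | p) he
      · have he' : e ∉ B := fun h => he ⟨e, h, rfl⟩
        exact (H.ends e he').imp (fun h => ⟨hj _ _ _ h.1, hj _ _ _ h.2⟩)
          fun h => ⟨hj _ _ _ h.1, hj _ _ _ h.2⟩
      · have h := hj _ _ _ (H.weight p.1 (Fin.pos p.2).ne')
        exact Or.inl ⟨Setoid.symm' _ h, Setoid.symm' _ h⟩
    flip := by
      rintro (e | p) he h
      · exact hj _ _ _ (H.flip e (fun h => he ⟨e, h, rfl⟩) (Sum.inl_injective h))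
      · exact hj _ _ _ (H.weight p.1 (Fin.pos p.2).ne')
    cut := by
      rintro (e | p) he
      · obtain ⟨U, h1, h2, h3⟩ := H.cut e fun h => he (congrArg Sum.inl h)
        refine ⟨U, h1, h2, ?_⟩
        rintro (e' | p) h4 h5
        · exact h3 e' (fun h => h4 (congrArg Sum.inl h)) fun h => h5 (congrArg Sum.inl h)
        · exact Iff.rfl
      · exact (he rfl).elim }

end WHypInv

/-- A tropical curve with a hyperelliptic involution that preserves lengths is hyperelliptic. -/
theorem Curve.hyperelliptic_of_wHypInv (X : Curve) (hX : X.IsTropical) {B : Set X.E}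
    (H : WHypInv X.toWGraph B) (hlen : ∀ e, X.len (H.onE e) = X.len e) : X.Hyperelliptic := by
  intro ℓ hℓ
  refine Model.hyperelliptic_of_hypInv (M := X.addLoopsModel ℓ) H.addLoops ?_
    (WGraph.addLoops_connected hX.1.1) ?_ (WGraph.exists_not_isBridge hX.1)
  · rintro (e | p)
    · exact hX.2 e
    · exact hℓ p
  · rintro (e | p)
    · exact hlen e
    · rfl

end

/-! ### Functions that relate two effective divisors of degree two. -/

section

open Multigraph

namespace Model

variable {M : Model}

theorem chip_injective : Function.Injective M.chip := Finsupp.single_left_injective one_ne_zero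

theorem chip_add_eq {p q x y : M.Point} (h : M.chip p + M.chip q = M.chip x + M.chip y) :
    (p = x ∧ q = y) ∨ (p = y ∧ q = x) := by
  have h1 : p = x ∨ p = y := by
    by_contra hn
    push Not at hn
    have := DFunLike.congr_fun h p
    simp only [Finsupp.add_apply, Finsupp.single_apply, hn.1.symm, hn.2.symm, if_false] at this
    split_ifs at this <;> omega
  rcases h1 with rfl | rfl
  · exact Or.inl ⟨rfl, chip_injective (add_left_cancel h)⟩
  · rw [add_comm (M.chip x)] at h
    exact Or.inr ⟨rfl, chip_injective (add_left_cancel h)⟩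

namespace PLData

section

variable {D : M.Div} (P : M.PLData D)

/-- The position of the end of a piece at which the function is smaller. -/
def loPos (j : P.Piece) : ℝ := if 0 < P.slope j then P.t j.1 j.2 else P.t j.1 (j.2 + 1)

theorem loPos_mem (j : P.Piece) : 0 ≤ P.loPos j ∧ P.loPos j ≤ M.len j.1 := by
  unfold loPos
  split_ifs
  · exact ⟨P.t_nonneg _ j.2.2.le, P.t_le_len _ j.2.2.le⟩
  · exact ⟨P.t_nonneg _ j.2.2, P.t_le_len _ j.2.2⟩

theorem loPos_add_mem {j : P.Piece} (h : P.slope j = 1 ∨ P.slope j = -1) :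
    0 ≤ P.loPos j + P.slope j * P.length j ∧ P.loPos j + P.slope j * P.length j ≤ M.len j.1 := by
  unfold loPos length
  rcases h with h | h <;> rw [h]
  · have h1 := P.t_nonneg j.1 j.2.2
    have h2 := P.t_le_len j.1 j.2.2
    simpa using ⟨h1, h2⟩
  · have h1 := P.t_nonneg j.1 j.2.2.le
    have h2 := P.t_le_len j.1 j.2.2.le
    simpa using ⟨h1, h2⟩

/-- The end of a piece at which the function is smaller. -/
def lo (j : P.Piece) : M.Point := M.edgePoint j.1 (P.loPos j)

end

variable {p q x y : M.Point} (P : M.PLData (M.chip p + M.chip q - (M.chip x + M.chip y)))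

/-- The sublevel set of `P.f a` has degree at least two. For `p + q - x - y` this is possible only
if it contains `p` and `q` and neither `x` nor `y`. -/
theorem levels_of_lt (hl : ∀ e, 0 < M.len e) (h2 : M.TwoEdgeConnected) {a b : M.Point}
    (hab : P.f a < P.f b) : P.f p ≤ P.f a ∧ P.f q ≤ P.f a ∧ P.f a < P.f x ∧ P.f a < P.f y := by
  have := P.two_le_wt hl h2 le_rfl hab
  simp only [map_sub, map_add, wt_chip, Set.mem_ofPred_eq] at this
  split_ifs at this <;> first | omega | (refine ⟨?_, ?_, ?_, ?_⟩ <;> linarith)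

variable (hx : p ≠ x) (hy : p ≠ y)
include hx hy

/-- As `p` is neither `x` nor `y`, the function is not constant, and `levels_of_lt` at the levels of
`p` and of `q` puts both at the minimum. -/
theorem levels (hl : ∀ e, 0 < M.len e) (h2 : M.TwoEdgeConnected) :
    P.f q = P.f p ∧ (∀ z, P.f p ≤ P.f z) ∧ P.f p < P.f x ∧ P.f p < P.f y := by
  have h3 : ∃ a b, P.f a < P.f b := by
    by_contra hn
    push Not at hn
    have := sub_eq_zero.1 (P.eq_zero_of_const hl fun a b => hn b a)
    rcases chip_add_eq this with h | h
    · exact hx h.1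
    · exact hy h.1
  obtain ⟨a, b, hab⟩ := h3
  have h4 := P.levels_of_lt hl h2 hab
  have h5 := P.levels_of_lt hl h2 (h4.1.trans_lt hab)
  have h6 := P.levels_of_lt hl h2 (h4.2.1.trans_lt hab)
  refine ⟨le_antisymm h5.2.1 h6.1, fun z => ?_, h5.2.2⟩
  rcases lt_or_ge (P.f z) (P.f b) with h | h
  · exact (P.levels_of_lt hl h2 h).1
  · linarith [h4.1]

/-- The lowest level is crossed by exactly two pieces, which have slope one and start at the two
points of positive multiplicity. -/
theorem exists_straddle (hl : ∀ e, 0 < M.len e) (h2 : M.TwoEdgeConnected) :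
    ∃ j₁ j₂, j₁ ≠ j₂ ∧ (∀ j, P.Straddle (P.f p) j ↔ j = j₁ ∨ j = j₂) ∧
      (∀ j, P.Straddle (P.f p) j → P.slope j = 1 ∨ P.slope j = -1) ∧ P.lo j₁ = p ∧ P.lo j₂ = q := by
  obtain ⟨hq, hmin, hx', hy'⟩ := P.levels hx hy hl h2
  obtain ⟨j₁, j₂, hne, h3, h4⟩ := P.exists_two_straddle hl h2 le_rfl hx'
  -- The total flux out of the lowest level is two, so exactly two pieces cross it, with flux one
  -- each.
  have hwt : ∑ j, P.flux (P.f p) j = 2 := by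
    rw [← P.wt_eq_sum_flux hl]
    simp [wt_chip, hq, not_le.2 hx', not_le.2 hy']
  have huniq : ∀ j, P.Straddle (P.f p) j ↔ j = j₁ ∨ j = j₂ := by
    refine fun j => ⟨fun hj => ?_, ?_⟩
    · by_contra hn
      push Not at hn
      have := P.sum_flux_ge (τ := P.f p) {j, j₁, j₂}
      rw [Finset.sum_insert (by simp [hn.1, hn.2]), Finset.sum_pair hne, hwt] at this
      linarith [P.one_le_flux hj, P.one_le_flux h3, P.one_le_flux h4]
    · rintro (rfl | rfl) <;> assumption
  have hflux : ∀ j, P.Straddle (P.f p) j → P.flux (P.f p) j = 1 := by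
    have := P.sum_flux_ge (τ := P.f p) {j₁, j₂}
    rw [Finset.sum_pair hne, hwt] at this
    intro j hj
    have := P.one_le_flux h3
    have := P.one_le_flux h4
    rcases (huniq j).1 hj with rfl | rfl <;> omega
  have hslope : ∀ j, P.Straddle (P.f p) j → P.slope j = 1 ∨ P.slope j = -1 := by
    intro j hj
    have := hflux j hj
    rcases P.flux_pos hj with ⟨_, _, _, h⟩ | ⟨_, _, _, h⟩ <;> omega
  let Φ := Finsupp.filterAddHom (M := ℤ) fun z => P.f z ≤ P.f p
  have hΦ : ∀ z, Φ (M.chip z) = if P.f z ≤ P.f p then M.chip z else 0 := by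
    intro z
    split_ifs with h
    · exact Finsupp.filter_single_of_pos _ h
    · exact Finsupp.filter_single_of_neg _ h
  -- Restrict the divisor to the lowest level. A piece that does not cross this level is constant or
  -- lies above it, so only the low ends of the two crossing pieces remain.
  have h5 : M.chip (P.lo j₁) + M.chip (P.lo j₂) = M.chip p + M.chip q := by
    have h6 := congrArg Φ (P.div_eq_sum hl)
    rw [map_sub, map_add, map_add, hΦ, hΦ, hΦ, hΦ, if_pos le_rfl, if_pos hq.le,
      if_neg (not_le.2 hx'), if_neg (not_le.2 hy'), add_zero, sub_zero, map_sum] at h6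
    refine Eq.trans ?_ h6.symm
    rw [← Finset.sum_pair hne (f := fun j => M.chip (P.lo j))]
    symm
    rw [← Finset.sum_subset (Finset.subset_univ {j₁, j₂})]
    · refine Finset.sum_congr rfl fun j hj => ?_
      have hj' := (huniq j).2 (by simpa using hj)
      rw [map_zsmul, map_sub, hΦ, hΦ]
      unfold lo loPos
      rcases P.flux_pos hj' with ⟨h7, h8, h9, _⟩ | ⟨h7, h8, h9, _⟩
      · rw [if_pos h7, if_neg (not_le.2 h8), if_pos (by omega)]
        have : P.slope j = 1 := by rcases hslope j hj' with h | h <;> omega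
        rw [this, one_smul, sub_zero]; rfl
      · rw [if_pos h7, if_neg (not_le.2 h8), if_neg (by omega)]
        have : P.slope j = -1 := by rcases hslope j hj' with h | h <;> omega
        rw [this, neg_smul, one_smul, zero_sub, neg_neg]; rfl
    · intro j _ hj
      have hj' := not_not.1 (mt (huniq j).1 (by simpa using hj))
      rw [map_zsmul, map_sub, hΦ, hΦ]
      by_cases h7 : P.f (P.p₀ j) ≤ P.f p
      · have h8 := hj'.1 h7
        have h9 : P.slope j = 0 := by
          have := mt (P.slope_pos_iff j).1 (by linarith [hmin (P.p₀ j)])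
          have := mt (P.slope_neg_iff j).1 (by linarith [hmin (P.p₁ j)])
          omega
        rw [h9, zero_smul]
      · rw [if_neg h7, if_neg (mt hj'.2 h7), sub_zero, smul_zero]
  rcases chip_add_eq h5 with h | h
  · exact ⟨j₁, j₂, hne, huniq, hslope, h⟩
  · exact ⟨j₂, j₁, hne.symm, fun j => (huniq j).trans or_comm, hslope, h.2, h.1⟩

omit hx hy

/-- The indicator of the superlevel set jumps only along the two crossing pieces, and there by the
slope. The result has the form required by `linEquiv_move`. -/
theorem cut_eq (hl : ∀ e, 0 < M.len e) {τ : ℝ} {j₁ j₂ : P.Piece} (hne : j₁ ≠ j₂)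
    (hj : ∀ j, P.Straddle τ j ↔ j = j₁ ∨ j = j₂)
    (hs : ∀ j, P.Straddle τ j → P.slope j = 1 ∨ P.slope j = -1) (e : M.E) :
    (if M.tgt e ∈ {v | P.f (M.vpt v) ≤ τ} then 0 else 1) -
        (if M.src e ∈ {v | P.f (M.vpt v) ≤ τ} then 0 else 1) =
      (if j₁.1 = e then P.slope j₁ else 0) + (if j₂.1 = e then P.slope j₂ else 0) := by
  have h := P.sum_edge (fun z => if P.f z ≤ τ then 0 else 1) hl e
  refine h.symm.trans ?_
  rw [← Finset.sum_pair hne (f := fun j => if j.1 = e then P.slope j else 0),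
    ← Finset.sum_subset (Finset.subset_univ {j₁, j₂})]
  · refine Finset.sum_congr rfl fun j hj' => ?_
    have h3 := (hj j).2 (by simpa using hj')
    congr 1
    rcases P.flux_pos h3 with ⟨h7, h8, h9, _⟩ | ⟨h7, h8, h9, _⟩
    · rw [if_pos h7, if_neg (not_le.2 h8)]
      rcases hs j h3 with h | h <;> omega
    · rw [if_pos h7, if_neg (not_le.2 h8)]
      rcases hs j h3 with h | h <;> omega
  · intro j _ hj'
    have h3 := not_not.1 (mt (hj j).1 (by simpa using hj'))
    simp only [h3, sub_self, ite_self]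

end PLData

end Model

end

section

open Multigraph

theorem exists_step {p : ℕ → Prop} {a b : ℕ} (hab : a ≤ b) (ha : p a) (hb : ¬ p b) :
    ∃ i, a ≤ i ∧ i < b ∧ p i ∧ ¬ p (i + 1) := by
  induction b, hab using Nat.le_induction with
  | base => exact (hb ha).elim
  | succ b hab ih =>
    by_cases h : p b
    · exact ⟨b, hab, Nat.lt_succ_self b, h, hb⟩
    · obtain ⟨i, h1, h2, h3⟩ := ih h
      exact ⟨i, h1, h2.trans (Nat.lt_succ_self b), h3⟩

namespace Model

variable {M : Model}

/-! ### Half-edges -/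

/-- The edges with an orientation; `true` stands for the reference orientation. -/
abbrev HalfEdge (M : Model) : Type := M.E × Bool

/-- The initial vertex. -/
def base (h : M.HalfEdge) : M.V := cond h.2 (M.src h.1) (M.tgt h.1)

/-- The terminal vertex. -/
def far (h : M.HalfEdge) : M.V := cond h.2 (M.tgt h.1) (M.src h.1)

/-- The sign of an orientation. -/
def sgn (b : Bool) : ℤ := cond b 1 (-1)

/-- The parameter of the initial vertex. -/
def start (h : M.HalfEdge) : ℝ := cond h.2 0 (M.len h.1)

/-- The point at distance `δ` from the initial vertex. -/
def pt (h : M.HalfEdge) (δ : ℝ) : M.Point := M.moved h.1 (start h) (sgn h.2) δ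

theorem sgn_eq (b : Bool) : sgn b = 1 ∨ sgn b = -1 := by cases b <;> simp [sgn]

theorem start_mem (hl : ∀ e, 0 < M.len e) (h : M.HalfEdge) :
    0 ≤ start h ∧ start h ≤ M.len h.1 := by
  obtain ⟨e, b⟩ := h
  cases b <;> simp [start, (hl e).le]

theorem start_add_mem {h : M.HalfEdge} {δ : ℝ} (h0 : 0 ≤ δ) (h1 : δ ≤ M.len h.1) :
    0 ≤ start h + sgn h.2 * δ ∧ start h + sgn h.2 * δ ≤ M.len h.1 := by
  obtain ⟨e, b⟩ := h
  cases b <;> simp [start, sgn] <;> exact ⟨by linarith, by linarith⟩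

theorem start_add_mem_Ioo {h : M.HalfEdge} {δ : ℝ} (h0 : 0 < δ) (h1 : δ < M.len h.1) :
    start h + sgn h.2 * δ ∈ Set.Ioo 0 (M.len h.1) := by
  obtain ⟨e, b⟩ := h
  cases b <;> simp [start, sgn] <;> exact ⟨by linarith, by linarith⟩

theorem pt_zero (hl : ∀ e, 0 < M.len e) (h : M.HalfEdge) : pt h 0 = M.vpt (base h) := by
  obtain ⟨e, b⟩ := h
  cases b <;> simp [pt, start, moved, base, edgePoint_zero, edgePoint_len hl]

theorem pt_len (hl : ∀ e, 0 < M.len e) (h : M.HalfEdge) :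
    pt h (M.len h.1) = M.vpt (far h) := by
  obtain ⟨e, b⟩ := h
  cases b <;> simp [pt, start, moved, far, sgn, edgePoint_zero, edgePoint_len hl]

theorem pt_half (h : M.HalfEdge) : pt h (M.len h.1 / 2) = M.edgePoint h.1 (M.len h.1 / 2) := by
  obtain ⟨e, b⟩ := h
  cases b
  · simp only [pt, start, moved, sgn, cond_false]
    congr 1
    push_cast
    ring
  · simp [pt, start, moved, sgn]

theorem edgePoint_ne_vpt {e : M.E} {t : ℝ} (ht : t ∈ Set.Ioo 0 (M.len e)) (v : M.V) :
    M.edgePoint e t ≠ M.vpt v := by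
  rw [edgePoint_inr e ht]
  exact Sum.inr_ne_inl

theorem edgePoint_injOn {e e' : M.E} {t t' : ℝ} (ht : t ∈ Set.Ioo 0 (M.len e))
    (h : M.edgePoint e t = M.edgePoint e' t') : e' = e ∧ t' = t := by
  rw [edgePoint_inr e ht] at h
  exact (edgePoint_eq_inr_iff _ _ _ _ ht).1 h.symm

theorem pt_ne_vpt {h : M.HalfEdge} {δ : ℝ} (h0 : 0 < δ) (h1 : δ < M.len h.1) (v : M.V) :
    pt h δ ≠ M.vpt v := edgePoint_ne_vpt (start_add_mem_Ioo h0 h1) v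

theorem pt_inj {h : M.HalfEdge} {δ δ' : ℝ} (h0 : 0 < δ) (h1 : δ < M.len h.1)
    (heq : pt h δ = pt h δ') : δ' = δ := by
  have := (edgePoint_injOn (start_add_mem_Ioo h0 h1) heq).2
  rcases sgn_eq h.2 with h2 | h2 <;> rw [h2] at this <;> push_cast at this <;> linarith

/-- The bound by half the length is there to tell the two orientations of one edge apart. -/
theorem eq_of_pt_eq {h h' : M.HalfEdge} {δ : ℝ} (h0 : 0 < δ) (h1 : δ < M.len h.1 / 2)
    (heq : pt h δ = pt h' δ) : h = h' := by
  have h3 := edgePoint_injOn (start_add_mem_Ioo h0 (by linarith)) heq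
  obtain ⟨e, b⟩ := h
  obtain ⟨e', b'⟩ := h'
  obtain ⟨rfl, h4⟩ := h3
  cases b <;> cases b' <;> simp [start, sgn] at h4 h1 ⊢ <;> linarith

/-- A function that increases from a level along a half-edge crosses that level there. -/
theorem PLData.exists_ascent {D : M.Div} (P : M.PLData D) (hl : ∀ e, 0 < M.len e)
    {τ δ : ℝ} {h : M.HalfEdge} (h0 : 0 ≤ δ) (h1 : δ ≤ M.len h.1)
    (hb : P.f (M.vpt (base h)) ≤ τ) (hδ : τ < P.f (pt h δ)) :
    ∃ j, P.Straddle τ j ∧ j.1 = h.1 ∧ 0 < sgn h.2 * P.slope j ∧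
      ∃ u, 0 ≤ u ∧ u < δ ∧ P.loPos j = start h + sgn h.2 * u := by
  obtain ⟨e, b⟩ := h
  have hs := start_add_mem (h := (e, b)) h0 h1
  obtain ⟨j, hj, h2, h3⟩ := P.exists_piece e hs.1 hs.2 (hl e)
  obtain ⟨e', i, hi⟩ := j
  -- The piece `i` contains the point at distance `δ`. Either the end of it nearer to the base is at
  -- most `τ`, and the piece itself crosses the level, or that end is already above, and a piece
  -- nearer to the base crosses.
  obtain rfl : e' = e := hj
  have h4 := P.f_between ⟨e', i, hi⟩ h2 h3
  change P.f (M.edgePoint e' (P.t e' i)) ≤ P.f (pt (e', b) δ) ∧ P.f (pt (e', b) δ) ≤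
    P.f (M.edgePoint e' (P.t e' (i + 1))) ∨ P.f (M.edgePoint e' (P.t e' (i + 1))) ≤
    P.f (pt (e', b) δ) ∧ P.f (pt (e', b) δ) ≤ P.f (M.edgePoint e' (P.t e' i)) at h4
  cases b
  · simp only [start, sgn, cond_false] at h2 h3
    push_cast at h2 h3
    have key : ∀ m (hm : m < P.k e'), τ < P.f (M.edgePoint e' (P.t e' m)) →
        P.f (M.edgePoint e' (P.t e' (m + 1))) ≤ τ → M.len e' - δ < P.t e' (m + 1) →
        ∃ j, P.Straddle τ j ∧ j.1 = e' ∧ 0 < sgn false * P.slope j ∧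
          ∃ u, 0 ≤ u ∧ u < δ ∧ P.loPos j = start (e', false) + sgn false * u := by
      intro m hm h5 h6 h7
      have h8 : P.slope ⟨e', m, hm⟩ < 0 := (P.slope_neg_iff _).2 (h6.trans_lt h5)
      refine ⟨⟨e', m, hm⟩, fun h => absurd (h.2 h6) (not_le.2 h5), rfl, ?_,
        M.len e' - P.t e' (m + 1), sub_nonneg.2 (P.t_le_len e' hm), by linarith, ?_⟩
      · simp only [sgn, cond_false]; omega
      · unfold loPos
        rw [if_neg (by omega)]
        simp [start, sgn]
    rcases lt_or_ge τ (P.f (M.edgePoint e' (P.t e' (i + 1)))) with h5 | h5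
    · have h6 : ¬ τ < P.f (M.edgePoint e' (P.t e' (P.k e'))) := by
        rw [P.t_last, edgePoint_len hl]
        exact not_lt.2 hb
      obtain ⟨m, hm1, hm2, hm3, hm4⟩ :=
        exists_step (p := fun m => τ < P.f (M.edgePoint e' (P.t e' m))) (Nat.succ_le_of_lt hi) h5 h6
      refine key m hm2 hm3 (not_lt.1 hm4) ?_
      have h7 := t_mono (P.t_lt e') hm1 hm2.le
      have h8 := P.t_lt e' m hm2
      simp only [Nat.succ_eq_add_one] at h7
      linarith
    · have h6 : τ < P.f (M.edgePoint e' (P.t e' i)) := by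
        rcases h4 with h4 | h4
        · linarith [h4.2]
        · exact hδ.trans_le h4.2
      refine key i hi h6 h5 (lt_of_le_of_ne (by linarith) fun h7 => ?_)
      have h8 : P.f (pt (e', false) δ) = P.f (M.edgePoint e' (P.t e' (i + 1))) := by
        rw [← h7]
        simp only [pt, moved, start, sgn, cond_false]
        push_cast
        rw [neg_one_mul, sub_eq_add_neg]
      linarith
  · simp only [start, sgn, cond_true] at h2 h3
    push_cast at h2 h3
    rw [zero_add, one_mul] at h2 h3
    have key : ∀ m (hm : m < P.k e'), P.f (M.edgePoint e' (P.t e' m)) ≤ τ →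
        τ < P.f (M.edgePoint e' (P.t e' (m + 1))) → P.t e' m < δ →
        ∃ j, P.Straddle τ j ∧ j.1 = e' ∧ 0 < sgn true * P.slope j ∧
          ∃ u, 0 ≤ u ∧ u < δ ∧ P.loPos j = start (e', true) + sgn true * u := by
      intro m hm h5 h6 h7
      have h8 : 0 < P.slope ⟨e', m, hm⟩ := (P.slope_pos_iff _).2 (h5.trans_lt h6)
      refine ⟨⟨e', m, hm⟩, fun h => absurd (h.1 h5) (not_le.2 h6), rfl, ?_,
        P.t e' m, P.t_nonneg e' hm.le, h7, ?_⟩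
      · simp only [sgn, cond_true]; omega
      · unfold loPos
        rw [if_pos h8]
        simp [start, sgn]
    rcases lt_or_ge τ (P.f (M.edgePoint e' (P.t e' i))) with h5 | h5
    · have h6 : P.f (M.edgePoint e' (P.t e' 0)) ≤ τ := by
        rw [P.t_zero, edgePoint_zero]
        exact hb
      obtain ⟨m, _, hm2, hm3, hm4⟩ :=
        exists_step (p := fun m => P.f (M.edgePoint e' (P.t e' m)) ≤ τ) (Nat.zero_le i) h6
          (not_le.2 h5)
      refine key m (hm2.trans hi) hm3 (not_le.1 hm4) ?_
      have h7 := t_mono (P.t_lt e') (Nat.succ_le_of_lt hm2) hi.le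
      have h8 := P.t_lt e' m (hm2.trans hi)
      simp only [Nat.succ_eq_add_one] at h7
      linarith
    · have h6 : τ < P.f (M.edgePoint e' (P.t e' (i + 1))) := by
        rcases h4 with h4 | h4
        · exact hδ.trans_le h4.2
        · linarith [h4.2]
      refine key i hi h5 h6 (lt_of_le_of_ne h2 fun h7 => ?_)
      have h8 : P.f (pt (e', true) δ) = P.f (M.edgePoint e' (P.t e' i)) := by
        rw [h7]
        simp only [pt, moved, start, sgn, cond_true]
        push_cast
        rw [zero_add, one_mul]
      linarith

/-! ### Conjugate points -/

section

variable {D : M.Div} (hD : ∀ x, ∃ x', M.LinEquiv D (M.chip x + M.chip x'))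

/-- The point that completes `x` to a divisor equivalent to `D`. -/
def conj (x : M.Point) : M.Point := (hD x).choose

theorem conj_spec (x : M.Point) : M.LinEquiv D (M.chip x + M.chip (conj hD x)) :=
  (hD x).choose_spec

variable (hl : ∀ e, 0 < M.len e) (h2 : M.TwoEdgeConnected)
include hl h2

/-- Two completions of `x` are equivalent points, hence equal on a 2-edge-connected graph. -/
theorem conj_eq {x y : M.Point} (h : M.LinEquiv D (M.chip x + M.chip y)) : conj hD x = y :=
  eq_of_chip_linEquiv hl h2 ((((conj_spec hD x).symm hl).trans hl h).congr_sub (by abel))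

theorem conj_conj (x : M.Point) : conj hD (conj hD x) = x :=
  conj_eq hD hl h2 (by rw [add_comm]; exact conj_spec hD x)

/-- Moving away from a vertex along a half-edge, the conjugate point moves along some edge. -/
theorem exists_direction (h : M.HalfEdge) : ∃ (e : M.E) (s : ℝ) (σ : ℤ) (δ₀ : ℝ) (U : Set M.V),
    0 < δ₀ ∧ M.edgePoint e s = conj hD (M.vpt (base h)) ∧ (0 ≤ s ∧ s ≤ M.len e) ∧
    (σ = 1 ∨ σ = -1) ∧ (0 ≤ s + σ * δ₀ ∧ s + σ * δ₀ ≤ M.len e) ∧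
    (∀ e', (if M.tgt e' ∈ U then 0 else 1) - (if M.src e' ∈ U then 0 else 1) =
      (if h.1 = e' then sgn h.2 else 0) + (if e = e' then σ else 0)) ∧
    ∀ δ, 0 ≤ δ → δ ≤ M.len h.1 → 0 ≤ s + σ * δ → s + σ * δ ≤ M.len e →
      conj hD (pt h δ) = M.moved e s σ δ := by
  set p := M.vpt (base h) with hp
  set q := conj hD p with hq
  have hlh := hl h.1
  -- `δ₁` is so small that the half-edge does not meet `q` up to there, except possibly at its base.
  obtain ⟨δ₁, hδ0, hδ1, hδ2, hδ3⟩ : ∃ δ₁, 0 < δ₁ ∧ δ₁ < M.len h.1 ∧ pt h δ₁ ≠ q ∧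
      ∀ u, 0 < u → u < δ₁ → pt h u ≠ q := by
    by_cases hex : ∃ u, 0 < u ∧ u < M.len h.1 ∧ pt h u = q
    · obtain ⟨u, h0, h1, hu⟩ := hex
      have : ∀ u', 0 < u' → u' < u → pt h u' ≠ q := fun u' h3 h4 h5 => by
        have := pt_inj h3 (h4.trans h1) (h5.trans hu.symm)
        linarith
      exact ⟨u / 2, by linarith, by linarith, this _ (by linarith) (by linarith),
        fun u' h3 h4 => this u' h3 (by linarith)⟩
    · push Not at hex
      exact ⟨M.len h.1 / 2, by linarith, by linarith, hex _ (by linarith) (by linarith),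
        fun u h3 h4 => hex u h3 (by linarith)⟩
  have hequiv : M.LinEquiv (M.chip p + M.chip q)
      (M.chip (pt h δ₁) + M.chip (conj hD (pt h δ₁))) :=
    ((conj_spec hD p).symm hl).trans hl (conj_spec hD _)
  obtain ⟨P⟩ := IsPrincipal.exists_plData hl hequiv
  have hpx : p ≠ pt h δ₁ := (pt_ne_vpt hδ0 hδ1 _).symm
  have hpy : p ≠ conj hD (pt h δ₁) := fun heq => hδ2 (by
    rw [hq, heq, conj_conj hD hl h2])
  obtain ⟨j₁, j₂, hne, hj, hs, hlo₁, hlo₂⟩ := P.exists_straddle hpx hpy hl h2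
  obtain ⟨j, hjs, hjh, hjσ, u, hu0, hu1, hu⟩ :=
    P.exists_ascent hl (h := h) hδ0.le hδ1.le le_rfl (P.levels hpx hpy hl h2).2.2.1
  have hlo : P.lo j = pt h u := by
    refine (congrArg (M.edgePoint j.1) hu).trans ?_
    rw [hjh]
    rfl
  -- The crossing piece on the half-edge begins at `p` or `q`, and neither lies at a distance
  -- strictly between `0` and `δ₁`.
  obtain rfl : u = 0 := by
    by_contra hu'
    have hu2 : 0 < u := lt_of_le_of_ne hu0 (Ne.symm hu')
    rcases (hj j).1 hjs with rfl | rfl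
    · exact pt_ne_vpt hu2 (hu1.trans hδ1) _ (hlo.symm.trans hlo₁)
    · exact hδ3 u hu2 hu1 (hlo.symm.trans hlo₂)
  obtain ⟨j', hne', hlo', hj'⟩ : ∃ j', j ≠ j' ∧ P.lo j' = q ∧
      ∀ i, P.Straddle (P.f p) i ↔ i = j ∨ i = j' := by
    rw [pt_zero hl] at hlo
    rcases (hj j).1 hjs with rfl | rfl
    · exact ⟨j₂, hne, hlo₂, hj⟩
    · exact ⟨j₁, hne.symm, hlo₁.trans (hlo.symm.trans hlo₂), fun i => (hj i).trans or_comm⟩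
  have hσj : P.slope j = sgn h.2 := by
    rcases hs j hjs with h4 | h4 <;> rcases sgn_eq h.2 with h5 | h5 <;> rw [h4, h5] at hjσ ⊢ <;>
      omega
  have hs' := hs j' ((hj' j').2 (Or.inr rfl))
  have hcut := P.cut_eq hl hne' hj' hs
  rw [hjh, hσj] at hcut
  refine ⟨j'.1, P.loPos j', P.slope j', P.length j', _, P.length_pos j', hlo', P.loPos_mem j', hs',
    P.loPos_add_mem hs', hcut, fun δ h3 h4 h5 h6 => ?_⟩
  -- Only the cut matters for moving the two points, so the motion extends beyond the two pieces as
  -- far as the edges reach.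
  have hmove := linEquiv_move hl _ h.1 j'.1 (start h) (P.loPos j') δ (sgn h.2) (P.slope j') h3
    (sgn_eq _) hs' (start_mem hl h) (start_add_mem h3 h4) (P.loPos_mem j') ⟨h5, h6⟩ hcut
  refine conj_eq hD hl h2 ((conj_spec hD p).trans hl ?_)
  have h7 : M.edgePoint h.1 (start h) = p := by
    have := pt_zero hl h
    unfold pt moved at this
    rwa [mul_zero, add_zero] at this
  rw [h7, show M.edgePoint j'.1 (P.loPos j') = q from hlo'] at hmove
  exact hmove

/-- The conjugate of a vertex is a vertex. -/
theorem exists_conj_vpt (hv : ∀ v, 3 ≤ M.valence v) (a : M.V) :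
    ∃ a', conj hD (M.vpt a) = M.vpt a' := by
  rcases exists_edgePoint (conj hD (M.vpt a)) with h | ⟨c, t, ht0, ht1, hc⟩
  · exact h
  exfalso
  -- If the conjugate were an interior point of an edge, it could start in two directions only.
  -- Different half-edges at `a` give different directions, so the valence of `a` would be at most
  -- two.
  have key : ∀ h : M.HalfEdge, base h = a → ∃ σ : ℤ, (σ = 1 ∨ σ = -1) ∧ ∃ δ₀, 0 < δ₀ ∧
      ∀ δ, 0 ≤ δ → δ ≤ δ₀ → conj hD (pt h δ) = M.moved c t σ δ := by
    intro h hh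
    obtain ⟨e, s, σ, δ₀, U, h3, h4, h5, h6, h7, _, h8⟩ := exists_direction hD hl h2 h
    rw [hh, hc] at h4
    obtain ⟨rfl, rfl⟩ := edgePoint_injOn ⟨ht0, ht1⟩ h4.symm
    refine ⟨σ, h6, min δ₀ (M.len h.1), lt_min h3 (hl _), fun δ h9 h10 =>
      h8 δ h9 (h10.trans (min_le_right _ _)) ?_ ?_⟩ <;>
    · have := h10.trans (min_le_left _ _)
      rcases h6 with h6 | h6 <;> rw [h6] at h7 ⊢ <;> push_cast at h7 ⊢ <;> linarith [h7.1, h7.2]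
  choose σ hσ δ₀ hδ₀ hconj using key
  have hinj : ∀ h h' hh hh', σ h hh = σ h' hh' → h = h' := by
    intro h h' hh hh' heq
    have hm : 0 < min (min (δ₀ h hh) (δ₀ h' hh')) (M.len h.1 / 3) :=
      lt_min (lt_min (hδ₀ _ _) (hδ₀ _ _)) (by linarith [hl h.1])
    set δ := min (min (δ₀ h hh) (δ₀ h' hh')) (M.len h.1 / 3)
    have h3 : δ ≤ M.len h.1 / 3 := min_le_right _ _
    have h4 := hconj h hh δ hm.le ((min_le_left _ _).trans (min_le_left _ _))
    have h5 := hconj h' hh' δ hm.le ((min_le_left _ _).trans (min_le_right _ _))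
    rw [heq, ← h5] at h4
    refine eq_of_pt_eq hm (by linarith [hl h.1]) ?_
    rw [← conj_conj hD hl h2 (pt h δ), h4, conj_conj hD hl h2]
  let F : {e : M.E // M.src e = a} ⊕ {e : M.E // M.tgt e = a} → Bool
    | .inl e => decide (σ (e.1, true) e.2 = 1)
    | .inr e => decide (σ (e.1, false) e.2 = 1)
  have hdec : ∀ h h' hh hh', decide (σ h hh = 1) = decide (σ h' hh' = 1) → h = h' := by
    intro h h' hh hh' heq
    have := decide_eq_decide.1 heq
    refine hinj h h' hh hh' ?_
    rcases hσ h hh with h3 | h3 <;> rcases hσ h' hh' with h4 | h4 <;> rw [h3, h4] at this ⊢ <;>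
      simp at this
  have hF : Function.Injective F := by
    rintro (e | e) (e' | e') heq
    · exact congrArg Sum.inl (Subtype.ext (congrArg Prod.fst (hdec _ _ _ _ heq)))
    · exact absurd (congrArg Prod.snd (hdec _ _ _ _ heq)) (by simp)
    · exact absurd (congrArg Prod.snd (hdec _ _ _ _ heq)) (by simp)
    · exact congrArg Sum.inr (Subtype.ext (congrArg Prod.fst (hdec _ _ _ _ heq)))
  have h3 := Nat.card_le_card_of_injective F hF
  rw [Nat.card_sum, Nat.card_eq_fintype_card (α := Bool), Fintype.card_bool] at h3
  have h4 := hv a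
  unfold valence at h4
  omega

/-- The conjugate of a half-edge. -/
theorem exists_conj_halfEdge (hv : ∀ v, 3 ≤ M.valence v) (h : M.HalfEdge) :
    ∃ (k : M.HalfEdge) (U : Set M.V), conj hD (M.vpt (base h)) = M.vpt (base k) ∧
      conj hD (M.vpt (far h)) = M.vpt (far k) ∧ M.len k.1 = M.len h.1 ∧
      conj hD (M.edgePoint h.1 (M.len h.1 / 2)) = M.edgePoint k.1 (M.len k.1 / 2) ∧
      ∀ e', (if M.tgt e' ∈ U then (0 : ℤ) else 1) - (if M.src e' ∈ U then 0 else 1) =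
        (if h.1 = e' then sgn h.2 else 0) + (if k.1 = e' then sgn k.2 else 0) := by
  obtain ⟨e, s, σ, δ₀, U, h3, h4, h5, h6, h7, h8, h9⟩ := exists_direction hD hl h2 h
  -- The conjugate of the base is a vertex, so the conjugate point enters the edge at one of its
  -- ends.
  obtain ⟨k, rfl, rfl, rfl⟩ : ∃ k : M.HalfEdge, e = k.1 ∧ s = start k ∧ σ = sgn k.2 := by
    obtain ⟨a', ha'⟩ := exists_conj_vpt hD hl h2 hv (base h)
    rw [ha', edgePoint_eq_inl_iff hl] at h4
    have := hl e
    rcases h4 with ⟨h4, _⟩ | ⟨h4, _⟩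
    · refine ⟨(e, true), rfl, le_antisymm h4 h5.1, ?_⟩
      rcases h6 with h6 | h6
      · exact h6
      · rw [h6] at h7; push_cast at h7; linarith [h7.1]
    · refine ⟨(e, false), rfl, le_antisymm h5.2 h4, ?_⟩
      rcases h6 with h6 | h6
      · rw [h6] at h7; push_cast at h7; linarith [h7.2]
      · exact h6
  have h10 : ∀ δ, 0 ≤ δ → δ ≤ M.len h.1 → δ ≤ M.len k.1 → conj hD (pt h δ) = pt k δ :=
    fun δ ha hb hc => h9 δ ha hb (start_add_mem ha hc).1 (start_add_mem ha hc).2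
  -- If one edge were shorter, the vertex at its end would be conjugate to an interior point of the
  -- other.
  have hlen : M.len k.1 = M.len h.1 := by
    rcases lt_trichotomy (M.len k.1) (M.len h.1) with hlt | heq | hlt
    · exfalso
      have h11 := h10 _ (hl _).le hlt.le le_rfl
      rw [pt_len hl] at h11
      obtain ⟨b, hb⟩ := exists_conj_vpt hD hl h2 hv (far k)
      rw [← h11, conj_conj hD hl h2] at hb
      exact pt_ne_vpt (hl _) hlt _ hb
    · exact heq
    · exfalso
      have h11 := h10 _ (hl _).le le_rfl hlt.le
      rw [pt_len hl] at h11
      obtain ⟨b, hb⟩ := exists_conj_vpt hD hl h2 hv (far h)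
      exact pt_ne_vpt (hl _) hlt _ (h11.symm.trans hb)
  refine ⟨k, U, ?_, ?_, hlen, ?_, h8⟩
  · rw [← pt_zero hl, h10 0 le_rfl (hl _).le (hl _).le, pt_zero hl]
  · rw [← pt_len hl, h10 _ (hl _).le le_rfl hlen.ge, ← hlen, pt_len hl]
  · have := hl h.1
    rw [← pt_half, h10 _ (by linarith) (by linarith) (by linarith), ← pt_half, hlen]

end

end Model

end

/-! ### The involution defined by conjugate points. -/

section

open Multigraph

namespace Model

variable {M : Model}

section

variable {D : M.Div} (hD : ∀ x, ∃ x', M.LinEquiv D (M.chip x + M.chip x'))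
  (hl : ∀ e, 0 < M.len e) (h2 : M.TwoEdgeConnected) (hv : ∀ v, 3 ≤ M.valence v)

/-- The conjugate of a vertex. -/
def conjV (a : M.V) : M.V := (exists_conj_vpt hD hl h2 hv a).choose

theorem conj_vpt (a : M.V) : conj hD (M.vpt a) = M.vpt (conjV hD hl h2 hv a) :=
  (exists_conj_vpt hD hl h2 hv a).choose_spec

theorem conjV_conjV (a : M.V) : conjV hD hl h2 hv (conjV hD hl h2 hv a) = a :=
  vpt_injective (by rw [← conj_vpt, ← conj_vpt, conj_conj hD hl h2])

/-- The conjugate of an edge. -/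
theorem exists_conj_edge (e : M.E) : ∃ e',
    conj hD (M.edgePoint e (M.len e / 2)) = M.edgePoint e' (M.len e' / 2) ∧
    M.len e' = M.len e ∧
    ((M.src e' = conjV hD hl h2 hv (M.src e) ∧ M.tgt e' = conjV hD hl h2 hv (M.tgt e)) ∨
      (M.src e' = conjV hD hl h2 hv (M.tgt e) ∧ M.tgt e' = conjV hD hl h2 hv (M.src e))) ∧
    (e' = e → conjV hD hl h2 hv (M.src e) = M.tgt e) ∧
    (e' ≠ e → ∃ U : Set M.V, M.src e ∈ U ∧ conjV hD hl h2 hv (M.src e) ∈ U ∧ M.tgt e ∉ U ∧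
      ∀ x, x ≠ e → x ≠ e' → (M.src x ∈ U ↔ M.tgt x ∈ U)) := by
  obtain ⟨⟨e', b⟩, U, h3, h4, h5, h6, h7⟩ := exists_conj_halfEdge hD hl h2 hv (e, true)
  rw [conj_vpt hD hl h2 hv] at h3 h4
  have h3 := vpt_injective h3
  have h4 := vpt_injective h4
  simp only [base, far, cond_true, sgn] at h3 h4 h7
  refine ⟨e', h6, h5, ?_, ?_, fun hne => ⟨U, ?_⟩⟩
  · cases b
    · exact Or.inr ⟨h4.symm, h3.symm⟩
    · exact Or.inl ⟨h3.symm, h4.symm⟩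
  · rintro rfl
    cases b
    · exact h3
    -- The same half-edge taken twice would be a jump of two along a single edge.
    · have := h7 e'
      simp only [if_true, cond_true] at this
      split_ifs at this <;> omega
  · have h8 := h7 e
    rw [if_pos rfl, if_neg hne] at h8
    have h9 : M.src e ∈ U ∧ M.tgt e ∉ U := by
      split_ifs at h8 with h10 h11 h11 <;> first | omega | exact ⟨h11, h10⟩
    refine ⟨h9.1, ?_, h9.2, fun x hx hx' => ?_⟩
    · have h10 := h7 e'
      rw [if_neg (Ne.symm hne), if_pos rfl] at h10
      rw [h3]
      cases b
      · simp only [cond_false] at h10 ⊢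
        split_ifs at h10 with h11 h12 h12 <;> omega
      · simp only [cond_true] at h10 ⊢
        split_ifs at h10 with h11 h12 h12 <;> omega
    · have h10 := h7 x
      rw [if_neg (Ne.symm hx), if_neg (Ne.symm hx')] at h10
      split_ifs at h10 with h11 h12 h12 <;> first | omega | tauto

/-- The conjugate edge. -/
def conjE (e : M.E) : M.E := (exists_conj_edge hD hl h2 hv e).choose

/-- An edge is recognised by its midpoint, so involutivity passes from points to edges. -/
theorem conjE_conjE (e : M.E) : conjE hD hl h2 hv (conjE hD hl h2 hv e) = e := by
  have h3 := (exists_conj_edge hD hl h2 hv e).choose_spec.1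
  have h4 := (exists_conj_edge hD hl h2 hv (conjE hD hl h2 hv e)).choose_spec.1
  have h5 := congrArg (conj hD) h3
  rw [conj_conj hD hl h2] at h5
  have := hl e
  exact (edgePoint_injOn ⟨by linarith, by linarith⟩ (h5.trans h4)).1

end

/-- The hyperelliptic involution of a 2-edge-connected hyperelliptic metric graph. -/
theorem exists_hypInv {D : M.Div} (hD : ∀ x, ∃ x', M.LinEquiv D (M.chip x + M.chip x'))
    (hl : ∀ e, 0 < M.len e) (h2 : M.TwoEdgeConnected) (hv : ∀ v, 3 ≤ M.valence v) :
    ∃ H : HypInv M.toMultigraph ∅, ∀ e, M.len (H.onE e) = M.len e := by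
  set ι := conjV hD hl h2 hv with hι
  set ε := conjE hD hl h2 hv with hε
  have hspec := fun e => (exists_conj_edge hD hl h2 hv e).choose_spec
  have hends : ∀ e, (M.src (ε e) = ι (M.src e) ∧ M.tgt (ε e) = ι (M.tgt e)) ∨
      (M.src (ε e) = ι (M.tgt e) ∧ M.tgt (ε e) = ι (M.src e)) := fun e => (hspec e).2.2.1
  have hιι : ∀ v, ι (ι v) = v := conjV_conjV hD hl h2 hv
  have hεε : ∀ e, ε (ε e) = e := conjE_conjE hD hl h2 hv
  refine ⟨{
    onV := ι
    onE := ε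
    isBridge := fun e he => he.elim
    onV_congr := fun h => by rw [join_empty.1 h]
    onV_onV := fun v => join_empty.2 (hιι v)
    onE_onE := hεε
    onE_of_mem := fun e he => he.elim
    ends := fun e _ => by simpa only [join_empty] using hends e
    flip := fun e _ he => join_empty.2 ((hspec e).2.2.2.1 he)
    cut := fun e he => ?_ }, fun e => (hspec e).2.1⟩
  obtain ⟨U, hU1, hU2, hU3, hU4⟩ := (hspec e).2.2.2.2 he
  -- The sublevel set `U` need not be invariant. It is replaced by the components of `M.src e` and
  -- of its conjugate after removal of the two edges: their union is invariant and lies in `U`, so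
  -- it does not contain `M.tgt e`.
  set J := M.joinSetoid {x | x ≠ e ∧ x ≠ ε e} with hJ
  have hJι : ∀ {a b}, J a b → J (ι a) (ι b) := fun h => by
    refine join_map ι (fun x hx => ?_) h
    have hx' : ε x ≠ e ∧ ε x ≠ ε e :=
      ⟨fun h => hx.2 (by rw [← h, hεε]), fun h => hx.1 (by rw [← hεε x, h, hεε])⟩
    have h3 := join_edge (S := {x | x ≠ e ∧ x ≠ ε e}) hx'
    rcases hends x with h4 | h4 <;> rw [h4.1, h4.2] at h3
    · exact h3
    · exact Setoid.symm' _ h3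
  have hJU : ∀ {a b}, J a b → (a ∈ U ↔ b ∈ U) := fun h =>
    join_mem_iff (fun x hx => hU4 x hx.1 hx.2) h
  refine ⟨{v | J (M.src e) v ∨ J (ι (M.src e)) v}, fun v => ⟨?_, ?_⟩, ?_, fun x hx hx' => ?_⟩
  · rintro (h | h)
    · have := hJι h
      rw [hιι] at this
      exact Or.inr this
    · have := hJι h
      rw [hιι, hιι] at this
      exact Or.inl this
  · rintro (h | h)
    · exact Or.inr (hJι h)
    · have := hJι h
      rw [hιι] at this
      exact Or.inl this
  · refine fun h => ?_
    rcases h.1 (Or.inl (J.refl _)) with h | h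
    · exact hU3 ((hJU h).1 hU1)
    · exact hU3 ((hJU h).1 hU2)
  · have h3 : J (M.src x) (M.tgt x) := join_edge (S := {x | x ≠ e ∧ x ≠ ε e}) ⟨hx, hx'⟩
    exact or_congr ⟨fun h => Setoid.trans' _ h h3, fun h => Setoid.trans' _ h (Setoid.symm' _ h3)⟩
      ⟨fun h => Setoid.trans' _ h h3, fun h => Setoid.trans' _ h (Setoid.symm' _ h3)⟩

end Model

end

/-! ### From hyperelliptic metric graphs to involutions of weighted graphs. -/

section

open Multigraph

namespace WGraph

variable {G : WGraph}

theorem join_addLoops {S : Set G.E} {a b : G.V} :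
    G.addLoops.joinSetoid (Sum.inl '' S) a b ↔ G.joinSetoid S a b := by
  constructor
  · refine join_map (G := G.addLoops) (H := G.toMultigraph) id ?_
    rintro _ ⟨e, he, rfl⟩
    exact join_edge (G := G.toMultigraph) he
  · exact join_map (G := G.toMultigraph) (H := G.addLoops) id fun e he =>
      join_edge (G := G.addLoops) (S := Sum.inl '' S) (e := Sum.inl e) ⟨e, he, rfl⟩

theorem bridges_addLoops (hc : G.Connected) :
    {e | G.addLoops.IsBridge e} = Sum.inl '' {e | G.IsBridge e} := by
  ext e
  rcases e with e | p
  · constructor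
    · exact fun h => ⟨e, isBridge_addLoops.1 h, rfl⟩
    · rintro ⟨e', h, he⟩
      rw [← Sum.inl_injective he]
      exact isBridge_addLoops.2 h
  · constructor
    · exact fun h => (not_isBridge_loop hc p h).elim
    · rintro ⟨e', h, he⟩
      cases he

/-- With `valence_pos`, this raises the valence of weighted vertices to at least three, provided
there is an edge. -/
theorem valence_addLoops (v : G.V) : G.valence v + 2 * G.w v ≤ G.addLoops.valence v := by
  have key : ∀ (f : G.E → G.V) (f' : G.addLoops.E → G.V), (∀ e, f' (Sum.inl e) = f e) →
      (∀ p, f' (Sum.inr p) = p.1) →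
      Nat.card {e // f e = v} + G.w v ≤ Nat.card {e // f' e = v} := by
    intro f f' h1 h2
    let F : {e // f e = v} ⊕ Fin (G.w v) → {e // f' e = v} := fun x =>
      Sum.elim (fun e => ⟨Sum.inl e.1, (h1 _).trans e.2⟩) (fun i => ⟨Sum.inr ⟨v, i⟩, h2 _⟩) x
    have hF : Function.Injective F := by
      rintro (e | i) (e' | i') h
      · exact congrArg Sum.inl (Subtype.ext (Sum.inl_injective (congrArg Subtype.val h)))
      · cases congrArg Subtype.val h
      · cases congrArg Subtype.val h
      · have := Sum.inr_injective (congrArg Subtype.val h)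
        exact congrArg Sum.inr (by simpa using this)
    have := Nat.card_le_card_of_injective F hF
    rwa [Nat.card_sum, Nat.card_eq_fintype_card (α := Fin _), Fintype.card_fin] at this
  have h1 := key G.src G.addLoops.src (fun _ => rfl) fun _ => rfl
  have h2 := key G.tgt G.addLoops.tgt (fun _ => rfl) fun _ => rfl
  refine le_trans (le_of_eq ?_) (Nat.add_le_add h1 h2)
  unfold valence
  ring

theorem valence_pos (hc : G.Connected) (hE : Nonempty G.E) (v : G.V) : 1 ≤ G.valence v := by
  by_contra hn
  have h0 : Nat.card {e : G.E // G.src e = v} = 0 ∧ Nat.card {e : G.E // G.tgt e = v} = 0 := by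
    unfold valence at hn; omega
  rw [Finite.card_eq_zero_iff, Finite.card_eq_zero_iff] at h0
  have hs : ∀ e, G.src e ≠ v := fun e he => h0.1.elim ⟨e, he⟩
  have ht : ∀ e, G.tgt e ≠ v := fun e he => h0.2.elim ⟨e, he⟩
  obtain ⟨e⟩ := hE
  exact hs e ((join_mem_iff (U := {v}) (fun e _ => iff_of_false (hs e) (ht e))
    (hc.2 v (G.src e))).1 rfl)

/-- Contracting bridges does not create weight. -/
theorem w_contract_bridges (hc : G.Connected) {B : Set G.E} (hB : ∀ e ∈ B, G.IsBridge e)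
    (hw : ∀ v, G.w v = 0) (c : (G.contract B).V) : (G.contract B).w c = 0 := by
  have h1 := card_component_lt B c fun e he _ => by
    refine ⟨{v | G.joinSetoid {e' | e' ≠ e} (G.src e) v}, fun h => ?_, fun e' _ _ hne => ?_⟩
    · exact (isBridge_iff hc e).1 (hB e he) (h.1 ((G.joinSetoid _).refl _))
    · have h3 := join_edge (G := G.toMultigraph) (S := {e' | e' ≠ e}) hne
      exact ⟨fun h => Setoid.trans' _ h h3, fun h => Setoid.trans' _ h (Setoid.symm' _ h3)⟩
  change G.contractWeight B c = 0
  unfold contractWeight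
  rw [Finset.sum_eq_zero fun v _ => hw v.1]
  omega

end WGraph

/-- An involution on the graph with added loops restricts to the graph. -/
theorem HypInv.exists_wHypInv {G : WGraph} {B : Set G.E} (H : HypInv G.addLoops (Sum.inl '' B)) :
    ∃ H' : WHypInv G B, ∀ e, H.onE (Sum.inl e) = Sum.inl (H'.onE e) := by
  have hloop : ∀ p, H.onE (Sum.inr p) = Sum.inr p := fun p => by
    by_contra h
    obtain ⟨U, _, h2, _⟩ := H.cut _ h
    exact h2 Iff.rfl
  have hinl : ∀ e, ∃ e', H.onE (Sum.inl e) = Sum.inl e' := fun e => by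
    rcases h : H.onE (Sum.inl e) with e' | p
    · exact ⟨e', rfl⟩
    · have := H.onE_onE (Sum.inl e)
      rw [h] at this
      cases (hloop p).symm.trans this
  choose ε hε using hinl
  have hj : ∀ {a b : G.V}, G.addLoops.joinSetoid (Sum.inl '' B) a b → G.joinSetoid B a b :=
    WGraph.join_addLoops.1
  have hnot : ∀ {e}, e ∉ B → (Sum.inl e : G.addLoops.E) ∉ Sum.inl '' B := fun he h => by
    obtain ⟨e', h', heq⟩ := h
    exact he (Sum.inl_injective heq ▸ h')
  refine ⟨{
    onV := H.onV
    onE := ε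
    isBridge := fun e he => WGraph.isBridge_addLoops.1 (H.isBridge _ ⟨e, he, rfl⟩)
    onV_congr := fun h => hj (H.onV_congr (WGraph.join_addLoops.2 h))
    onV_onV := fun v => hj (H.onV_onV v)
    onE_onE := fun e => Sum.inl_injective (by
      have := H.onE_onE (Sum.inl e)
      rw [hε] at this
      exact (hε _).symm.trans this)
    onE_of_mem := fun e he => Sum.inl_injective ((hε e).symm.trans
      (H.onE_of_mem _ ⟨e, he, rfl⟩))
    ends := fun e he => by
      have h := H.ends (Sum.inl e) (hnot he)
      rw [hε] at h
      exact h.imp (fun h => ⟨hj h.1, hj h.2⟩) fun h => ⟨hj h.1, hj h.2⟩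
    flip := fun e he h => hj (H.flip (Sum.inl e) (hnot he) ((hε e).trans (congrArg _ h)))
    cut := fun e he => by
      obtain ⟨U, h1, h2, h3⟩ := H.cut (Sum.inl e) fun h =>
        he (Sum.inl_injective ((hε e).symm.trans h))
      refine ⟨U, h1, h2, fun e' h4 h5 => h3 (Sum.inl e') (fun h => h4 (Sum.inl_injective h))
        fun h => h5 (Sum.inl_injective (h.trans (hε e)))⟩
    weight := fun v hv => by
      refine hj (H.flip (Sum.inr ⟨v, 0, Nat.pos_of_ne_zero hv⟩) ?_ (hloop _))
      rintro ⟨e, _, h⟩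
      cases h }, hε⟩

/-- A hyperelliptic metric graph has a hyperelliptic involution up to bridges. -/
theorem Model.Hyperelliptic.exists_hypInv {M : Model} (h : M.Hyperelliptic)
    (hl : ∀ e, 0 < M.len e) (hc : M.Connected) (hval : ∀ v, 3 ≤ M.valence v) :
    ∃ H : HypInv M.toMultigraph {e | M.IsBridge e}, ∀ e, M.len (H.onE e) = M.len e := by
  obtain ⟨D, hdeg, hrank⟩ := h
  set B : Set M.E := {e | M.IsBridge e} with hB
  let G₀ : WGraph := ⟨M.toMultigraph, fun _ => 0⟩
  -- Rank one completes every point to a divisor equivalent to `D`, and this property survives the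
  -- contraction of bridges.
  have hD : ∀ y, ∃ y', (M.contract B).LinEquiv (M.push B D)
      ((M.contract B).chip y + (M.contract B).chip y') := by
    intro y
    obtain ⟨x, rfl⟩ := proj_surjective B y
    obtain ⟨A, hA, h1⟩ := hrank.1 (M.chip x) (chip_nonneg x) (deg_chip x)
    have h2 := LinEquiv.deg_eq hl h1
    rw [deg_sub, hdeg, deg_chip] at h2
    obtain ⟨x', rfl⟩ := eq_chip_of_deg hA (by omega)
    have h3 : M.LinEquiv D (M.chip x + M.chip x') := h1.congr_sub (by abel)
    refine ⟨M.proj B x', ?_⟩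
    have h4 := IsPrincipal.push hl hc (B := B) (fun _ he => he) h3
    rwa [map_sub, map_add, push_chip, push_chip] at h4
  -- With zero weights, which contracting bridges keeps, stability of the contraction says that its
  -- valences are at least three.
  obtain ⟨H, hH⟩ := Model.exists_hypInv hD (len_contract_pos hl B)
    (WGraph.twoEdgeConnected_contract_bridges (G := G₀) hc) fun c =>
      WGraph.stable_contract (G := G₀) (fun v _ => hval v) c
        (WGraph.w_contract_bridges (G := G₀) hc (fun _ he => he) (fun _ => rfl) c)
  let H₁ : HypInv M.toMultigraph B := HypInv.lift (G := G₀) (Z := B) (fun _ he => he) H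
  refine ⟨H₁, fun e => ?_⟩
  by_cases he : e ∈ B
  · rw [H₁.onE_of_mem e he]
  · have : H₁.onE e = (H.onE ⟨e, he⟩).1 := dif_neg he
    rw [this]
    exact hH ⟨e, he⟩

namespace Curve

/-- A tropical curve for which `Γ^w` is hyperelliptic has a hyperelliptic involution. -/
theorem exists_wHypInv (X : Curve) (hX : X.IsTropical) (ℓ : (Σ v : X.V, Fin (X.w v)) → ℝ)
    (hℓ : ∀ p, 0 < ℓ p) (h : (X.addLoopsModel ℓ).Hyperelliptic) :
    ∃ H : WHypInv X.toWGraph {e | X.IsBridge e}, ∀ e, X.len (H.onE e) = X.len e := by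
  -- Without edges, a vertex of weight one has valence only two in `Γ^w`; the identity serves in
  -- this case.
  by_cases hE : Nonempty X.E
  swap
  · have hE' := not_nonempty_iff.1 hE
    exact ⟨{
      onV := id
      onE := id
      isBridge := fun e => hE'.elim e
      onV_congr := fun h => h
      onV_onV := fun v => (X.joinSetoid _).refl v
      onE_onE := fun e => rfl
      onE_of_mem := fun e _ => rfl
      ends := fun e => hE'.elim e
      flip := fun e => hE'.elim e
      cut := fun e => hE'.elim e
      weight := fun v _ => (X.joinSetoid _).refl v }, fun e => hE'.elim e⟩
  obtain ⟨H₁, hH₁⟩ := h.exists_hypInv (by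
    rintro (e | p)
    · exact hX.2 e
    · exact hℓ p) (WGraph.addLoops_connected hX.1.1) fun v => by
      have h1 := WGraph.valence_addLoops (G := X.toWGraph) v
      have h2 := WGraph.valence_pos hX.1.1 hE v
      have h3 := hX.1.2 v
      change 3 ≤ X.addLoops.valence v
      omega
  obtain ⟨H₂, hH₂⟩ : ∃ H₂ : HypInv X.addLoops (Sum.inl '' {e | X.IsBridge e}),
      ∀ e, (X.addLoopsModel ℓ).len (H₂.onE e) = (X.addLoopsModel ℓ).len e :=
    (WGraph.bridges_addLoops (G := X.toWGraph) hX.1.1) ▸ ⟨H₁, hH₁⟩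
  obtain ⟨H₃, hH₃⟩ := H₂.exists_wHypInv
  refine ⟨H₃, fun e => ?_⟩
  have := hH₂ (Sum.inl e)
  rw [hH₃] at this
  exact this

end Curve

end

/-! ### Relations, cells and curves. -/

section

open Multigraph

/-- The relation whose classes are the orbits of a hyperelliptic involution on the edges. -/
def HypInv.rel {G : Multigraph} {B : Set G.E} (H : HypInv G B) : Setoid G.E where
  r e e' := e' = e ∨ e' = H.onE e
  iseqv := by
    refine ⟨fun _ => Or.inl rfl, ?_, ?_⟩
    · rintro x y (rfl | rfl)
      exacts [Or.inl rfl, Or.inr (H.onE_onE x).symm]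
    · rintro x y z (rfl | rfl) (rfl | rfl)
      exacts [Or.inl rfl, Or.inr rfl, Or.inr rfl, Or.inl (H.onE_onE x)]

theorem Multigraph.join_eq_iff_of_empty {G : Multigraph} {S : Set G.E} (hS : ∀ e, e ∉ S)
    {a b : G.V} : G.joinSetoid S a b ↔ a = b := by
  rw [Set.eq_empty_of_forall_notMem hS, join_empty]

theorem WGraph.contractWeight_of_empty {G : WGraph} {S : Set G.E} (hS : ∀ e, e ∉ S) (v : G.V) :
    G.contractWeight S (Quotient.mk _ v) = G.w v := by
  have h1 : ∀ v', Quotient.mk (G.joinSetoid S) v' = Quotient.mk _ v ↔ v' = v :=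
    fun v' => Quotient.eq.trans (join_eq_iff_of_empty hS)
  have h2 : Nat.card {e : G.E // e ∈ S ∧ Quotient.mk (G.joinSetoid S) (G.src e) =
      Quotient.mk _ v} = 0 := Finite.card_eq_zero_iff.2 ⟨fun e => hS _ e.2.1⟩
  unfold contractWeight
  rw [card_subtype_singleton h1, h2]
  refine Finset.sum_eq_single
    (⟨v, rfl⟩ : {v' : G.V // Quotient.mk (G.joinSetoid S) v' = Quotient.mk _ v})
    (fun b _ hb => (hb (Subtype.ext ((h1 _).1 b.2))).elim) fun h => ?_
  exact (h (by convert Finset.mem_univ _)).elim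

namespace Curve

variable {g : ℕ} {X : Curve}

/-- The classes are the orbits of the involution, which preserves lengths. Uniqueness comes from the
graph alone, whatever the lengths are. -/
theorem existsUnique_rel (hX : X.IsTropical) (hg : X.genus = g)
    {ℓ : (Σ v : X.V, Fin (X.w v)) → ℝ} (hℓ : ∀ p, 0 < ℓ p)
    (h : (X.addLoopsModel ℓ).Hyperelliptic) :
    ∃! r : Setoid X.E, X.constrain r ∈ types g ∧ ∀ e e', r e e' → X.len e = X.len e' := by
  obtain ⟨H, hH⟩ := X.exists_wHypInv hX ℓ hℓ h
  refine ⟨H.rel, ⟨⟨hX.1, hg, CGraph.hyperelliptic_of_wHypInv (X.constrain H.rel) hX.1 H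
    fun _ _ => Iff.rfl⟩, ?_⟩, fun r hr => ?_⟩
  · rintro e _ (rfl | rfl)
    exacts [rfl, (hH e).symm]
  · exact CGraph.Hyperelliptic.rel_unique hX.1.2 hr.1.2.2
      (CGraph.hyperelliptic_of_wHypInv (X.constrain H.rel) hX.1 H fun _ _ => Iff.rfl)

theorem existsUnique_two_rel (hX : X.IsTropical) (hg : X.genus = g) (h2 : X.TwoEdgeConnected)
    {ℓ : (Σ v : X.V, Fin (X.w v)) → ℝ} (hℓ : ∀ p, 0 < ℓ p)
    (h : (X.addLoopsModel ℓ).Hyperelliptic) :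
    ∃! r : Setoid X.E, X.constrain r ∈ twoTypes g ∧ ∀ e e', r e e' → X.len e = X.len e' := by
  obtain ⟨H, hH⟩ : ∃ H : WHypInv X.toWGraph ∅, ∀ e, X.len (H.onE e) = X.len e := by
    have hB : {e | X.IsBridge e} = ∅ :=
      Set.eq_empty_of_forall_notMem (twoEdgeConnected_iff.1 h2).2
    obtain ⟨H, hH⟩ := X.exists_wHypInv hX ℓ hℓ h
    exact hB ▸ ⟨H, hH⟩
  have hT := CGraph.twoHyperelliptic_of_wHypInv (X.constrain H.rel) h2 hX.1.2 H fun _ _ => Iff.rfl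
  refine ⟨H.rel, ⟨⟨hX.1, hg, hT⟩, ?_⟩, fun r hr => ?_⟩
  · rintro e _ (rfl | rfl)
    exacts [rfl, (hH e).symm]
  · exact CGraph.TwoHyperelliptic.rel_unique hX.1.2 hr.1.2.2 hT

/-- A curve is represented by its lengths in the cell of a constrained type. -/
theorem exists_cell (hX : ∀ e, 0 < X.len e) {r : Setoid X.E}
    (hr : ∀ e e', r e e' → X.len e = X.len e') :
    ∃ c : (X.constrain r).Cell, (X.constrain r).cellClass c = Quotient.mk isoSetoid X := by
  let x : (X.constrain r).Orthant := Quotient.lift (fun e => ⟨X.len e, (hX e).le⟩)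
    fun e e' h => Subtype.ext (hr e e' h)
  -- All lengths are positive, so nothing is contracted and the classes of vertices are singletons.
  have hZ : ∀ e : X.E, e ∉ {e | (X.constrain r).lengthOf x e = 0} := fun e he =>
    (hX e).ne' (congrArg NNReal.toReal he)
  refine ⟨Quotient.mk _ x, Eq.symm (Quotient.sound (s := isoSetoid)
    (a := X) (b := (X.constrain r).curveOf x) ⟨⟨Equiv.ofBijective
    (Quotient.mk (X.joinSetoid {e | (X.constrain r).lengthOf x e = 0})) ⟨fun a b h =>
      (join_eq_iff_of_empty (G := X.toMultigraph) hZ).1 (Quotient.exact h), Quotient.mk_surjective⟩, (Equiv.subtypeUnivEquiv hZ).symm,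
      fun e => rfl⟩, fun v => ?_, fun e => rfl⟩)⟩
  exact WGraph.contractWeight_of_empty (G := X.toWGraph) hZ v

end Curve

namespace CGraph

variable {T : CGraph} (x : T.Orthant)

theorem curveOf_isTropical (hT : T.IsType) : (T.curveOf x).IsTropical :=
  ⟨WGraph.isType_contract hT, fun e => NNReal.coe_pos.2 (pos_iff_ne_zero.2 e.2)⟩

/-- Partners are related, so they have equal lengths. Hence the set of edges of length zero is
invariant, and the involution descends to its contraction, preserving lengths. -/
theorem curveOf_hyperelliptic (hT : T.IsType) {B : Set T.E} (H : WHypInv T.toWGraph B)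
    (hr : ∀ e e', T.r e e' ↔ e' = e ∨ e' = H.onE e) : (T.curveOf x).Hyperelliptic := by
  have hlen : ∀ e, T.lengthOf x (H.onE e) = T.lengthOf x e := fun e =>
    congrArg x (Quotient.sound (s := T.r) (Setoid.symm' _ ((hr e _).2 (Or.inr rfl))))
  exact (T.curveOf x).hyperelliptic_of_wHypInv (curveOf_isTropical x hT)
    (H.contract hT.1 {e | T.lengthOf x e = 0} fun e he =>
      (hlen e).trans he) fun e => congrArg NNReal.toReal (hlen e.1)

end CGraph

theorem Space.toClass_injective (C : Set CGraph) : Function.Injective (Space.toClass (C := C)) := by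
  intro a b h
  induction a using Quotient.inductionOn with | _ a => ?_
  induction b using Quotient.inductionOn with | _ b => ?_
  exact Quotient.sound h

/-- A property of the points of a space can be checked on the points of the orthants. -/
theorem Space.forall_of_orthant {C : Set CGraph} {p : Curve.Class → Prop}
    (h : ∀ T ∈ C, ∀ x : T.Orthant, p (Quotient.mk Curve.isoSetoid (T.curveOf x)))
    (a : Space C) : p a.toClass := by
  induction a using Quotient.inductionOn with | _ a => ?_
  obtain ⟨T, c⟩ := a
  induction c using Quotient.inductionOn with | _ x => ?_
  exact h T.1 T.2 x

theorem Space.exists_of_cell {C : Set CGraph} {T : CGraph} (hT : T ∈ C) {κ : Curve.Class}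
    (h : ∃ c, T.cellClass c = κ) : ∃ a : Space C, a.toClass = κ := by
  obtain ⟨c, hc⟩ := h
  exact ⟨Quotient.mk (glueSetoid C) ⟨⟨T, hT⟩, c⟩, hc⟩

end

end TropHyp

end

theorem mainTheorem6 (g : ℕ) :
    -- the points of each space correspond bijectively to isomorphism classes of curves
    Set.BijOn (TropHyp.Space.toClass (C := TropHyp.twoTypes g)) Set.univ
      (TropHyp.twoHypClasses g) ∧
    Set.BijOn (TropHyp.Space.toClass (C := TropHyp.types g)) Set.univ
      (TropHyp.hypClasses g) ∧
    -- a curve that is hyperelliptic for some choice of the lengths of the added loops is a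
    -- positive length assignment on a constrained type for exactly one relation on its edges
    (∀ X : TropHyp.Curve, X.IsTropical → X.genus = g → X.TwoEdgeConnected →
      ∀ ℓ : (Σ v : X.V, Fin (X.w v)) → ℝ, (∀ p, 0 < ℓ p) → (X.addLoopsModel ℓ).Hyperelliptic →
        ∃! r : Setoid X.E, X.constrain r ∈ TropHyp.twoTypes g ∧
          ∀ e e', r e e' → X.len e = X.len e') ∧
    (∀ X : TropHyp.Curve, X.IsTropical → X.genus = g →
      ∀ ℓ : (Σ v : X.V, Fin (X.w v)) → ℝ, (∀ p, 0 < ℓ p) → (X.addLoopsModel ℓ).Hyperelliptic →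
        ∃! r : Setoid X.E, X.constrain r ∈ TropHyp.types g ∧
          ∀ e e', r e e' → X.len e = X.len e') := by
  refine ⟨⟨fun a _ => ?_, (TropHyp.Space.toClass_injective _).injOn, ?_⟩,
    ⟨fun a _ => ?_, (TropHyp.Space.toClass_injective _).injOn, ?_⟩,
    fun X hX hg h2 ℓ hℓ h => TropHyp.Curve.existsUnique_two_rel hX hg h2 hℓ h,
    fun X hX hg ℓ hℓ h => TropHyp.Curve.existsUnique_rel hX hg hℓ h⟩
  · refine TropHyp.Space.forall_of_orthant (p := (· ∈ TropHyp.twoHypClasses g))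
      (fun T hT x => ?_) a
    obtain ⟨H, hr⟩ := hT.2.2.exists_wHypInv
    exact ⟨T.curveOf x, TropHyp.CGraph.curveOf_isTropical x hT.1,
      TropHyp.WGraph.genus_contract.trans hT.2.1,
      TropHyp.WGraph.twoEdgeConnected_contract hT.2.2.1,
      TropHyp.CGraph.curveOf_hyperelliptic x hT.1 H hr, rfl⟩
  · rintro _ ⟨X, hX, hg, h2, h, rfl⟩
    -- One choice of lengths for the added loops is enough; here they all have length one.
    obtain ⟨r, ⟨hT, hr⟩, _⟩ := TropHyp.Curve.existsUnique_two_rel hX hg h2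
      (ℓ := fun _ => 1) (fun _ => one_pos) (h _ fun _ => one_pos)
    obtain ⟨a, ha⟩ := TropHyp.Space.exists_of_cell hT (TropHyp.Curve.exists_cell hX.2 hr)
    exact ⟨a, Set.mem_univ a, ha⟩
  · refine TropHyp.Space.forall_of_orthant (p := (· ∈ TropHyp.hypClasses g))
      (fun T hT x => ?_) a
    obtain ⟨H, hr⟩ := hT.2.2.exists_wHypInv
    exact ⟨T.curveOf x, TropHyp.CGraph.curveOf_isTropical x hT.1,
      TropHyp.WGraph.genus_contract.trans hT.2.1,
      TropHyp.CGraph.curveOf_hyperelliptic x hT.1 H hr, rfl⟩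
  · rintro _ ⟨X, hX, hg, h, rfl⟩
    obtain ⟨r, ⟨hT, hr⟩, _⟩ := TropHyp.Curve.existsUnique_rel hX hg
      (ℓ := fun _ => 1) (fun _ => one_pos) (h _ fun _ => one_pos)
    obtain ⟨a, ha⟩ := TropHyp.Space.exists_of_cell hT (TropHyp.Curve.exists_cell hX.2 hr)
    exact ⟨a, Set.mem_univ a, ha⟩
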